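/- Let $n\ge 1$, $\gamma\in(0,1)$, $T>0$. Write $\widehat f(\xi)=(2\pi)^{-n/2}\int_{\mathbb R^n} f(x)e^{-ix\cdot\xi}\,dx$ (extended to $L^2(\mathbb R^n)$ by Plancherel), $E_{\gamma,1}(z)=\sum_{k\ge 0} z^k/\Gamma(\gamma k+1)$ and $\varphi_\alpha(x)=\alpha^{-n}\varphi(x/\alpha)$. For $g\in L^2(\mathbb R^n)$ (complex-valued), a *solution with final value $g$* is a function $u\in C([0,T],L^2(\mathbb R^n))\cap C((0,T],H^2(\mathbb R^n))$ with $u(\cdot,T)=g$ which satisfies $\frac{\partial^\gamma u}{\partial t^\gamma}=\Delta u$ in $L^2(\mathbb R^n)$ for every $t\in(0,T)$; here $\frac{\partial^\gamma u}{\partial t^\gamma}(t)=\frac1{\Gamma(1-\gamma)}\int_0^t\frac{u'(s)}{(t-s)^\gamma}\,ds$ is the Caputo derivative ($u'$ the derivative in $L^2(\mathbb R^n)$, the integral being improper at $0$). Let $A$ be the bounded operator on $L^2(\mathbb R^n)$ with $\widehat{Af}(\xi)=E_{\gamma,1}(-|\xi|^2T^\gamma)\widehat f(\xi)$. It is the forward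 operator: $Af=g$ if and only if there is a solution $u$ with final value $g$ and $u(\cdot,0)=f$. We say that a kernel $\varphi$ *defines a regularization method* if for all $\alpha>0$ and $g\in L^2(\mathbb R^n)$ the function $\varphi_\alpha\star g$ is in $L^2(\mathbb R^n)$, there is exactly one solution $u_\alpha$ with final value $\varphi_\alpha\star g$, and the maps $R_{\alpha,t}:g\mapsto u_\alpha(\cdot,t)$, $t\in[0,T]$, are bounded linear operators on $L^2(\mathbb R^n)$ such that * whenever $u$ is a solution with final value $g$, $R_{\alpha,t}g\to u(\cdot,t)$ in $L^2(\mathbb R^n)$ as $\alpha\downarrow0$, for every $t\in[0,T]$; * there is a parameter choice $\delta\mapsto\alpha(\delta)>0$ with $\alpha(\delta)\to0$ as $\delta\downarrow 0$, such that whenever $u$ is a solution with final value $g$ and $\|g^\delta-g\|_{L^2}\le\delta$ for all $\delta>0$, $R_{\alpha(\delta),t}\,g^\delta\to u(\cdot,t)$ in $L^2(\mathbb R^n)$ as $\delta\downarrow0$, for every $t\in[0,T]$. **(1)** Let $\varphi:\mathbb R^n\to\mathbb R$ be smooth and integrable with $\int\varphi=1$, and suppose that there is a function $\varrho$ on $(0,\infty)$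 with $$\frac{|\widehat\varphi(\alpha\xi)|}{E_{\gamma,1}(-|\xi|^2T^\gamma)}\le\varrho(\alpha)\qquad\text{for all }\alpha>0,\ \xi\in\mathbb R^n.$$ Then $\varphi$ defines a regularization method. **(2) Approximate inverse.** In the situation of (1), let $\alpha>0$ and $e_\alpha(x,y)=\varphi_\alpha(x-y)$. If $u$ is a solution with final value $g$, then $u_\alpha(\cdot,t)=\varphi_\alpha\star u(\cdot,t)$ for all $t\in[0,T]$; in particular $u_\alpha(x,0)=\int e_\alpha(x,y)\,u(y,0)\,dy$ for almost every $x$. If moreover $\xi\mapsto\widehat\varphi(\alpha\xi)/E_{\gamma,1}(-|\xi|^2T^\gamma)$ is in $L^2(\mathbb R^n)$, then for every $x$ the function $e_\alpha(x,\cdot)$ is in $L^2(\mathbb R^n)$, the adjoint equation $A^*v_{x,\alpha}=e_\alpha(x,\cdot)$ has exactly one solution $v_{x,\alpha}\in L^2(\mathbb R^n)$, and for every $g\in L^2(\mathbb R^n)$, $u_\alpha(x,0)=\langle v_{x,\alpha},g\rangle_{L^2}$ for almost every $x$. **(3) Dirichlet kernel and Fourier regularization.** Let $\varphi(x)=\prod_{j=1}^n\frac{\sin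 x_j}{\pi x_j}$ (which is in $L^2(\mathbb R^n)$ but not in $L^1(\mathbb R^n)$). Then $\varphi_{1/\nu}$ is the Dirichlet kernel $D_\nu(x)=\pi^{-n}\prod_j\frac{\sin(\nu x_j)}{x_j}$ for $\nu>0$; $\widehat\varphi=(2\pi)^{-n/2}\chi_{[-1,1]^n}$ almost everywhere; with this $\widehat\varphi$ the inequality of (1) holds with $\varrho(\alpha)=C(1+1/\alpha^2)$ for some constant $C$ (depending on $n,\gamma,T$); $\varphi$ defines a regularization method; for every $\alpha>0$ all the assertions of (2) hold for $\varphi$; and for $\alpha=1/\nu$ and all $g\in L^2(\mathbb R^n)$, $t\in[0,T]$, $$\widehat{u_{1/\nu}}(\xi,t)=\chi_{[-\nu,\nu]^n}(\xi)\,\frac{E_{\gamma,1}(-|\xi|^2t^\gamma)}{E_{\gamma,1}(-|\xi|^2T^\gamma)}\,\widehat g(\xi)\quad\text{for almost every }\xi,$$ which for $n=1$ is Fourier regularization with cut-off frequency $\xi_{\max}=\nu$. -/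

import Mathlib

open MeasureTheory Filter Topology Set FourierTransform
open scoped Laplacian SchwartzMap ENNReal ContDiff InnerProductSpace

noncomputable section

namespace FractionalDiffusion

/-- The space `ℝⁿ` with its Euclidean norm. -/
abbrev Space (n : ℕ) : Type := EuclideanSpace ℝ (Fin n)

/-- The complex Hilbert space `L²(ℝⁿ)`. -/
abbrev L2 (n : ℕ) : Type := Lp (α := Space n) ℂ 2 volume

/-- The Mittag-Leffler function `E_{γ,1}` on the real line. -/
def mittagLeffler (γ x : ℝ) : ℝ := ∑' k : ℕ, x ^ k / Real.Gamma (γ * k + 1)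

/-- The symbol `ξ ↦ E_{γ,1}(-|ξ|² t^γ)`. -/
def symbol {n : ℕ} (γ t : ℝ) (ξ : Space n) : ℝ := mittagLeffler γ (-(‖ξ‖ ^ 2 * t ^ γ))

/-- The Fourier transform `(2π)^{-n/2} ∫ φ(x) e^{-i x·ξ} dx` of an integrable real function. -/
def fourierL1 {n : ℕ} (φ : Space n → ℝ) (ξ : Space n) : ℂ :=
  (((2 * Real.pi) ^ (-(n : ℝ) / 2) : ℝ) : ℂ) *
    ∫ x, Complex.exp (-((⟪x, ξ⟫_ℝ : ℝ) : ℂ) * Complex.I) * (φ x : ℂ)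

/-- The Fourier-Plancherel transform on `L²(ℝⁿ)` in the same convention, i.e. the extension of
`(2π)^{-n/2} ∫ f(x) e^{-i x·ξ} dx`; Mathlib's `𝓕` has the kernel `e^{-2π i x·ξ}` instead. -/
def fourierL2 {n : ℕ} (f : L2 n) (ξ : Space n) : ℂ :=
  (((2 * Real.pi) ^ (-(n : ℝ) / 2) : ℝ) : ℂ) * (𝓕 f : L2 n) ((2 * Real.pi)⁻¹ • ξ)

/-- The norm of `H^s(ℝⁿ)` on `L²(ℝⁿ)`, with value `∞` exactly outside `H^s(ℝⁿ)` (for `s ≥ 0`). -/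
def sobolevENorm {n : ℕ} (s : ℝ) (f : L2 n) : ℝ≥0∞ :=
  eLpNorm (fun ξ : Space n => (((1 + ‖ξ‖ ^ 2) ^ (s / 2) : ℝ) : ℂ) * fourierL2 f ξ) 2 volume

/-- `w` is the Caputo derivative `Γ(1-γ)⁻¹ ∫₀ᵗ (t-s)^{-γ} u'(s) ds` of order `γ` at `t` of the
vector-valued function `u`. Here `u'` is the norm derivative, and the integral is a Bochner
integral over `(ε, t)`, taken as an improper integral at the end point `0`, where `u'` need not
be absolutely integrable. -/
def HasCaputoDerivAt {X : Type*} [NormedAddCommGroup X] [NormedSpace ℝ X]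
    (γ : ℝ) (u : ℝ → X) (w : X) (t : ℝ) : Prop :=
  DifferentiableOn ℝ u (Ioo 0 t) ∧
  (∀ ε ∈ Ioo 0 t, IntervalIntegrable (fun s => (t - s) ^ (-γ) • deriv u s) volume ε t) ∧
  Tendsto (fun ε => (Real.Gamma (1 - γ))⁻¹ • ∫ s in ε..t, (t - s) ^ (-γ) • deriv u s)
    (𝓝[>] 0) (𝓝 w)

/-- `u` is a solution on `[0, T]` of `∂^γ u / ∂t^γ = Δ u` with the final value `u(·, T) = g`:
`u ∈ C([0,T], L²) ∩ C((0,T], H²)`, and the equation holds in `L²` for every `t ∈ (0,T)`, where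
the Laplacian is the distributional one. As `u` is continuous into `H²` at `T`, the condition
`u T = g` also says that `u(·, t) → g` in `H²` as `t → T`. -/
structure IsSolution {n : ℕ} (γ T : ℝ) (g : L2 n) (u : ℝ → L2 n) : Prop where
  continuousOn : ContinuousOn u (Icc 0 T)
  mem_sobolev : ∀ t ∈ Ioc 0 T, sobolevENorm 2 (u t) < ⊤
  continuousOn_sobolev : ∀ t ∈ Ioc 0 T,
    Tendsto (fun s => sobolevENorm 2 (u s - u t)) (𝓝[Ioc 0 T] t) (𝓝 0)
  equation : ∀ t ∈ Ioo 0 T, ∃ w : L2 n, HasCaputoDerivAt γ u w t ∧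
    (w : 𝓢'(Space n, ℂ)) = Δ (u t : 𝓢'(Space n, ℂ))
  final : u T = g

/-- The rescaled kernel `φ_α(x) = α^{-n} φ(x/α)`. -/
def dilate {n : ℕ} (φ : Space n → ℝ) (α : ℝ) (x : Space n) : ℝ :=
  (α ^ n)⁻¹ * φ (α⁻¹ • x)

/-- `h = φ_α ⋆ f` in `L²(ℝⁿ)`, the convolution integral being absolutely convergent
almost everywhere. -/
def IsMollification {n : ℕ} (φ : Space n → ℝ) (α : ℝ) (f h : L2 n) : Prop :=
  ∀ᵐ x : Space n, Integrable (fun y : Space n => (dilate φ α (x - y) : ℂ) * f y) ∧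
    h x = ∫ y : Space n, (dilate φ α (x - y) : ℂ) * f y

/-- The family `(R α t)` of bounded operators on `L²(ℝⁿ)` is a regularization method for
recovering `u(·, t)`, `0 ≤ t ≤ T`, from the final value `g = u(·, T)`: it converges pointwise on
all attainable data, and there is a parameter choice `δ ↦ a δ` for which the reconstructions from
noisy data of noise level `δ` converge to the solution as `δ ↓ 0`. -/
structure IsRegularizationMethod {n : ℕ} (γ T : ℝ) (R : ℝ → ℝ → (L2 n →L[ℂ] L2 n)) : Prop where
  tendsto : ∀ (g : L2 n) (u : ℝ → L2 n), IsSolution γ T g u → ∀ t ∈ Icc 0 T,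
    Tendsto (fun α => R α t g) (𝓝[>] 0) (𝓝 (u t))
  parameter_choice : ∃ a : ℝ → ℝ, (∀ δ > 0, 0 < a δ) ∧ Tendsto a (𝓝[>] 0) (𝓝 0) ∧
    ∀ (g : L2 n) (u : ℝ → L2 n), IsSolution γ T g u → ∀ t ∈ Icc 0 T,
      ∀ gδ : ℝ → L2 n, (∀ δ > 0, ‖gδ δ - g‖ ≤ δ) →
        Tendsto (fun δ => R (a δ) t (gδ δ)) (𝓝[>] 0) (𝓝 (u t))

/-- The solutions `u_α` with the final values `φ_α ⋆ g` define a regularization method: for all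
`α > 0` and `g ∈ L²(ℝⁿ)` the function `φ_α ⋆ g` is in `L²(ℝⁿ)`, there is exactly one solution
`u_α` on `[0, T]` with this final value, and the operators `R α t : g ↦ u_α(·, t)` are a
regularization method. -/
def DefinesRegularizationMethod {n : ℕ} (γ T : ℝ) (φ : Space n → ℝ) : Prop :=
  ∃ (M : ℝ → L2 n → L2 n) (R : ℝ → ℝ → (L2 n →L[ℂ] L2 n)),
    (∀ α > 0, ∀ g, IsMollification φ α g (M α g)) ∧
    (∀ α > 0, ∀ g, IsSolution γ T (M α g) (fun t => R α t g)) ∧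
    (∀ α > 0, ∀ g u, IsSolution γ T (M α g) u → EqOn u (fun t => R α t g) (Icc 0 T)) ∧
    IsRegularizationMethod γ T R

/-- `|ψ(αξ)| / E_{γ,1}(-|ξ|² T^γ) ≤ ϱ(α)` for all `α > 0` and all `ξ`. -/
def KernelCondition {n : ℕ} (γ T : ℝ) (ψ : Space n → ℂ) (ϱ : ℝ → ℝ) : Prop :=
  ∀ α > 0, ∀ ξ : Space n, ‖ψ (α • ξ)‖ / symbol γ T ξ ≤ ϱ α

/-- `A` is the operator `𝓕⁻¹ E_{γ,1}(-|ξ|² T^γ) 𝓕`. -/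
def IsForwardOperator {n : ℕ} (γ T : ℝ) (A : L2 n →L[ℂ] L2 n) : Prop :=
  ∀ f : L2 n, fourierL2 (A f) =ᵐ[volume] fun ξ => (symbol γ T ξ : ℂ) * fourierL2 f ξ

/-- For exact data `g = u(·, T)` one has `u_α(·, t) = φ_α ⋆ u(·, t)` for all `t ∈ [0, T]`; at
`t = 0` this reads `u_α(x, 0) = ⟨e_α(x, ·), u(·, 0)⟩` with `e_α(x, y) = φ_α(x - y)`. -/
def MollifiesSolution {n : ℕ} (γ T : ℝ) (φ : Space n → ℝ) (α : ℝ) : Prop :=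
  ∀ (g h : L2 n) (u uα : ℝ → L2 n), IsSolution γ T g u → IsMollification φ α g h →
    IsSolution γ T h uα → ∀ t ∈ Icc 0 T, IsMollification φ α (u t) (uα t)

/-- For every `x` the function `e_α(x, y) = φ_α(x - y)` of `y` is in `L²(ℝⁿ)`, the adjoint
equation `A* v_x = e_α(x, ·)` has exactly one solution `v_x ∈ L²(ℝⁿ)`, and
`u_α(x, 0) = ⟨v_x, g⟩` for every `g ∈ L²(ℝⁿ)` and almost every `x`. -/
def HasReconstructionKernel {n : ℕ} (γ T : ℝ) (A : L2 n →L[ℂ] L2 n) (φ : Space n → ℝ)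
    (α : ℝ) : Prop :=
  ∃ e v : Space n → L2 n,
    (∀ x, e x =ᵐ[volume] fun y => (dilate φ α (x - y) : ℂ)) ∧
    (∀ x w, ContinuousLinearMap.adjoint A w = e x ↔ w = v x) ∧
    ∀ (g h : L2 n) (uα : ℝ → L2 n), IsMollification φ α g h → IsSolution γ T h uα →
      ∀ᵐ x : Space n, uα 0 x = ⟪v x, g⟫_ℂ

/-- The Dirichlet kernel `D_ν(x) = π^{-n} ∏ⱼ sin(ν xⱼ) / xⱼ`, with its continuous extension to
the points where some `xⱼ = 0`. -/
def dirichletKernel (n : ℕ) (ν : ℝ) (x : Space n) : ℝ :=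
  ∏ j, (ν / Real.pi * Real.sinc (ν * x j))

/-- The characteristic function of the cube `{ξ : |ξⱼ| ≤ ν for all j}`. -/
def cubeIndicator (n : ℕ) (ν : ℝ) : Space n → ℂ :=
  Set.indicator {ξ : Space n | ∀ j, |ξ j| ≤ ν} (fun _ => 1)

end FractionalDiffusion

end

open FractionalDiffusion

/-! On the Fourier side the equation decouples into the relaxation equations `∂^γ y = -l y`, `l =
|ξ|²`, solved by `y(t) = E_{γ,1}(-l t^γ)`. Solution operators, mollifications and reconstructions
are therefore Fourier multipliers. The analytic work lies in bounds on `y` that are uniform in `l`.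

These bounds come from one extremal principle, `HasCaputoDerivAt.rpow_mul_sub_le`: at a maximum over
`[0, t]` attained at `t`, the Caputo derivative is bounded below. Termwise computation with Beta
integrals gives the equations satisfied by `y` and by `z = t y'`. The principle then yields `0 < y ≤
1`, `-γ ≤ z ≤ 0`, monotonicity of `y` and `1/y ≤ 1 + Γ(1-γ) t^γ l`. Estimating the truncated Caputo
integral of `y` with these facts gives `l y(t) ≤ C(t)`. Uniformity in `l` permits dominated
convergence in `L²`, so the flow with symbol `y` is continuous into `H²` for positive times and
satisfies the equation (`hasCaputoDerivAt_flow`, `isSolution_flow`).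

Uniqueness uses the same principle: if `d` is a difference of solutions with `d 0 = 0` and `‖d‖` is
maximal at `r`, it is applied to `s ↦ Re ⟪d r, d s⟫`, and `Re ⟪d, Δ d⟫ ≤ 0` forces `d r = 0`. Hence
every solution is an orbit of the flow, and since the symbol never vanishes the final value
determines it.

If mollification has symbol `Ψ_α`, the reconstruction at time `t` has symbol `E_t Ψ_α / E_T`. On
exact data this is the flow of the mollified initial value and converges because `Ψ_α → 1`
boundedly. On noise of size `δ` it costs at most `δ ϱ(α)`, and `α(δ)` is made to decrease slowly
enough that this tends to zero. `IsMollifierSymbol` isolates what is needed of the kernel. It is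
verified for integrable kernels by Young's inequality and density of Schwartz functions, and for the
Dirichlet kernel by pairing `f` in `L²` with translates of the kernel. The reconstruction kernel is
the inverse transform of `e^{-i x·ξ} conj(Ψ_α) / E_T`. -/

noncomputable section

namespace FractionalDiffusion

section

/-! ### Extremal principle for the Caputo derivative -/

/-- If `f` attains its maximum over `[0, t]` at `t`, then its Caputo derivative at `t` is at least
`t^{-γ} (f t - f 0) / Γ(1-γ)`. -/
theorem HasCaputoDerivAt.rpow_mul_sub_le {γ t w : ℝ} {f : ℝ → ℝ} (hγ : γ ∈ Ioo (0 : ℝ) 1)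
    (ht : 0 < t) (h : HasCaputoDerivAt γ f w t) (hc : ContinuousOn f (Icc 0 t))
    (hd : DifferentiableAt ℝ f t) (hmax : ∀ s ∈ Icc 0 t, f s ≤ f t) :
    t ^ (-γ) * (f t - f 0) ≤ Real.Gamma (1 - γ) * w := by
  obtain ⟨hdiff, hint, hlim⟩ := h
  have hG : 0 < Real.Gamma (1 - γ) := Real.Gamma_pos_of_pos (by linarith [hγ.2])
  have key : ∀ ε ∈ Ioo 0 t, (t - ε) ^ (-γ) * (f t - f ε) ≤
      ∫ s in ε..t, (t - s) ^ (-γ) • deriv f s := by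
    intro ε hε
    -- This is integration by parts written as an inequality. The comparison function has derivative
    -- `(t-s)^{-γ} f'(s)` minus `γ (t-s)^{-γ-1} (f t - f s)`, and the subtracted term is nonnegative
    -- by maximality. No integrability of that term is needed.
    have hcont : ContinuousOn (fun s => -((t - s) ^ (-γ) * (f t - f s))) (Icc ε t) := by
      intro s hs
      rcases hs.2.lt_or_eq with hst | rfl
      · have h1 : ContinuousWithinAt f (Icc ε t) s :=
          (hc s ⟨hε.1.le.trans hs.1, hs.2⟩).mono (Icc_subset_Icc_left hε.1.le)
        have h2 : ContinuousAt (fun s : ℝ => (t - s) ^ (-γ)) s :=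
          (continuousAt_const.sub continuousAt_id).rpow_const (Or.inl (sub_pos.2 hst).ne')
        exact (h2.continuousWithinAt.mul (continuousWithinAt_const.sub h1)).neg
      -- At the right end the singular kernel meets a zero of `f t - f s`: differentiability gives
      -- `O(t-s)`, so the product is `O((t-s)^{1-γ})`.
      · obtain ⟨C, hC⟩ := (hd.hasDerivAt.isBigO_sub).bound
        have h0 : Tendsto (fun r : ℝ => |C| * |s - r| ^ (1 - γ)) (𝓝[Icc ε s] s) (𝓝 0) := by
          have : ContinuousAt (fun r : ℝ => |C| * |s - r| ^ (1 - γ)) s :=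
            continuousAt_const.mul
              ((continuousAt_const.sub continuousAt_id).abs.rpow_const
                (Or.inr (by linarith [hγ.2])))
          have := this.tendsto
          simp only [sub_self, abs_zero] at this
          rw [Real.zero_rpow (by linarith [hγ.2]), mul_zero] at this
          exact this.mono_left nhdsWithin_le_nhds
        have : -((s - s) ^ (-γ) * (f s - f s)) = 0 := by simp
        unfold ContinuousWithinAt
        beta_reduce
        rw [this]
        refine squeeze_zero_norm' ?_ h0
        filter_upwards [nhdsWithin_le_nhds hC, self_mem_nhdsWithin] with r hr hrs
        rcases hrs.2.lt_or_eq with hlt | rfl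
        · have hp : 0 < s - r := sub_pos.2 hlt
          rw [norm_neg, norm_mul, Real.norm_of_nonneg (Real.rpow_nonneg hp.le _), abs_of_pos hp,
            norm_sub_rev]
          rw [norm_sub_rev r s, Real.norm_of_nonneg hp.le] at hr
          calc (s - r) ^ (-γ) * ‖f r - f s‖ ≤ (s - r) ^ (-γ) * (|C| * (s - r)) := by
                gcongr
                exact hr.trans (by gcongr; exact le_abs_self C)
            _ = |C| * (s - r) ^ (1 - γ) := by
                rw [sub_eq_add_neg 1 γ, Real.rpow_add hp, Real.rpow_one]; ring
        · simp
          positivity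
    have hsub := intervalIntegral.sub_le_integral_of_hasDeriv_right_of_le (a := ε) (b := t)
      (g := fun s => -((t - s) ^ (-γ) * (f t - f s)))
      (g' := fun s => -((-1 * (-γ) * (t - s) ^ (-γ - 1)) * (f t - f s) +
        (t - s) ^ (-γ) * (0 - deriv f s)))
      (φ := fun s => (t - s) ^ (-γ) • deriv f s) hε.2.le hcont ?_ ?_ ?_
    · simpa using hsub
    · intro s hs
      have hs0 : s ∈ Ioo 0 t := ⟨hε.1.trans hs.1, hs.2⟩
      have h1 : HasDerivAt f (deriv f s) s :=
        ((hdiff s hs0).differentiableAt (Ioo_mem_nhds hs0.1 hs0.2)).hasDerivAt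
      have h2 : HasDerivAt (fun s : ℝ => t - s) (-1) s := by
        simpa using (hasDerivAt_id s).const_sub t
      have h3 := h2.rpow_const (p := -γ) (Or.inl (sub_pos.2 hs.2).ne')
      exact ((h3.mul ((hasDerivAt_const s (f t)).sub h1)).neg).hasDerivWithinAt
    · have := hint ε hε
      rwa [intervalIntegrable_iff_integrableOn_Icc_of_le hε.2.le] at this
    · intro s hs
      have hp : 0 < t - s := sub_pos.2 hs.2
      have h1 := hmax s ⟨hε.1.le.trans hs.1.le, hs.2.le⟩
      have h2 : 0 ≤ γ * (t - s) ^ (-γ - 1) * (f t - f s) :=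
        mul_nonneg (mul_nonneg hγ.1.le (Real.rpow_nonneg hp.le _)) (sub_nonneg.2 h1)
      simp only [smul_eq_mul]
      linarith
  -- Letting `ε ↓ 0` uses only continuity of `f` at `0`; the derivative may be singular there.
  have hmem : Ioo 0 t ∈ 𝓝[>] (0 : ℝ) := Ioo_mem_nhdsGT ht
  have hL : Tendsto (fun ε => (Real.Gamma (1 - γ))⁻¹ * ((t - ε) ^ (-γ) * (f t - f ε))) (𝓝[>] 0)
      (𝓝 ((Real.Gamma (1 - γ))⁻¹ * ((t - 0) ^ (-γ) * (f t - f 0)))) := by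
    have h1 : Tendsto f (𝓝[>] 0) (𝓝 (f 0)) :=
      ((hc 0 ⟨le_rfl, ht.le⟩).tendsto).mono_left
        (le_inf nhdsWithin_le_nhds (le_principal_iff.2 (mem_of_superset hmem Ioo_subset_Icc_self)))
    have h2 : ContinuousAt (fun s : ℝ => (t - s) ^ (-γ)) 0 :=
      (continuousAt_const.sub continuousAt_id).rpow_const (Or.inl (by simpa using ht.ne'))
    exact ((h2.tendsto.mono_left nhdsWithin_le_nhds).mul (tendsto_const_nhds.sub h1)).const_mul _
  have := le_of_tendsto_of_tendsto hL hlim (by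
    filter_upwards [hmem] with ε hε
    rw [smul_eq_mul]
    exact mul_le_mul_of_nonneg_left (key ε hε) (inv_nonneg.2 hG.le))
  rw [sub_zero] at this
  rwa [inv_mul_le_iff₀ hG] at this

/-- The Caputo derivative commutes with continuous linear maps. -/
theorem HasCaputoDerivAt.clm_comp {X Y : Type*} [NormedAddCommGroup X] [NormedSpace ℝ X]
    [CompleteSpace X] [NormedAddCommGroup Y] [NormedSpace ℝ Y] [CompleteSpace Y]
    {γ t : ℝ} {u : ℝ → X} {w : X} (L : X →L[ℝ] Y) (ht : 0 < t)
    (h : HasCaputoDerivAt γ u w t) :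
    HasCaputoDerivAt γ (fun s => L (u s)) (L w) t := by
  obtain ⟨hd, hi, hl⟩ := h
  have hderiv : ∀ s ∈ Ioo 0 t, deriv (fun s => L (u s)) s = L (deriv u s) := fun s hs =>
    (L.hasFDerivAt.comp_hasDerivAt s
      ((hd s hs).differentiableAt (Ioo_mem_nhds hs.1 hs.2)).hasDerivAt).deriv
  have heq : ∀ ε ∈ Ioo 0 t, EqOn (fun s => (t - s) ^ (-γ) • deriv (fun s => L (u s)) s)
      (fun s => L ((t - s) ^ (-γ) • deriv u s)) (uIoo ε t) := by
    intro ε hε s hs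
    rw [uIoo_of_le hε.2.le] at hs
    simp only [map_smul]
    rw [hderiv s ⟨hε.1.trans hs.1, hs.2⟩]
  have hLi : ∀ ε ∈ Ioo 0 t, IntervalIntegrable
      (fun s => L ((t - s) ^ (-γ) • deriv u s)) volume ε t := fun ε hε =>
    ⟨L.integrable_comp (hi ε hε).1, L.integrable_comp (hi ε hε).2⟩
  refine ⟨fun s hs => L.differentiableAt.comp_differentiableWithinAt s (hd s hs), ?_, ?_⟩
  · intro ε hε
    exact (hLi ε hε).congr_uIoo (heq ε hε).symm
  · refine ((L.continuous.tendsto w).comp hl).congr' ?_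
    filter_upwards [Ioo_mem_nhdsGT ht] with ε hε
    simp only [Function.comp, map_smul]
    rw [← L.intervalIntegral_comp_comm (hi ε hε)]
    congr 1
    exact intervalIntegral.integral_congr_uIoo (heq ε hε).symm

/-- The Caputo derivative of a difference. -/
theorem HasCaputoDerivAt.sub {X : Type*} [NormedAddCommGroup X] [NormedSpace ℝ X]
    {γ t : ℝ} {u v : ℝ → X} {w z : X} (ht : 0 < t) (hu : HasCaputoDerivAt γ u w t)
    (hv : HasCaputoDerivAt γ v z t) : HasCaputoDerivAt γ (fun s => u s - v s) (w - z) t := by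
  obtain ⟨hd, hi, hl⟩ := hu
  obtain ⟨hd', hi', hl'⟩ := hv
  have heq : ∀ ε ∈ Ioo 0 t, EqOn (fun s => (t - s) ^ (-γ) • deriv (fun s => u s - v s) s)
      (fun s => (t - s) ^ (-γ) • deriv u s - (t - s) ^ (-γ) • deriv v s) (uIoo ε t) := by
    intro ε hε s hs
    rw [uIoo_of_le hε.2.le] at hs
    have hn : Ioo 0 t ∈ 𝓝 s := Ioo_mem_nhds (hε.1.trans hs.1) hs.2
    have hs' : s ∈ Ioo 0 t := ⟨hε.1.trans hs.1, hs.2⟩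
    simp only
    rw [deriv_fun_sub ((hd s hs').differentiableAt hn) ((hd' s hs').differentiableAt hn), smul_sub]
  refine ⟨hd.sub hd', fun ε hε => ((hi ε hε).sub (hi' ε hε)).congr_uIoo (heq ε hε).symm, ?_⟩
  refine (hl.sub hl').congr' ?_
  filter_upwards [Ioo_mem_nhdsGT ht] with ε hε
  rw [← smul_sub, ← intervalIntegral.integral_sub (hi ε hε) (hi' ε hε)]
  congr 1
  exact intervalIntegral.integral_congr_uIoo (heq ε hε).symm

/-! ### Power series of Mittag-Leffler type -/

/-- The Gamma function grows faster than every exponential. -/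
theorem rpow_sub_one_mul_exp_neg_le_Gamma {R s : ℝ} (hR : 0 < R) (hs : 1 ≤ s) :
    R ^ (s - 1) * Real.exp (-R) ≤ Real.Gamma s := by
  have hs0 : 0 < s := by linarith
  rw [Real.Gamma_eq_integral hs0, ← integral_exp_neg_Ioi R, ← integral_const_mul]
  have hi := Real.GammaIntegral_convergent hs0
  -- Only the part of the Gamma integral over `(R, ∞)` is kept, where `x^{s-1} ≥ R^{s-1}`.
  calc ∫ x in Ioi R, R ^ (s - 1) * Real.exp (-x)
      ≤ ∫ x in Ioi R, Real.exp (-x) * x ^ (s - 1) := by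
        refine setIntegral_mono_on ?_ (hi.mono_set (Ioi_subset_Ioi hR.le)) measurableSet_Ioi ?_
        · exact (exp_neg_integrableOn_Ioi R one_pos |>.congr_fun (fun x _ => by simp)
            measurableSet_Ioi).const_mul _
        · intro x hx
          rw [mul_comm]
          gcongr
          exact le_of_lt hx
    _ ≤ ∫ x in Ioi 0, Real.exp (-x) * x ^ (s - 1) := by
        refine setIntegral_mono_set hi ?_ (Ioi_subset_Ioi hR.le).eventuallyLE
        filter_upwards [ae_restrict_mem measurableSet_Ioi] with x hx
        exact mul_nonneg (Real.exp_pos _).le (Real.rpow_nonneg (le_of_lt hx) _)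

/-- The series `∑ b_k x^k / Γ(γ k + 1)`. -/
def mlSeries (γ : ℝ) (b : ℕ → ℝ) (x : ℝ) : ℝ := ∑' k : ℕ, b k * x ^ k / Real.Gamma (γ * k + 1)

/-- The sequence `b` grows at most exponentially. -/
def ExpGrowth (b : ℕ → ℝ) : Prop := ∃ C r : ℝ, ∀ k, |b k| ≤ C * r ^ k

theorem ExpGrowth.exists_nonneg {b : ℕ → ℝ} (h : ExpGrowth b) :
    ∃ C r : ℝ, 0 ≤ C ∧ 0 ≤ r ∧ ∀ k, |b k| ≤ C * r ^ k := by
  obtain ⟨C, r, h⟩ := h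
  refine ⟨|C|, |r|, abs_nonneg _, abs_nonneg _, fun k => (h k).trans ?_⟩
  rw [← abs_pow, ← abs_mul]
  exact le_abs_self _

theorem expGrowth_pow (x : ℝ) : ExpGrowth (fun k => x ^ k) :=
  ⟨1, |x|, fun k => by simp⟩

theorem ExpGrowth.mul {a b : ℕ → ℝ} (ha : ExpGrowth a) (hb : ExpGrowth b) :
    ExpGrowth (fun k => a k * b k) := by
  obtain ⟨C, r, hC, hr, h⟩ := ha.exists_nonneg
  obtain ⟨C', r', hC', hr', h'⟩ := hb.exists_nonneg
  refine ⟨C * C', r * r', fun k => ?_⟩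
  rw [abs_mul]
  calc |a k| * |b k| ≤ (C * r ^ k) * (C' * r' ^ k) := by
        gcongr
        exacts [h k, h' k]
    _ = _ := by ring

theorem expGrowth_const (c : ℝ) : ExpGrowth (fun _ => c) := ⟨|c|, 1, fun k => by simp⟩

theorem expGrowth_natCast : ExpGrowth (fun k => (k : ℝ)) := by
  refine ⟨1, 2, fun k => ?_⟩
  rw [Nat.abs_cast, one_mul]
  exact_mod_cast Nat.lt_two_pow_self.le

theorem ExpGrowth.shift {b : ℕ → ℝ} (h : ExpGrowth b) : ExpGrowth (fun k => b (k + 1)) := by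
  obtain ⟨C, r, h⟩ := h
  exact ⟨C * r, r, fun k => (h (k + 1)).trans_eq (by ring)⟩

theorem Gamma_mul_add_one_pos {γ : ℝ} (hγ : 0 < γ) (k : ℕ) : 0 < Real.Gamma (γ * k + 1) :=
  Real.Gamma_pos_of_pos (by positivity)

/-- With `R^γ = q` the lower bound for Gamma reads `Γ(γ k + 1) ≥ q^k e^{-R}`. Taking `q` at least
twice the growth rate of the numerator leaves a geometric series of ratio `1/2`. -/
theorem ExpGrowth.summable {γ : ℝ} (hγ : 0 < γ) {b : ℕ → ℝ} (h : ExpGrowth b) (x : ℝ) :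
    Summable fun k : ℕ => |b k| * |x| ^ k / Real.Gamma (γ * k + 1) := by
  obtain ⟨C, r, hC, hr, h⟩ := h.exists_nonneg
  -- The summand `1` keeps `q` positive when `r * |x| = 0`.
  set q : ℝ := 2 * (r * |x| + 1) with hq
  have hq0 : 0 < q := by positivity
  set R : ℝ := q ^ γ⁻¹
  have hR : 0 < R := Real.rpow_pos_of_pos hq0 _
  have hRq : R ^ γ = q := by
    rw [← Real.rpow_mul hq0.le, inv_mul_cancel₀ hγ.ne', Real.rpow_one]
  have hΓ : ∀ k : ℕ, q ^ k * Real.exp (-R) ≤ Real.Gamma (γ * k + 1) := by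
    intro k
    have := rpow_sub_one_mul_exp_neg_le_Gamma hR (s := γ * k + 1) (by
      have : 0 ≤ γ * (k : ℝ) := by positivity
      linarith)
    rwa [add_sub_cancel_right, Real.rpow_mul hR.le, hRq, Real.rpow_natCast] at this
  refine Summable.of_nonneg_of_le (fun k => ?_) (fun k => ?_)
    ((summable_geometric_of_lt_one (by norm_num : (0 : ℝ) ≤ 1 / 2) (by norm_num)).mul_left
      (C * Real.exp R))
  · exact div_nonneg (by positivity) (Gamma_mul_add_one_pos hγ k).le
  · rw [div_le_iff₀ (Gamma_mul_add_one_pos hγ k)]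
    calc |b k| * |x| ^ k ≤ C * r ^ k * |x| ^ k := by gcongr; exact h k
      _ = C * (r * |x|) ^ k := by rw [mul_pow]; ring
      _ ≤ C * (q / 2) ^ k := by
          gcongr
          rw [hq]; linarith
      _ = C * Real.exp R * (1 / 2) ^ k * (q ^ k * Real.exp (-R)) := by
          rw [Real.exp_neg, div_pow, div_pow]
          field_simp
          simp
      _ ≤ _ := by gcongr; exact hΓ k

theorem ExpGrowth.hasSum {γ : ℝ} (hγ : 0 < γ) {b : ℕ → ℝ} (h : ExpGrowth b) (x : ℝ) :
    HasSum (fun k : ℕ => b k * x ^ k / Real.Gamma (γ * k + 1)) (mlSeries γ b x) := by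
  refine Summable.hasSum (Summable.of_norm ((h.summable hγ x).congr fun k => ?_))
  rw [norm_div, norm_mul, norm_pow, Real.norm_of_nonneg (Gamma_mul_add_one_pos hγ k).le]
  rfl

/-- Term by term differentiation of `mlSeries`. -/
theorem hasDerivAt_mlSeries {γ : ℝ} (hγ : 0 < γ) {b : ℕ → ℝ} (h : ExpGrowth b) (x : ℝ) :
    HasDerivAt (mlSeries γ b)
      (∑' k : ℕ, b k * (k * x ^ (k - 1)) / Real.Gamma (γ * k + 1)) x := by
  have hsum := (h.mul expGrowth_natCast).summable hγ (|x| + 1)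
  have hx : x ∈ Metric.ball (0 : ℝ) (|x| + 1) := by simp
  have h0 : (0 : ℝ) ∈ Metric.ball (0 : ℝ) (|x| + 1) := Metric.mem_ball_self (by positivity)
  unfold mlSeries
  refine hasDerivAt_tsum_of_isPreconnected (t := Metric.ball (0 : ℝ) (|x| + 1)) (y₀ := 0)
    (g := fun (k : ℕ) (x : ℝ) => b k * x ^ k / Real.Gamma (γ * k + 1))
    (g' := fun (k : ℕ) (x : ℝ) => b k * (k * x ^ (k - 1)) / Real.Gamma (γ * k + 1)) hsum
    Metric.isOpen_ball (convex_ball _ _).isPreconnected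
    (fun k y _ => ?_) (fun k y hy => ?_) h0 (h.hasSum hγ 0).summable hx
  · exact ((hasDerivAt_pow k y).const_mul (b k)).div_const _
  · have hy' : |y| ≤ |x| + 1 := by simpa using (mem_ball_zero_iff.1 hy).le
    -- A radius at least `1` lets the truncated exponent `k - 1` be raised to `k`, which matches the
    -- dominating series.
    have h1 : 1 ≤ |x| + 1 := by linarith [abs_nonneg x]
    rw [norm_div, Real.norm_of_nonneg (Gamma_mul_add_one_pos hγ k).le]
    refine div_le_div_of_nonneg_right ?_ (Gamma_mul_add_one_pos hγ k).le
    rw [Real.norm_eq_abs, abs_mul, abs_mul, abs_mul, abs_pow, mul_assoc, abs_of_nonneg (h1.trans' zero_le_one)]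
    gcongr
    calc |y| ^ (k - 1) ≤ (|x| + 1) ^ (k - 1) := by gcongr
      _ ≤ (|x| + 1) ^ k := pow_le_pow_right₀ h1 (Nat.sub_le _ _)

theorem continuous_mlSeries {γ : ℝ} (hγ : 0 < γ) {b : ℕ → ℝ} (h : ExpGrowth b) :
    Continuous (mlSeries γ b) :=
  continuous_iff_continuousAt.2 fun x => (hasDerivAt_mlSeries hγ h x).continuousAt

/-- The operator `x d/dx` acts diagonally on coefficients, so the derivative stays within the same
class of series. Dividing by `x` is the price. -/
theorem hasDerivAt_mlSeries_of_ne_zero {γ : ℝ} (hγ : 0 < γ) {b : ℕ → ℝ} (h : ExpGrowth b) {x : ℝ}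
    (hx : x ≠ 0) : HasDerivAt (mlSeries γ b) (mlSeries γ (fun k => b k * k) x / x) x := by
  convert hasDerivAt_mlSeries hγ h x using 1
  rw [mlSeries, ← tsum_div_const]
  refine tsum_congr fun k => ?_
  rcases k with _ | k
  · simp
  · rw [Nat.add_sub_cancel, pow_succ]
    field_simp

theorem mlSeries_add {γ : ℝ} (hγ : 0 < γ) {a b : ℕ → ℝ} (ha : ExpGrowth a) (hb : ExpGrowth b)
    (x : ℝ) : mlSeries γ (fun k => a k + b k) x = mlSeries γ a x + mlSeries γ b x := by
  rw [← ((ha.hasSum hγ x).add (hb.hasSum hγ x)).tsum_eq]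
  exact tsum_congr fun k => by ring

theorem mlSeries_const_mul (γ c : ℝ) (b : ℕ → ℝ) (x : ℝ) :
    mlSeries γ (fun k => c * b k) x = c * mlSeries γ b x := by
  rw [mlSeries, mlSeries, ← tsum_mul_left]
  exact tsum_congr fun k => by ring

theorem mlSeries_comp_mul (γ c : ℝ) (b : ℕ → ℝ) (x : ℝ) :
    mlSeries γ (fun k => b k * c ^ k) x = mlSeries γ b (c * x) :=
  tsum_congr fun k => by rw [mul_pow]; ring

theorem mlSeries_zero (γ : ℝ) (b : ℕ → ℝ) : mlSeries γ b 0 = b 0 := by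
  rw [mlSeries, tsum_eq_single 0 fun k hk => by simp [hk]]
  simp

theorem mittagLeffler_eq_mlSeries (γ x : ℝ) : mittagLeffler γ x = mlSeries γ (fun _ => 1) x :=
  tsum_congr fun k => by rw [one_mul]

/-- The real Beta integral over `(0, t)`. -/
theorem integral_rpow_mul_rpow_sub {a c t : ℝ} (ha : 0 < a) (hc : 0 < c) (ht : 0 < t) :
    ∫ s in 0..t, s ^ (a - 1) * (t - s) ^ (c - 1) =
      t ^ (a + c - 1) * (Real.Gamma a * Real.Gamma c / Real.Gamma (a + c)) := by
  have h := Complex.betaIntegral_scaled a c ht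
  rw [Complex.betaIntegral_eq_Gamma_mul_div _ _ (by simpa) (by simpa)] at h
  have h1 : ∫ x in 0..t, (x : ℂ) ^ ((a : ℂ) - 1) * ((t : ℂ) - x) ^ ((c : ℂ) - 1) =
      ((∫ s in 0..t, s ^ (a - 1) * (t - s) ^ (c - 1) : ℝ) : ℂ) := by
    rw [← intervalIntegral.integral_ofReal]
    refine intervalIntegral.integral_congr_Ioo_of_le ht.le fun x hx => ?_
    rw [Complex.ofReal_mul, Complex.ofReal_cpow hx.1.le, Complex.ofReal_cpow (sub_pos.2 hx.2).le]
    push_cast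
    rfl
  rw [h1, ← Complex.ofReal_add, Complex.Gamma_ofReal, Complex.Gamma_ofReal, Complex.Gamma_ofReal,
    ← Complex.ofReal_one, ← Complex.ofReal_sub, ← Complex.ofReal_cpow ht.le] at h
  exact_mod_cast h

end

section

/-- The integral of a nonintegrable function has the default value `0`, whereas the Beta formula
gives a positive value. -/
theorem integrableOn_rpow_mul_rpow_sub {a c t : ℝ} (ha : 0 < a) (hc : 0 < c) (ht : 0 < t) :
    IntervalIntegrable (fun s => s ^ (a - 1) * (t - s) ^ (c - 1)) volume 0 t := by
  by_contra hcon
  have h := integral_rpow_mul_rpow_sub ha hc ht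
  rw [intervalIntegral.integral_undef hcon] at h
  have := Real.Gamma_pos_of_pos ha
  have := Real.Gamma_pos_of_pos hc
  have := Real.Gamma_pos_of_pos (add_pos ha hc)
  have : 0 < t ^ (a + c - 1) * (Real.Gamma a * Real.Gamma c / Real.Gamma (a + c)) := by positivity
  exact this.ne h

/-- Without constant term, each power satisfies `x^{k+1} ≤ (x/X) X^{k+1}`. At `x = s^γ` this makes
the time derivative `O(s^{γ-1})` near `0`, hence integrable. -/
theorem abs_mlSeries_le {γ : ℝ} (hγ : 0 < γ) {b : ℕ → ℝ} (h : ExpGrowth b) (h0 : b 0 = 0)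
    {x X : ℝ} (hx : 0 ≤ x) (hxX : x ≤ X) (hX : 0 < X) :
    |mlSeries γ b x| ≤ x / X * ∑' k : ℕ, |b k| * |X| ^ k / Real.Gamma (γ * k + 1) := by
  have hs := (h.summable hγ X).mul_left (x / X)
  rw [← tsum_mul_left]
  refine tsum_of_norm_bounded (E := ℝ) hs.hasSum fun k => ?_
  rcases k with _ | k
  · simp [h0]
  · have hΓ := Gamma_mul_add_one_pos hγ (k + 1)
    rw [norm_div, norm_mul, norm_pow, Real.norm_of_nonneg hΓ.le, Real.norm_of_nonneg hx,
      Real.norm_eq_abs, abs_of_pos hX, ← mul_div_assoc]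
    have hle : x ^ (k + 1) ≤ x / X * X ^ (k + 1) := by
      calc x ^ (k + 1) = x * x ^ k := pow_succ' x k
        _ ≤ x * X ^ k := by gcongr
        _ = x / X * X ^ (k + 1) := by rw [pow_succ]; field_simp
    rw [mul_left_comm]
    gcongr

/-- Differentiation of `s ↦ ∑ b_k s^{γ k} / Γ(γ k + 1)`. -/
theorem hasDerivAt_mlSeries_rpow {γ : ℝ} (hγ : 0 < γ) {b : ℕ → ℝ} (h : ExpGrowth b) {s : ℝ}
    (hs : 0 < s) : HasDerivAt (fun s => mlSeries γ b (s ^ γ))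
      (γ * mlSeries γ (fun k => b k * k) (s ^ γ) / s) s := by
  have hp : 0 < s ^ γ := Real.rpow_pos_of_pos hs γ
  refine ((hasDerivAt_mlSeries_of_ne_zero hγ h hp.ne').comp s
    (Real.hasDerivAt_rpow_const (p := γ) (Or.inl hs.ne'))).congr_deriv ?_
  rw [Real.rpow_sub_one hs.ne']
  field_simp

/-- The Caputo derivative of `s ↦ ∑ b_k s^{γ k} / Γ(γ k + 1)` shifts the coefficients. -/
theorem hasCaputoDerivAt_mlSeries {γ : ℝ} (hγ : γ ∈ Ioo (0 : ℝ) 1) {b : ℕ → ℝ} (h : ExpGrowth b)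
    {t : ℝ} (ht : 0 < t) : HasCaputoDerivAt γ (fun s => mlSeries γ b (s ^ γ))
      (mlSeries γ (fun k => b (k + 1)) (t ^ γ)) t := by
  have hγ0 := hγ.1
  have hγ1 : 0 < 1 - γ := by linarith [hγ.2]
  have hbk : ExpGrowth (fun k => b k * k) := h.mul expGrowth_natCast
  have hderiv : ∀ s ∈ Ioo 0 t, deriv (fun s => mlSeries γ b (s ^ γ)) s =
      γ * mlSeries γ (fun k => b k * k) (s ^ γ) / s := fun s hs =>
    (hasDerivAt_mlSeries_rpow hγ0 h hs.1).deriv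
  -- The coefficients `b k * k` vanish at `k = 0`, so the integrand is dominated by the Beta
  -- integrand `s^{γ-1} (t-s)^{-γ}`. For these functions the improper integral converges absolutely.
  have hint : IntervalIntegrable
      (fun s => (t - s) ^ (-γ) • deriv (fun s => mlSeries γ b (s ^ γ)) s) volume 0 t := by
    set K : ℝ := ∑' k : ℕ, |b k * k| * |t ^ γ| ^ k / Real.Gamma (γ * k + 1)
    have hdom := (integrableOn_rpow_mul_rpow_sub hγ0 hγ1 ht).const_mul (γ / t ^ γ * K)
    rw [intervalIntegrable_iff_integrableOn_Ioo_of_le ht.le] at hdom ⊢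
    refine hdom.mono' ?_ ?_
    · exact (((measurable_const.sub measurable_id).pow_const _).smul
        (measurable_deriv _)).aestronglyMeasurable
    · filter_upwards [ae_restrict_mem measurableSet_Ioo] with s hs
      have hle : s ^ γ ≤ t ^ γ := Real.rpow_le_rpow hs.1.le hs.2.le hγ0.le
      have hb := abs_mlSeries_le hγ0 hbk (by simp) (Real.rpow_nonneg hs.1.le γ) hle
        (Real.rpow_pos_of_pos ht γ)
      have hp : 0 ≤ (t - s) ^ (-γ) := Real.rpow_nonneg (sub_pos.2 hs.2).le _
      rw [hderiv s hs, smul_eq_mul, norm_mul, norm_div, norm_mul, Real.norm_of_nonneg hγ0.le,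
        Real.norm_of_nonneg hs.1.le, Real.norm_of_nonneg hp, Real.norm_eq_abs]
      calc (t - s) ^ (-γ) * (γ * |mlSeries γ (fun k => b k * k) (s ^ γ)| / s)
          ≤ (t - s) ^ (-γ) * (γ * (s ^ γ / t ^ γ * K) / s) := by
            have := hs.1
            gcongr
        _ = γ / t ^ γ * K * (s ^ (γ - 1) * (t - s) ^ ((1 - γ) - 1)) := by
            rw [Real.rpow_sub_one hs.1.ne', show (1 - γ) - 1 = -γ by ring]
            have := hs.1.ne'
            field_simp
  have hval : ∫ s in 0..t, (t - s) ^ (-γ) • deriv (fun s => mlSeries γ b (s ^ γ)) s =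
      Real.Gamma (1 - γ) * mlSeries γ (fun k => b (k + 1)) (t ^ γ) := by
    -- `F k` is the term of index `k + 1` of the integrand, simplified by `γ(k+1) / Γ(γ(k+1)+1) = 1
    -- / Γ(γ(k+1))`. The Beta integral cancels this Gamma factor and leaves `Γ(1-γ) / Γ(γ k + 1)`:
    -- this is the shift of coefficients.
    set F : ℕ → ℝ → ℝ := fun k s => b (k + 1) / Real.Gamma (γ * (k + 1)) *
      (s ^ (γ * (k + 1) - 1) * (t - s) ^ ((1 - γ) - 1)) with hF
    have hpos : ∀ k : ℕ, 0 < γ * ((k : ℝ) + 1) := fun k => by positivity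
    have hFint : ∀ k, IntegrableOn (F k) (Ioc 0 t) volume := fun k => by
      rw [← intervalIntegrable_iff_integrableOn_Ioc_of_le ht.le]
      exact (integrableOn_rpow_mul_rpow_sub (hpos k) hγ1 ht).const_mul _
    have hval : ∀ k : ℕ, ∫ s in Ioc 0 t, s ^ (γ * (k + 1) - 1) * (t - s) ^ ((1 - γ) - 1) =
        (t ^ γ) ^ k * (Real.Gamma (γ * (k + 1)) * Real.Gamma (1 - γ) / Real.Gamma (γ * k + 1)) := by
      intro k
      rw [← intervalIntegral.integral_of_le ht.le, integral_rpow_mul_rpow_sub (hpos k) hγ1 ht,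
        ← Real.rpow_natCast, ← Real.rpow_mul ht.le]
      congr 2
      · ring
      · ring_nf
    have hnorm : ∀ k, ∫ s in Ioc 0 t, ‖F k s‖ =
        Real.Gamma (1 - γ) * (|b (k + 1)| * |t ^ γ| ^ k / Real.Gamma (γ * k + 1)) := by
      intro k
      have hΓ := Real.Gamma_pos_of_pos (hpos k)
      have hcongr : ∫ s in Ioc 0 t, ‖F k s‖ =
          ∫ s in Ioc 0 t, |b (k + 1)| / Real.Gamma (γ * (k + 1)) *
            (s ^ (γ * (k + 1) - 1) * (t - s) ^ ((1 - γ) - 1)) := by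
        refine setIntegral_congr_fun measurableSet_Ioc fun s hs => ?_
        simp only [hF]
        rw [norm_mul, norm_div, Real.norm_of_nonneg hΓ.le, Real.norm_eq_abs, Real.norm_of_nonneg]
        exact mul_nonneg (Real.rpow_nonneg hs.1.le _) (Real.rpow_nonneg (sub_nonneg.2 hs.2) _)
      rw [hcongr, integral_const_mul, hval, abs_of_pos (Real.rpow_pos_of_pos ht γ)]
      field_simp
    have hsum := hasSum_integral_of_summable_integral_norm hFint
      (((h.shift.summable hγ0 (t ^ γ)).mul_left (Real.Gamma (1 - γ))).congr fun k => (hnorm k).symm)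
    have hterm : ∀ k, ∫ s in Ioc 0 t, F k s =
        Real.Gamma (1 - γ) * (b (k + 1) * (t ^ γ) ^ k / Real.Gamma (γ * k + 1)) := by
      intro k
      have hΓ := Real.Gamma_pos_of_pos (hpos k)
      rw [integral_const_mul, hval]
      field_simp
    have htot : ∫ s in Ioc 0 t, ∑' k, F k s =
        ∫ s in 0..t, (t - s) ^ (-γ) • deriv (fun s => mlSeries γ b (s ^ γ)) s := by
      rw [intervalIntegral.integral_of_le ht.le, integral_Ioc_eq_integral_Ioo,
        integral_Ioc_eq_integral_Ioo]
      refine setIntegral_congr_fun measurableSet_Ioo fun s hs => ?_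
      rw [hderiv s hs, smul_eq_mul]
      have hs1 := hbk.hasSum hγ0 (s ^ γ)
      -- The term of index `0` is zero, and removing it aligns the series with `F`.
      rw [← hasSum_nat_add_iff' 1] at hs1
      simp only [Finset.sum_range_one, Nat.cast_zero, mul_zero, zero_mul, zero_div, sub_zero] at hs1
      have hs2 := (hs1.mul_left ((t - s) ^ (-γ) * (γ / s)))
      refine Eq.trans ?_ (hs2.tsum_eq.trans (by ring))
      refine tsum_congr fun k => ?_
      have e1 : Real.Gamma (γ * ((k + 1 : ℕ) : ℝ) + 1) =
          γ * (k + 1) * Real.Gamma (γ * (k + 1)) := by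
        push_cast
        exact Real.Gamma_add_one (hpos k).ne'
      have e2 : s ^ (γ * ((k : ℝ) + 1) - 1) = (s ^ γ) ^ (k + 1) / s := by
        rw [Real.rpow_sub_one hs.1.ne', Real.rpow_mul hs.1.le]
        norm_cast
      rw [e1]
      simp only [hF]
      rw [e2, show (1 - γ) - 1 = -γ by ring]
      have hΓ := Real.Gamma_pos_of_pos (hpos k)
      have hk : (k : ℝ) + 1 ≠ 0 := by positivity
      push_cast
      field_simp
    rw [← htot, ← hsum.tsum_eq, mlSeries, ← tsum_mul_left]
    exact tsum_congr hterm
  refine ⟨fun s hs => (hasDerivAt_mlSeries_rpow hγ0 h hs.1).differentiableAt.differentiableWithinAt,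
    fun ε hε => hint.mono_set ?_, ?_⟩
  · rw [uIcc_of_le hε.2.le, uIcc_of_le ht.le]
    exact Icc_subset_Icc_left hε.1.le
  -- Since the integral converges absolutely on `(0, t)`, the improper limit is continuity of the
  -- primitive in its lower end.
  · have hcont := intervalIntegral.continuousOn_primitive_interval_left
      (f := fun s => (t - s) ^ (-γ) • deriv (fun s => mlSeries γ b (s ^ γ)) s) (μ := volume)
      (a := 0) (b := t) (by
        rw [uIcc_of_le ht.le]
        rwa [intervalIntegrable_iff_integrableOn_Icc_of_le ht.le] at hint)
    have h0 := (hcont 0 left_mem_uIcc).tendsto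
    rw [hval] at h0
    have h1 := (h0.mono_left (le_inf nhdsWithin_le_nhds (le_principal_iff.2
      (mem_of_superset (Ioo_mem_nhdsGT ht) (by
        rw [uIcc_of_le ht.le]; exact Ioo_subset_Icc_self)))) :
        Tendsto _ (𝓝[>] (0 : ℝ)) _).const_smul (Real.Gamma (1 - γ))⁻¹
    have hG : Real.Gamma (1 - γ) ≠ 0 := (Real.Gamma_pos_of_pos hγ1).ne'
    rwa [smul_eq_mul, inv_mul_cancel_left₀ hG] at h1

end

section

/-! ### The relaxation function `t ↦ E_{γ,1}(-l t^γ)` -/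

/-- The relaxation function `E_{γ,1}(-l t^γ)`. -/
def mlFlow (γ l t : ℝ) : ℝ := mittagLeffler γ (-(l * t ^ γ))

/-- The function `t ∂ₜ E_{γ,1}(-l t^γ)`. -/
def mlDrift (γ l t : ℝ) : ℝ := γ * mlSeries γ (fun k => (k : ℝ)) (-(l * t ^ γ))

theorem mlFlow_eq (γ l t : ℝ) : mlFlow γ l t = mlSeries γ (fun k => (-l) ^ k) (t ^ γ) := by
  have := mlSeries_comp_mul γ (-l) (fun _ => 1) (t ^ γ)
  simp only [one_mul] at this
  rw [this, mlFlow, mittagLeffler_eq_mlSeries, neg_mul]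

theorem mlDrift_eq (γ l t : ℝ) :
    mlDrift γ l t = mlSeries γ (fun k => γ * (k * (-l) ^ k)) (t ^ γ) := by
  rw [mlSeries_const_mul, mlSeries_comp_mul, mlDrift, neg_mul]

theorem continuous_mittagLeffler {γ : ℝ} (hγ : 0 < γ) : Continuous (mittagLeffler γ) := by
  rw [funext (mittagLeffler_eq_mlSeries γ)]
  exact continuous_mlSeries hγ (expGrowth_const 1)

theorem continuous_mlFlow {γ : ℝ} (hγ : 0 < γ) :
    Continuous fun p : ℝ × ℝ => mlFlow γ p.1 p.2 :=
  (continuous_mittagLeffler hγ).comp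
    (continuous_fst.mul (continuous_snd.rpow_const fun _ => Or.inr hγ.le)).neg

theorem continuous_mlDrift {γ : ℝ} (hγ : 0 < γ) :
    Continuous fun p : ℝ × ℝ => mlDrift γ p.1 p.2 :=
  continuous_const.mul ((continuous_mlSeries hγ expGrowth_natCast).comp
    (continuous_fst.mul (continuous_snd.rpow_const fun _ => Or.inr hγ.le)).neg)

theorem mlFlow_zero {γ : ℝ} (hγ : 0 < γ) (l : ℝ) : mlFlow γ l 0 = 1 := by
  rw [mlFlow_eq, Real.zero_rpow hγ.ne', mlSeries_zero, pow_zero]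

theorem mlDrift_zero {γ : ℝ} (hγ : 0 < γ) (l : ℝ) : mlDrift γ l 0 = 0 := by
  rw [mlDrift_eq, Real.zero_rpow hγ.ne', mlSeries_zero]
  simp

theorem hasDerivAt_mlFlow {γ : ℝ} (hγ : 0 < γ) (l : ℝ) {s : ℝ} (hs : 0 < s) :
    HasDerivAt (mlFlow γ l) (mlDrift γ l s / s) s := by
  rw [funext (mlFlow_eq γ l)]
  refine (hasDerivAt_mlSeries_rpow hγ (expGrowth_pow (-l)) hs).congr_deriv ?_
  rw [mlDrift_eq, mlSeries_const_mul]
  simp only [mul_comm]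

theorem differentiableAt_mlDrift {γ : ℝ} (hγ : 0 < γ) (l : ℝ) {s : ℝ} (hs : 0 < s) :
    DifferentiableAt ℝ (mlDrift γ l) s := by
  rw [funext (mlDrift_eq γ l)]
  exact (hasDerivAt_mlSeries_rpow hγ
    ((expGrowth_const γ).mul (expGrowth_natCast.mul (expGrowth_pow (-l)))) hs).differentiableAt

variable {γ l t : ℝ}

/-- Shifting the geometric sequence `(-l)^k` multiplies it by `-l`: this is the relaxation equation.
-/
theorem hasCaputoDerivAt_mlFlow (hγ : γ ∈ Ioo (0 : ℝ) 1) (l : ℝ) (ht : 0 < t) :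
    HasCaputoDerivAt γ (mlFlow γ l) (-l * mlFlow γ l t) t := by
  have h := hasCaputoDerivAt_mlSeries hγ (expGrowth_pow (-l)) ht
  simp only [pow_succ'] at h
  rwa [mlSeries_const_mul, ← mlFlow_eq, ← funext (mlFlow_eq γ l)] at h

/-- From `(k+1)(-l)^{k+1} = -l (k (-l)^k + (-l)^k)`, the function `z = t y'` satisfies a relaxation
equation with the forcing `-l γ y`. The extremal principle applied to it controls the sign and size
of `y'`. -/
theorem hasCaputoDerivAt_mlDrift (hγ : γ ∈ Ioo (0 : ℝ) 1) (l : ℝ) (ht : 0 < t) :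
    HasCaputoDerivAt γ (mlDrift γ l) (-l * (mlDrift γ l t + γ * mlFlow γ l t)) t := by
  have hg := (expGrowth_const γ).mul (expGrowth_natCast.mul (expGrowth_pow (-l)))
  have h := hasCaputoDerivAt_mlSeries hγ hg ht
  have h2 : mlSeries γ (fun k => γ * ((k + 1 : ℕ) * (-l) ^ (k + 1))) (t ^ γ) =
      -l * (mlDrift γ l t + γ * mlFlow γ l t) := by
    rw [mlDrift_eq, mlFlow_eq, ← mlSeries_const_mul γ γ,
      ← mlSeries_add hγ.1 hg ((expGrowth_const γ).mul (expGrowth_pow (-l))), ← mlSeries_const_mul]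
    congr 1
    ext k
    push_cast
    ring
  rwa [h2, ← funext (mlDrift_eq γ l)] at h

/-! ### Positivity, monotonicity and decay of the relaxation function. -/

theorem continuous_mlFlow_time (hγ : 0 < γ) (l : ℝ) : Continuous (mlFlow γ l) :=
  (continuous_mlFlow hγ).comp (Continuous.prodMk_right l)

theorem continuous_mlDrift_time (hγ : 0 < γ) (l : ℝ) : Continuous (mlDrift γ l) :=
  (continuous_mlDrift hγ).comp (Continuous.prodMk_right l)

/-- Extremal principle at a minimum. -/
theorem HasCaputoDerivAt.le_rpow_mul_sub {w : ℝ} {f : ℝ → ℝ} (hγ : γ ∈ Ioo (0 : ℝ) 1)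
    (ht : 0 < t) (h : HasCaputoDerivAt γ f w t) (hc : Continuous f)
    (hd : DifferentiableAt ℝ f t) (hmin : ∀ s ∈ Icc 0 t, f t ≤ f s) :
    t ^ (-γ) * (f 0 - f t) ≤ -(Real.Gamma (1 - γ) * w) := by
  have h1 := h.clm_comp (-ContinuousLinearMap.id ℝ ℝ) ht
  have h2 := h1.rpow_mul_sub_le hγ ht hc.neg.continuousOn
    (by simpa using hd.neg) (by simpa using hmin)
  simp only [_root_.neg_apply, ContinuousLinearMap.id_apply] at h2
  linarith

/-- A nonpositive minimum would lie at some `r > 0`, because the initial value is `1`. There the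
extremal principle bounds the positive number `r^{-γ} (1 - y(r))` by `Γ(1-γ) l y(r) ≤ 0`. -/
theorem mlFlow_pos (hγ : γ ∈ Ioo (0 : ℝ) 1) (hl : 0 ≤ l) (ht : 0 ≤ t) : 0 < mlFlow γ l t := by
  by_contra! hcon
  obtain ⟨r, hr, hmin⟩ := isCompact_Icc.exists_isMinOn (nonempty_Icc.2 ht)
    (continuous_mlFlow_time hγ.1 l).continuousOn
  have hr0 : mlFlow γ l r ≤ 0 := (hmin (right_mem_Icc.2 ht)).trans hcon
  have hrpos : 0 < r := by
    rcases hr.1.lt_or_eq with h | rfl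
    · exact h
    · rw [mlFlow_zero hγ.1] at hr0; linarith
  have h := (hasCaputoDerivAt_mlFlow hγ l hrpos).le_rpow_mul_sub hγ hrpos
    (continuous_mlFlow_time hγ.1 l) (hasDerivAt_mlFlow hγ.1 l hrpos).differentiableAt
    fun s hs => hmin ⟨hs.1, hs.2.trans hr.2⟩
  rw [mlFlow_zero hγ.1] at h
  have h1 : 0 < r ^ (-γ) * (1 - mlFlow γ l r) :=
    mul_pos (Real.rpow_pos_of_pos hrpos _) (by linarith)
  have h2 : Real.Gamma (1 - γ) * (l * mlFlow γ l r) ≤ 0 :=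
    mul_nonpos_of_nonneg_of_nonpos (Real.Gamma_pos_of_pos (by linarith [hγ.2])).le
      (mul_nonpos_of_nonneg_of_nonpos hl hr0)
  linarith

/-- At a positive maximum of `z` the extremal principle makes the Caputo derivative positive, while
the equation makes it `-l (z + γ y) ≤ 0`. -/
theorem mlDrift_nonpos (hγ : γ ∈ Ioo (0 : ℝ) 1) (hl : 0 ≤ l) (ht : 0 ≤ t) :
    mlDrift γ l t ≤ 0 := by
  by_contra! hcon
  obtain ⟨r, hr, hmax⟩ := isCompact_Icc.exists_isMaxOn (nonempty_Icc.2 ht)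
    (continuous_mlDrift_time hγ.1 l).continuousOn
  have hr0 : 0 < mlDrift γ l r := hcon.trans_le (hmax (right_mem_Icc.2 ht))
  have hrpos : 0 < r := by
    rcases hr.1.lt_or_eq with h | rfl
    · exact h
    · rw [mlDrift_zero hγ.1] at hr0; exact hr0
  have h := (hasCaputoDerivAt_mlDrift hγ l hrpos).rpow_mul_sub_le hγ hrpos
    (continuous_mlDrift_time hγ.1 l).continuousOn (differentiableAt_mlDrift hγ.1 l hrpos)
    fun s hs => hmax ⟨hs.1, hs.2.trans hr.2⟩
  rw [mlDrift_zero hγ.1, sub_zero] at h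
  have h1 : 0 < r ^ (-γ) * mlDrift γ l r := mul_pos (Real.rpow_pos_of_pos hrpos _) hr0
  have h3 : 0 ≤ γ * mlFlow γ l r := mul_nonneg hγ.1.le (mlFlow_pos hγ hl hr.1).le
  have h2 : 0 ≤ Real.Gamma (1 - γ) * (l * (mlDrift γ l r + γ * mlFlow γ l r)) :=
    mul_nonneg (Real.Gamma_pos_of_pos (by linarith [hγ.2])).le (mul_nonneg hl (by linarith))
  linarith

theorem mlFlow_antitoneOn (hγ : γ ∈ Ioo (0 : ℝ) 1) (hl : 0 ≤ l) :
    AntitoneOn (mlFlow γ l) (Ici 0) := by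
  refine antitoneOn_of_deriv_nonpos (convex_Ici 0) (continuous_mlFlow_time hγ.1 l).continuousOn
    ?_ ?_ <;> rw [interior_Ici]
  · exact fun s hs => (hasDerivAt_mlFlow hγ.1 l hs).differentiableAt.differentiableWithinAt
  · intro s hs
    rw [(hasDerivAt_mlFlow hγ.1 l hs).deriv]
    exact div_nonpos_of_nonpos_of_nonneg (mlDrift_nonpos hγ hl (le_of_lt hs)) (le_of_lt hs)

theorem mlFlow_le_one (hγ : γ ∈ Ioo (0 : ℝ) 1) (hl : 0 ≤ l) (ht : 0 ≤ t) : mlFlow γ l t ≤ 1 := by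
  rw [← mlFlow_zero hγ.1 l]
  exact mlFlow_antitoneOn hγ hl self_mem_Ici ht ht

/-- At a minimum of `z` below `-γ` one has `z + γ y < 0`, since `y ≤ 1`. The equation then makes the
Caputo derivative nonnegative, against the extremal principle. -/
theorem neg_le_mlDrift (hγ : γ ∈ Ioo (0 : ℝ) 1) (hl : 0 ≤ l) (ht : 0 ≤ t) :
    -γ ≤ mlDrift γ l t := by
  by_contra! hcon
  obtain ⟨r, hr, hmin⟩ := isCompact_Icc.exists_isMinOn (nonempty_Icc.2 ht)
    (continuous_mlDrift_time hγ.1 l).continuousOn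
  have hr0 : mlDrift γ l r < -γ := lt_of_le_of_lt (hmin (right_mem_Icc.2 ht)) hcon
  have hrpos : 0 < r := by
    rcases hr.1.lt_or_eq with h | rfl
    · exact h
    · rw [mlDrift_zero hγ.1] at hr0; linarith [hγ.1]
  have h := (hasCaputoDerivAt_mlDrift hγ l hrpos).le_rpow_mul_sub hγ hrpos
    (continuous_mlDrift_time hγ.1 l) (differentiableAt_mlDrift hγ.1 l hrpos)
    fun s hs => hmin ⟨hs.1, hs.2.trans hr.2⟩
  rw [mlDrift_zero hγ.1] at h
  have h1 : 0 < r ^ (-γ) * (0 - mlDrift γ l r) :=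
    mul_pos (Real.rpow_pos_of_pos hrpos _) (by linarith [hγ.1])
  have h3 : γ * mlFlow γ l r ≤ γ :=
    mul_le_of_le_one_right hγ.1.le (mlFlow_le_one hγ hl hr.1)
  have h2 : Real.Gamma (1 - γ) * (l * (mlDrift γ l r + γ * mlFlow γ l r)) ≤ 0 :=
    mul_nonpos_of_nonneg_of_nonpos (Real.Gamma_pos_of_pos (by linarith [hγ.2])).le
      (mul_nonpos_of_nonneg_of_nonpos hl (by linarith))
  linarith

/-- The bound does not depend on `l`, so `y'` is at most `1/t` in absolute value uniformly in the
frequency. This permits differentiation of the flow in `L²`. -/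
theorem abs_mlDrift_le (hγ : γ ∈ Ioo (0 : ℝ) 1) (hl : 0 ≤ l) (ht : 0 ≤ t) :
    |mlDrift γ l t| ≤ 1 :=
  abs_le.2 ⟨by linarith [neg_le_mlDrift hγ hl ht, hγ.2], by linarith [mlDrift_nonpos hγ hl ht]⟩

/-- The lower bound `E_{γ,1}(-x) ≥ 1 / (1 + Γ(1-γ) x)`. -/
theorem inv_mlFlow_le (hγ : γ ∈ Ioo (0 : ℝ) 1) (hl : 0 ≤ l) (ht : 0 < t) :
    (mlFlow γ l t)⁻¹ ≤ 1 + Real.Gamma (1 - γ) * t ^ γ * l := by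
  -- A decreasing function has its minimum over `[0, t]` at `t`, so the extremal principle reads
  -- `t^{-γ} (1 - y(t)) ≤ Γ(1-γ) l y(t)`.
  have h := (hasCaputoDerivAt_mlFlow hγ l ht).le_rpow_mul_sub hγ ht
    (continuous_mlFlow_time hγ.1 l) (hasDerivAt_mlFlow hγ.1 l ht).differentiableAt
    fun s hs => mlFlow_antitoneOn hγ hl hs.1 ht.le hs.2
  rw [mlFlow_zero hγ.1] at h
  have hp := Real.rpow_pos_of_pos ht γ
  have hy := mlFlow_pos hγ hl ht.le
  rw [Real.rpow_neg ht.le, inv_mul_le_iff₀ hp] at h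
  rw [inv_le_iff_one_le_mul₀ hy]
  linarith

/-- The truncated Caputo integral of the relaxation function. -/
def mlCaputoInt (γ l ε t : ℝ) : ℝ := ∫ s in ε..t, (t - s) ^ (-γ) * (mlDrift γ l s / s)

theorem mlCaputoInt_eq (hγ : 0 < γ) (l : ℝ) {ε : ℝ} (hε : ε ∈ Ioo 0 t) : mlCaputoInt γ l ε t =
    ∫ s in ε..t, (t - s) ^ (-γ) • deriv (mlFlow γ l) s :=
  intervalIntegral.integral_congr_Ioo_of_le hε.2.le fun s hs => by
    simp only [smul_eq_mul]
    rw [(hasDerivAt_mlFlow hγ l (hε.1.trans hs.1)).deriv]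

theorem tendsto_mlCaputoInt (hγ : γ ∈ Ioo (0 : ℝ) 1) (l : ℝ) (ht : 0 < t) :
    Tendsto (fun ε => (Real.Gamma (1 - γ))⁻¹ * mlCaputoInt γ l ε t) (𝓝[>] 0)
      (𝓝 (-l * mlFlow γ l t)) := by
  refine (hasCaputoDerivAt_mlFlow hγ l ht).2.2.congr' ?_
  filter_upwards [Ioo_mem_nhdsGT ht] with ε hε
  rw [mlCaputoInt_eq hγ.1 l hε, smul_eq_mul]

theorem intervalIntegrable_mlCaputoInt (hγ : γ ∈ Ioo (0 : ℝ) 1) (l : ℝ) {ε : ℝ}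
    (hε : ε ∈ Ioo 0 t) :
    IntervalIntegrable (fun s => (t - s) ^ (-γ) * (mlDrift γ l s / s)) volume ε t := by
  refine ((hasCaputoDerivAt_mlFlow hγ l (hε.1.trans hε.2)).2.1 ε hε).congr_uIoo fun s hs => ?_
  rw [uIoo_of_le hε.2.le] at hs
  simp only [smul_eq_mul]
  rw [(hasDerivAt_mlFlow hγ.1 l (hε.1.trans hs.1)).deriv]

/-- The integrand is nonpositive. On `s ≤ t/2` the kernel is at most `(t/2)^{-γ}` and `y` decreases
by at most `1`; on `s ≥ t/2` one has `|y'| ≤ 2/t` and the kernel is integrable. The bound depends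
neither on `l` nor on `ε`; it gives both the decay of `y` in `l` and the domination needed for `ε ↓
0` in `L²`. -/
theorem abs_mlCaputoInt_le (hγ : γ ∈ Ioo (0 : ℝ) 1) (hl : 0 ≤ l) {ε : ℝ} (hε : ε ∈ Ioo 0 t) :
    |mlCaputoInt γ l ε t| ≤ (t / 2) ^ (-γ) + 2 / (t * (1 - γ)) * t ^ (1 - γ) := by
  have ht : 0 < t := hε.1.trans hε.2
  have hγ1 : 0 < 1 - γ := by linarith [hγ.2]
  have hsign : mlCaputoInt γ l ε t ≤ 0 := by
    rw [mlCaputoInt, ← neg_nonneg, ← intervalIntegral.integral_neg]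
    refine intervalIntegral.integral_nonneg hε.2.le fun s hs => ?_
    have hs0 : 0 ≤ s := hε.1.le.trans hs.1
    rw [neg_nonneg]
    exact mul_nonpos_of_nonneg_of_nonpos (Real.rpow_nonneg (sub_nonneg.2 hs.2) _)
      (div_nonpos_of_nonpos_of_nonneg (mlDrift_nonpos hγ hl hs0) hs0)
  -- The comparison function has derivative `(t/2)^{-γ} y' - (2/t) (t-s)^{-γ}`. Both terms are
  -- nonpositive, and on each half of the interval one of them already lies below the integrand, so
  -- no splitting of the integral is needed.
  have hle := intervalIntegral.sub_le_integral_of_hasDeriv_right_of_le (a := ε) (b := t)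
    (g := fun s => (t / 2) ^ (-γ) * mlFlow γ l s + 2 / (t * (1 - γ)) * (t - s) ^ (1 - γ))
    (g' := fun s => (t / 2) ^ (-γ) * (mlDrift γ l s / s) +
      2 / (t * (1 - γ)) * (-1 * (1 - γ) * (t - s) ^ (1 - γ - 1)))
    (φ := fun s => (t - s) ^ (-γ) * (mlDrift γ l s / s)) hε.2.le ?_ ?_ ?_ ?_
  · change _ ≤ mlCaputoInt γ l ε t at hle
    simp only [sub_self, Real.zero_rpow hγ1.ne', mul_zero, add_zero] at hle
    have h1 := mlFlow_le_one hγ hl hε.1.le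
    have h2 := mlFlow_pos hγ hl ht.le
    have h3 : (t - ε) ^ (1 - γ) ≤ t ^ (1 - γ) :=
      Real.rpow_le_rpow (by linarith [hε.2]) (by linarith [hε.1]) hγ1.le
    have h4 : 2 / (t * (1 - γ)) * (t - ε) ^ (1 - γ) ≤ 2 / (t * (1 - γ)) * t ^ (1 - γ) :=
      mul_le_mul_of_nonneg_left h3 (by positivity)
    have h5 : 0 < (t / 2) ^ (-γ) := Real.rpow_pos_of_pos (by linarith) _
    have h6 : (t / 2) ^ (-γ) * mlFlow γ l ε ≤ (t / 2) ^ (-γ) := mul_le_of_le_one_right h5.le h1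
    have h7 : 0 < (t / 2) ^ (-γ) * mlFlow γ l t := mul_pos h5 h2
    rw [abs_of_nonpos hsign]
    linarith
  · refine ((continuous_const.mul (continuous_mlFlow_time hγ.1 l)).add
      (continuous_const.mul ?_)).continuousOn
    exact (continuous_const.sub continuous_id).rpow_const fun _ => Or.inr hγ1.le
  · intro s hs
    have h2 : HasDerivAt (fun s : ℝ => t - s) (-1) s := by
      simpa using (hasDerivAt_id s).const_sub t
    have h3 := h2.rpow_const (p := 1 - γ) (Or.inl (sub_pos.2 hs.2).ne')
    exact (((hasDerivAt_mlFlow hγ.1 l (hε.1.trans hs.1)).const_mul _).add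
      (h3.const_mul _)).hasDerivWithinAt
  · have := intervalIntegrable_mlCaputoInt hγ l hε
    rwa [intervalIntegrable_iff_integrableOn_Icc_of_le hε.2.le] at this
  · intro s hs
    have hs0 : 0 < s := hε.1.trans hs.1
    have hp : 0 < t - s := sub_pos.2 hs.2
    have hz := mlDrift_nonpos hγ hl hs0.le
    have hz' : mlDrift γ l s / s ≤ 0 := div_nonpos_of_nonpos_of_nonneg hz hs0.le
    have e : 2 / (t * (1 - γ)) * (-1 * (1 - γ) * (t - s) ^ (1 - γ - 1)) =
        -(2 / t) * (t - s) ^ (-γ) := by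
      rw [show 1 - γ - 1 = -γ by ring]
      field_simp
    have hq : 0 < (t - s) ^ (-γ) := Real.rpow_pos_of_pos hp _
    rw [e]
    rcases le_total s (t / 2) with hst | hst
    · have h1 : (t - s) ^ (-γ) ≤ (t / 2) ^ (-γ) :=
        Real.rpow_le_rpow_of_nonpos (by linarith) (by linarith) (by linarith [hγ.1])
      have h2 := mul_le_mul_of_nonpos_right h1 hz'
      have h3 : 0 ≤ 2 / t * (t - s) ^ (-γ) := by positivity
      linarith
    · have h1 : -(2 / t) ≤ mlDrift γ l s / s := by
        rw [le_div_iff₀ hs0]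
        have h2 : -1 ≤ mlDrift γ l s := (abs_le.1 (abs_mlDrift_le hγ hl hs0.le)).1
        have h3 : 1 ≤ 2 / t * s := by
          rw [div_mul_eq_mul_div, one_le_div ht]; linarith
        linarith
      have h2 := mul_le_mul_of_nonneg_left h1 hq.le
      have h3 : (t / 2) ^ (-γ) * (mlDrift γ l s / s) ≤ 0 :=
        mul_nonpos_of_nonneg_of_nonpos (Real.rpow_nonneg (by linarith) _) hz'
      linarith

/-- The constant in the decay estimate of the relaxation function. -/
def mlDecay (γ t : ℝ) : ℝ :=
  (Real.Gamma (1 - γ))⁻¹ * ((t / 2) ^ (-γ) + 2 / (t * (1 - γ)) * t ^ (1 - γ))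

/-- The upper bound `l E_{γ,1}(-l t^γ) ≤ C(t)`. -/
theorem mul_mlFlow_le (hγ : γ ∈ Ioo (0 : ℝ) 1) (hl : 0 ≤ l) (ht : 0 < t) :
    l * mlFlow γ l t ≤ mlDecay γ t := by
  have hG : 0 < Real.Gamma (1 - γ) := Real.Gamma_pos_of_pos (by linarith [hγ.2])
  -- The normalised truncated integrals tend to `-l y(t)`, so their uniform bound passes to the
  -- limit.
  have h := (tendsto_mlCaputoInt hγ l ht).abs
  have h2 := le_of_tendsto h (b := mlDecay γ t) (by
    filter_upwards [Ioo_mem_nhdsGT ht] with ε hε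
    rw [abs_mul, abs_of_pos (inv_pos.2 hG)]
    exact mul_le_mul_of_nonneg_left (abs_mlCaputoInt_le hγ hl hε) (inv_pos.2 hG).le)
  rw [neg_mul, abs_neg] at h2
  exact (le_abs_self _).trans h2

/-- Monotonicity in time extends the decay estimate at `r` to all later times. This gives `H²`
bounds that are locally uniform on `(0, T]`. -/
theorem mlFlow_mul_one_add_le (hγ : γ ∈ Ioo (0 : ℝ) 1) (hl : 0 ≤ l) {r : ℝ} (hr : 0 < r)
    (hrt : r ≤ t) : (1 + l) * mlFlow γ l t ≤ 1 + mlDecay γ r := by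
  have h1 := mlFlow_le_one hγ hl (hr.le.trans hrt)
  have h2 := mlFlow_antitoneOn hγ hl hr.le (hr.le.trans hrt) hrt
  have h3 := mul_mlFlow_le hγ hl hr
  have h4 := mul_le_mul_of_nonneg_left h2 hl
  linarith

/-- The truncated integral is treated as a function of its lower end. The same derivative formula in
`L²` then identifies the vector-valued integral by the fundamental theorem of calculus, without a
Fubini argument. -/
theorem hasDerivAt_mlCaputoInt (hγ : γ ∈ Ioo (0 : ℝ) 1) (l : ℝ) {ε : ℝ} (hε : ε ∈ Ioo 0 t) :
    HasDerivAt (fun ε => mlCaputoInt γ l ε t) (-((t - ε) ^ (-γ) * (mlDrift γ l ε / ε))) ε := by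
  have hcont : ∀ s ∈ Ioo 0 t, ContinuousAt (fun s => (t - s) ^ (-γ) * (mlDrift γ l s / s)) s :=
    fun s hs => ((continuousAt_const.sub continuousAt_id).rpow_const
      (Or.inl (sub_pos.2 hs.2).ne')).mul
      ((continuous_mlDrift_time hγ.1 l).continuousAt.div continuousAt_id hs.1.ne')
  refine intervalIntegral.integral_hasDerivAt_left (intervalIntegrable_mlCaputoInt hγ l hε) ?_
    (hcont ε hε)
  exact (continuousOn_of_forall_continuousAt hcont).stronglyMeasurableAtFilter isOpen_Ioo ε hε

theorem continuousOn_mlCaputoInt (hγ : γ ∈ Ioo (0 : ℝ) 1) (l : ℝ) {ε : ℝ}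
    (hε : ε ∈ Ioo 0 t) : ContinuousOn (fun r => mlCaputoInt γ l r t) (Icc ε t) := by
  have h := intervalIntegrable_mlCaputoInt hγ l hε
  rw [intervalIntegrable_iff_integrableOn_Icc_of_le hε.2.le] at h
  have := intervalIntegral.continuousOn_primitive_interval_left (μ := volume)
    (by rwa [uIcc_of_le hε.2.le])
  rwa [uIcc_of_le hε.2.le] at this

theorem measurable_mlCaputoInt (hγ : 0 < γ) (ε t : ℝ) :
    Measurable fun l => mlCaputoInt γ l ε t := by
  have hm : StronglyMeasurable (Function.uncurry fun (l s : ℝ) =>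
      (t - s) ^ (-γ) * (mlDrift γ l s / s)) := by
    refine Measurable.stronglyMeasurable ?_
    refine Measurable.mul ?_ ?_
    · exact (measurable_const.sub measurable_snd).pow_const _
    · exact (continuous_mlDrift hγ).measurable.div measurable_snd
  unfold mlCaputoInt
  simp only [intervalIntegral]
  exact (hm.integral_prod_right.sub hm.integral_prod_right).measurable

end

section

/-! ### Multiplication operators on `L²` -/

variable {n : ℕ}

/-- A measurable bounded function. -/
def BddMeas (m : Space n → ℂ) : Prop := Measurable m ∧ ∃ C, ∀ ξ, ‖m ξ‖ ≤ C

theorem BddMeas.memLp {m : Space n → ℂ} (hm : BddMeas m) (f : L2 n) :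
    MemLp (fun ξ => m ξ * f ξ) 2 volume := by
  obtain ⟨h, C, hC⟩ := hm
  exact (Lp.memLp f).of_le_mul (c := C) (h.aestronglyMeasurable.mul (Lp.aestronglyMeasurable f))
    (Eventually.of_forall fun ξ => by rw [norm_mul]; gcongr; exact hC ξ)

theorem BddMeas.sub {m m' : Space n → ℂ} (hm : BddMeas m) (hm' : BddMeas m') :
    BddMeas (fun ξ => m ξ - m' ξ) := by
  obtain ⟨h, C, hC⟩ := hm
  obtain ⟨h', C', hC'⟩ := hm'
  exact ⟨h.sub h', C + C', fun ξ => (norm_sub_le _ _).trans (add_le_add (hC ξ) (hC' ξ))⟩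

theorem BddMeas.mul {m m' : Space n → ℂ} (hm : BddMeas m) (hm' : BddMeas m') :
    BddMeas (fun ξ => m ξ * m' ξ) := by
  obtain ⟨h, C, hC⟩ := hm
  obtain ⟨h', C', hC'⟩ := hm'
  refine ⟨h.mul h', C * C', fun ξ => ?_⟩
  rw [norm_mul]
  exact mul_le_mul (hC ξ) (hC' ξ) (norm_nonneg _) ((norm_nonneg _).trans (hC ξ))

theorem BddMeas.const_mul {m : Space n → ℂ} (hm : BddMeas m) (c : ℂ) :
    BddMeas (fun ξ => c * m ξ) :=
  BddMeas.mul ⟨measurable_const, ‖c‖, fun _ => le_rfl⟩ hm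

theorem norm_toLp_le_of_bound {f : L2 n} {h : Space n → ℂ} (hh : MemLp h 2 volume) {C : ℝ}
    (hb : ∀ᵐ ξ : Space n, ‖h ξ‖ ≤ C * ‖f ξ‖) : ‖hh.toLp h‖ ≤ C * ‖f‖ := by
  refine Lp.norm_le_mul_norm_of_ae_le_mul ?_
  filter_upwards [hh.coeFn_toLp, hb] with ξ h1 h2
  rwa [h1]

open Classical in
/-- Multiplication by a bounded measurable function, as an operator on `L²`
(and zero for other functions). -/
def mulOp (m : Space n → ℂ) : L2 n →L[ℂ] L2 n :=
  if hm : BddMeas m then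
    LinearMap.mkContinuous
      { toFun := fun f => (hm.memLp f).toLp _
        map_add' := fun f g => by
          rw [← MemLp.toLp_add]
          refine MemLp.toLp_congr _ _ ?_
          filter_upwards [Lp.coeFn_add f g] with ξ h
          rw [h]
          simp [mul_add]
        map_smul' := fun c f => by
          rw [← MemLp.toLp_const_smul]
          refine MemLp.toLp_congr _ _ ?_
          filter_upwards [Lp.coeFn_smul c f] with ξ h
          rw [h]
          simp [mul_left_comm] }
      hm.2.choose fun f => norm_toLp_le_of_bound (hm.memLp f) (Eventually.of_forall fun ξ => by
        rw [norm_mul]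
        gcongr
        exact hm.2.choose_spec ξ)
  else 0

theorem coeFn_mulOp {m : Space n → ℂ} (hm : BddMeas m) (f : L2 n) :
    mulOp m f =ᵐ[volume] fun ξ => m ξ * f ξ := by
  rw [mulOp, dif_pos hm]
  exact (hm.memLp f).coeFn_toLp

theorem mulOp_eq_iff {m : Space n → ℂ} (hm : BddMeas m) {f h : L2 n} :
    h = mulOp m f ↔ h =ᵐ[volume] fun ξ => m ξ * f ξ := by
  refine ⟨fun e => e ▸ coeFn_mulOp hm f, fun e => Lp.ext (e.trans (coeFn_mulOp hm f).symm)⟩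

theorem norm_mulOp_le {m : Space n → ℂ} (hm : BddMeas m) {C : ℝ} (hC : ∀ ξ, ‖m ξ‖ ≤ C)
    (f : L2 n) : ‖mulOp m f‖ ≤ C * ‖f‖ := by
  refine Lp.norm_le_mul_norm_of_ae_le_mul ?_
  filter_upwards [coeFn_mulOp hm f] with ξ h
  rw [h, norm_mul]
  gcongr
  exact hC ξ

theorem mulOp_sub {m m' : Space n → ℂ} (hm : BddMeas m) (hm' : BddMeas m') (f : L2 n) :
    mulOp (fun ξ => m ξ - m' ξ) f = mulOp m f - mulOp m' f := by
  refine ((mulOp_eq_iff (hm.sub hm')).2 ?_).symm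
  filter_upwards [Lp.coeFn_sub (mulOp m f) (mulOp m' f), coeFn_mulOp hm f, coeFn_mulOp hm' f]
    with ξ h1 h2 h3
  rw [h1, Pi.sub_apply, h2, h3, sub_mul]

theorem mulOp_const_mul {m : Space n → ℂ} (hm : BddMeas m) (c : ℂ) (f : L2 n) :
    mulOp (fun ξ => c * m ξ) f = c • mulOp m f := by
  refine ((mulOp_eq_iff (hm.const_mul c)).2 ?_).symm
  filter_upwards [Lp.coeFn_smul c (mulOp m f), coeFn_mulOp hm f] with ξ h1 h2
  rw [h1, Pi.smul_apply, h2, smul_eq_mul, mul_assoc]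

theorem mulOp_mulOp {m m' : Space n → ℂ} (hm : BddMeas m) (hm' : BddMeas m') (f : L2 n) :
    mulOp m (mulOp m' f) = mulOp (fun ξ => m ξ * m' ξ) f := by
  refine (mulOp_eq_iff (hm.mul hm')).2 ?_
  filter_upwards [coeFn_mulOp hm (mulOp m' f), coeFn_mulOp hm' f] with ξ h1 h2
  rw [h1, h2, mul_assoc]

theorem norm_sq_eq_integral (f : L2 n) : ‖f‖ ^ 2 = ∫ ξ, ‖f ξ‖ ^ 2 := by
  have h := inner_self_eq_norm_sq (𝕜 := ℂ) f
  have h2 : ∫ ξ, ⟪f ξ, f ξ⟫_ℂ = ((∫ ξ, ‖f ξ‖ ^ 2 : ℝ) : ℂ) := by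
    rw [← integral_complex_ofReal]
    refine integral_congr_ae (Eventually.of_forall fun ξ => ?_)
    simp only [inner_self_eq_norm_sq_to_K]
    norm_cast
  rw [L2.inner_def, h2] at h
  simpa using h.symm

theorem integrable_norm_sq (f : L2 n) : Integrable fun ξ => ‖f ξ‖ ^ 2 :=
  (memLp_two_iff_integrable_sq_norm (Lp.aestronglyMeasurable f)).1 (Lp.memLp f)

/-- Dominated convergence for multiplication operators. -/
theorem tendsto_mulOp {ι : Type*} {l : Filter ι} [l.IsCountablyGenerated]
    {m : ι → Space n → ℂ} {m₀ : Space n → ℂ} (f : L2 n) {C : ℝ}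
    (hm : ∀ᶠ i in l, Measurable (m i)) (hC : ∀ᶠ i in l, ∀ ξ, ‖m i ξ‖ ≤ C) (hm₀ : BddMeas m₀)
    (hlim : ∀ ξ, Tendsto (fun i => m i ξ) l (𝓝 (m₀ ξ))) :
    Tendsto (fun i => mulOp (m i) f) l (𝓝 (mulOp m₀ f)) := by
  obtain ⟨C₀, hC₀⟩ := hm₀.2
  have key : Tendsto (fun i => ∫ ξ, ‖(m i ξ - m₀ ξ) * f ξ‖ ^ 2) l (𝓝 (∫ _ : Space n, (0 : ℝ))) := by
    refine tendsto_integral_filter_of_dominated_convergence (fun ξ => (C + C₀) ^ 2 * ‖f ξ‖ ^ 2)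
      ?_ ?_ ((integrable_norm_sq f).const_mul _) ?_
    · filter_upwards [hm] with i hi
      exact (((hi.sub hm₀.1).aestronglyMeasurable.mul (Lp.aestronglyMeasurable f)).norm).pow 2
    · filter_upwards [hC] with i hi
      refine Eventually.of_forall fun ξ => ?_
      rw [Real.norm_of_nonneg (by positivity), norm_mul, mul_pow]
      gcongr
      exact (norm_sub_le _ _).trans (add_le_add (hi ξ) (hC₀ ξ))
    · refine Eventually.of_forall fun ξ => ?_
      have := ((((hlim ξ).sub_const (m₀ ξ)).mul_const (f ξ)).norm).pow 2
      simpa using this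
  rw [integral_zero] at key
  rw [tendsto_iff_norm_sub_tendsto_zero]
  have h2 : Tendsto (fun i => √(∫ ξ, ‖(m i ξ - m₀ ξ) * f ξ‖ ^ 2)) l (𝓝 0) := by
    have := (Real.continuous_sqrt.tendsto 0).comp key
    rwa [Real.sqrt_zero] at this
  refine h2.congr' ?_
  filter_upwards [hm, hC] with i hi hi'
  have hb : BddMeas (m i) := ⟨hi, C, hi'⟩
  rw [← mulOp_sub hb hm₀, ← Real.sqrt_sq (norm_nonneg (mulOp _ f)), norm_sq_eq_integral]
  congr 1
  refine integral_congr_ae ?_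
  filter_upwards [coeFn_mulOp (hb.sub hm₀) f] with ξ h
  rw [h]

/-- Strong differentiation of a family of multiplication operators. -/
theorem hasDerivAt_mulOp {m m' : ℝ → Space n → ℂ} (f : L2 n) {a b s C : ℝ} (hs : s ∈ Ioo a b)
    (hm : ∀ r ∈ Ioo a b, BddMeas (m r)) (hm' : Measurable (m' s))
    (hd : ∀ r ∈ Ioo a b, ∀ ξ, HasDerivAt (fun r => m r ξ) (m' r ξ) r)
    (hC : ∀ r ∈ Ioo a b, ∀ ξ, ‖m' r ξ‖ ≤ C) :
    HasDerivAt (fun r => mulOp (m r) f) (mulOp (m' s) f) s := by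
  rw [hasDerivAt_iff_tendsto_slope]
  have hn : Ioo a b ∈ 𝓝[≠] s := nhdsWithin_le_nhds (Ioo_mem_nhds hs.1 hs.2)
  -- The difference quotients are again multiplication operators, bounded by `C` through the mean
  -- value inequality, so dominated convergence applies to them.
  have key : Tendsto (fun r : ℝ => mulOp (fun ξ => ((r : ℂ) - (s : ℂ))⁻¹ * (m r ξ - m s ξ)) f) (𝓝[≠] s)
      (𝓝 (mulOp (m' s) f)) := by
    refine tendsto_mulOp (C := C) f ?_ ?_ ⟨hm', C, hC s hs⟩ ?_
    · filter_upwards [hn] with r hr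
      exact (((hm r hr).sub (hm s hs)).const_mul _).1
    · filter_upwards [hn, self_mem_nhdsWithin] with r hr hrs ξ
      have hmv := (convex_Ioo a b).norm_image_sub_le_of_norm_hasDerivWithin_le
        (f := fun r => m r ξ) (f' := fun r => m' r ξ)
        (fun x hx => (hd x hx ξ).hasDerivWithinAt) (fun x hx => hC x hx ξ) hs hr
      have hpos : 0 < ‖r - s‖ := norm_pos_iff.2 (sub_ne_zero.2 hrs)
      have e : ‖((r : ℂ) - s)⁻¹‖ = ‖r - s‖⁻¹ := by
        rw [norm_inv, ← Complex.ofReal_sub, Complex.norm_real]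
      rw [norm_mul, e, inv_mul_le_iff₀ hpos]
      linarith
    · intro ξ
      have := (hasDerivAt_iff_tendsto_slope.1 (hd s hs ξ))
      refine this.congr fun r => ?_
      rw [slope_def_module, Complex.real_smul]
      push_cast
      rfl
  refine key.congr' ?_
  filter_upwards [hn] with r hr
  rw [mulOp_const_mul ((hm r hr).sub (hm s hs)), mulOp_sub (hm r hr) (hm s hs), slope_def_module]
  rw [← Complex.ofReal_sub, ← Complex.ofReal_inv]
  rfl

/-! ### Fourier multipliers -/

/-- The Fourier multiplier with symbol `m` (in the frequency variable of `𝓕`). -/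
def fourierMul (m : Space n → ℂ) : L2 n →L[ℂ] L2 n :=
  ((Lp.fourierTransformₗᵢ (Space n) ℂ).symm.toContinuousLinearEquiv : L2 n →L[ℂ] L2 n) ∘L mulOp m ∘L
    ((Lp.fourierTransformₗᵢ (Space n) ℂ).toContinuousLinearEquiv : L2 n →L[ℂ] L2 n)

theorem fourierMul_apply (m : Space n → ℂ) (f : L2 n) :
    fourierMul m f = 𝓕⁻ (mulOp m (𝓕 f) : L2 n) := rfl

theorem fourier_fourierMul (m : Space n → ℂ) (f : L2 n) :
    (𝓕 (fourierMul m f) : L2 n) = mulOp m (𝓕 f) := by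
  rw [fourierMul_apply, FourierTransform.fourier_fourierInv_eq]

theorem eq_fourierMul_iff {m : Space n → ℂ} (hm : BddMeas m) {f h : L2 n} :
    h = fourierMul m f ↔ (𝓕 h : L2 n) =ᵐ[volume] fun ξ => m ξ * (𝓕 f : L2 n) ξ := by
  rw [← mulOp_eq_iff hm, ← fourier_fourierMul]
  exact ⟨fun e => e ▸ rfl, fun e => (Lp.fourierTransformₗᵢ (Space n) ℂ).injective e⟩

theorem norm_fourierMul_le {m : Space n → ℂ} (hm : BddMeas m) {C : ℝ} (hC : ∀ ξ, ‖m ξ‖ ≤ C)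
    (f : L2 n) : ‖fourierMul m f‖ ≤ C * ‖f‖ := by
  rw [← Lp.norm_fourier_eq, fourier_fourierMul, ← Lp.norm_fourier_eq f]
  exact norm_mulOp_le hm hC _

/-! ### Change of variables by dilation, distributional Laplacian -/

theorem ae_comp_smul {c : ℝ} (hc : c ≠ 0) {p : Space n → Prop} (h : ∀ᵐ x : Space n, p x) :
    ∀ᵐ x : Space n, p (c • x) := by
  rw [ae_iff] at h ⊢
  have : {x : Space n | ¬p (c • x)} = (fun x => c • x) ⁻¹' {x | ¬p x} := rfl
  rw [this, Measure.addHaar_preimage_smul volume hc, h, mul_zero]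

/-- The two normalisations differ by a nonzero constant, which cancels, and by the substitution `ξ =
2π η`, which preserves null sets. All multiplier arguments can therefore be carried out with `𝓕`. -/
theorem fourierL2_ae_iff {f h : L2 n} {σ : Space n → ℂ} :
    (fourierL2 h =ᵐ[volume] fun ξ => σ ξ * fourierL2 f ξ) ↔
      (𝓕 h : L2 n) =ᵐ[volume] fun η => σ ((2 * Real.pi) • η) * (𝓕 f : L2 n) η := by
  have hπ : (2 * Real.pi) ≠ 0 := by positivity
  have hc : (((2 * Real.pi) ^ (-(n : ℝ) / 2) : ℝ) : ℂ) ≠ 0 := by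
    rw [Complex.ofReal_ne_zero]; positivity
  constructor
  · intro H
    filter_upwards [ae_comp_smul hπ H] with η hη
    simp only [fourierL2, inv_smul_smul₀ hπ] at hη
    rw [mul_left_comm] at hη
    exact mul_left_cancel₀ hc hη
  · intro H
    filter_upwards [ae_comp_smul (inv_ne_zero hπ) H] with ξ hξ
    simp only [smul_inv_smul₀ hπ] at hξ
    rw [fourierL2, fourierL2, hξ, mul_left_comm]

/-- Smooth compactly supported test functions are Schwartz functions. -/
theorem ae_eq_of_integral_schwartz {f g : Space n → ℂ} (hf : LocallyIntegrable f)
    (hg : LocallyIntegrable g) (h : ∀ φ : 𝓢(Space n, ℂ), ∫ x, φ x * f x = ∫ x, φ x * g x) :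
    f =ᵐ[volume] g := by
  refine ae_eq_of_integral_contDiff_smul_eq hf hg fun φ hφ hc => ?_
  have hg₁ : HasCompactSupport (Complex.ofRealCLM ∘ φ) := hc.comp_left rfl
  have hg₂ : ContDiff ℝ ∞ (Complex.ofRealCLM ∘ φ) := by fun_prop
  simpa using h (hg₁.toSchwartzMap hg₂)

theorem locallyIntegrable_L2 (f : L2 n) : LocallyIntegrable f :=
  (Lp.memLp f).locallyIntegrable one_le_two

theorem locallyIntegrable_continuous_mul {a f : Space n → ℂ} (hf : LocallyIntegrable f)
    (ha : Continuous a) : LocallyIntegrable (fun x => a x * f x) := by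
  rw [locallyIntegrable_iff] at hf ⊢
  exact fun K hK => (hf K hK).continuousOn_mul ha.continuousOn hK

/-- The distributional Laplacian on the Fourier side. -/
theorem eq_laplacian_iff {w u : L2 n} : ((w : 𝓢'(Space n, ℂ)) = Δ (u : 𝓢'(Space n, ℂ))) ↔
    (𝓕 w : L2 n) =ᵐ[volume] fun η => ((-(2 * Real.pi) ^ 2 * ‖η‖ ^ 2 : ℝ) : ℂ) *
      (𝓕 u : L2 n) η := by
  have htg : (fun x : Space n => Complex.ofReal (‖x‖ ^ 2)).HasTemperateGrowth := by fun_prop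
  have hinj : ((w : 𝓢'(Space n, ℂ)) = Δ (u : 𝓢'(Space n, ℂ))) ↔
      (𝓕 (w : 𝓢'(Space n, ℂ))) = 𝓕 (Δ (u : 𝓢'(Space n, ℂ))) := by
    refine ⟨fun e => e ▸ rfl, fun e => ?_⟩
    have := congrArg (fun T : 𝓢'(Space n, ℂ) => 𝓕⁻ T) e
    simpa using this
  -- The multiplier of the Laplacian is moved onto the test function, where it acts pointwise
  -- because it has temperate growth.
  have hR : ∀ φ : 𝓢(Space n, ℂ), (𝓕 (Δ (u : 𝓢'(Space n, ℂ)))) φ =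
      ∫ x, φ x * (((-(2 * Real.pi) ^ 2 * ‖x‖ ^ 2 : ℝ) : ℂ) * (𝓕 u : L2 n) x) := by
    intro φ
    rw [TemperedDistribution.laplacian_eq_fourierMultiplierCLM,
      TemperedDistribution.fourierMultiplierCLM_apply, ← Complex.coe_smul,
      FourierTransform.fourier_smul,
      FourierTransform.fourier_fourierInv_eq, Lp.fourier_toTemperedDistribution_eq]
    change ((-(2 * Real.pi) ^ 2 : ℝ) : ℂ) • (((𝓕 u : L2 n) : 𝓢'(Space n, ℂ))
      (SchwartzMap.smulLeftCLM ℂ (fun x : Space n => Complex.ofReal (‖x‖ ^ 2)) φ)) = _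
    rw [Lp.toTemperedDistribution_apply, smul_eq_mul, ← integral_const_mul]
    refine integral_congr_ae (Eventually.of_forall fun x => ?_)
    simp only [SchwartzMap.smulLeftCLM_apply_apply htg, smul_eq_mul]
    push_cast
    ring
  have hL : ∀ φ : 𝓢(Space n, ℂ), (𝓕 (w : 𝓢'(Space n, ℂ))) φ = ∫ x, φ x * (𝓕 w : L2 n) x := by
    intro φ
    rw [Lp.fourier_toTemperedDistribution_eq, Lp.toTemperedDistribution_apply]
    rfl
  rw [hinj]
  constructor
  · intro e
    refine ae_eq_of_integral_schwartz (locallyIntegrable_L2 _)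
      (locallyIntegrable_continuous_mul (locallyIntegrable_L2 _) (by fun_prop)) fun φ => ?_
    rw [← hL, ← hR, e]
  · intro e
    ext φ
    rw [hL, hR]
    refine integral_congr_ae ?_
    filter_upwards [e] with x hx
    rw [hx]

end

section

variable {n : ℕ}

/-! ### Families of Fourier multipliers -/

theorem ofReal_smul_L2 (c : ℝ) (f : L2 n) : (c : ℂ) • f = c • f := by
  refine Lp.ext ?_
  filter_upwards [Lp.coeFn_smul (c : ℂ) f, Lp.coeFn_smul c f] with x h1 h2
  rw [h1, h2]
  rfl

theorem fourierMul_sub {m m' : Space n → ℂ} (hm : BddMeas m) (hm' : BddMeas m') (f : L2 n) :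
    fourierMul (fun ξ => m ξ - m' ξ) f = fourierMul m f - fourierMul m' f := by
  rw [fourierMul_apply, mulOp_sub hm hm']
  exact (Lp.fourierTransformₗᵢ (Space n) ℂ).symm.map_sub _ _

theorem fourierMul_const_mul {m : Space n → ℂ} (hm : BddMeas m) (c : ℂ) (f : L2 n) :
    fourierMul (fun ξ => c * m ξ) f = c • fourierMul m f := by
  rw [fourierMul_apply, mulOp_const_mul hm, FourierTransform.fourierInv_smul]
  rfl

theorem fourierMul_fourierMul {m m' : Space n → ℂ} (hm : BddMeas m) (hm' : BddMeas m')
    (f : L2 n) : fourierMul m (fourierMul m' f) = fourierMul (fun ξ => m ξ * m' ξ) f := by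
  rw [fourierMul_apply, fourier_fourierMul, mulOp_mulOp hm hm', fourierMul_apply]

theorem fourierMul_one (f : L2 n) : fourierMul (fun _ => 1) f = f := by
  refine ((eq_fourierMul_iff (m := fun _ => 1) ⟨measurable_const, 1, by simp⟩).2 ?_).symm
  simp

theorem tendsto_fourierMul {ι : Type*} {l : Filter ι} [l.IsCountablyGenerated]
    {m : ι → Space n → ℂ} {m₀ : Space n → ℂ} (f : L2 n) {C : ℝ}
    (hm : ∀ᶠ i in l, Measurable (m i)) (hC : ∀ᶠ i in l, ∀ ξ, ‖m i ξ‖ ≤ C) (hm₀ : BddMeas m₀)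
    (hlim : ∀ ξ, Tendsto (fun i => m i ξ) l (𝓝 (m₀ ξ))) :
    Tendsto (fun i => fourierMul (m i) f) l (𝓝 (fourierMul m₀ f)) :=
  ((Lp.fourierTransformₗᵢ (Space n) ℂ).symm.continuous.tendsto _).comp
    (tendsto_mulOp (𝓕 f) hm hC hm₀ hlim)

theorem hasDerivAt_fourierMul {m m' : ℝ → Space n → ℂ} (f : L2 n) {a b s C : ℝ}
    (hs : s ∈ Ioo a b) (hm : ∀ r ∈ Ioo a b, BddMeas (m r)) (hm' : Measurable (m' s))
    (hd : ∀ r ∈ Ioo a b, ∀ ξ, HasDerivAt (fun r => m r ξ) (m' r ξ) r)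
    (hC : ∀ r ∈ Ioo a b, ∀ ξ, ‖m' r ξ‖ ≤ C) :
    HasDerivAt (fun r => fourierMul (m r) f) (fourierMul (m' s) f) s :=
  (((Lp.fourierTransformₗᵢ (Space n) ℂ).symm.toContinuousLinearEquiv :
    L2 n →L[ℂ] L2 n).restrictScalars ℝ).hasFDerivAt.comp_hasDerivAt s
    (hasDerivAt_mulOp (𝓕 f) hs hm hm' hd hC)

/-! ### The solution operators -/

/-- The squared angular frequency `|ξ|²` with `ξ = 2π η`. -/
def freqSq (η : Space n) : ℝ := ‖(2 * Real.pi) • η‖ ^ 2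

theorem freqSq_nonneg (η : Space n) : 0 ≤ freqSq η := sq_nonneg _

theorem freqSq_eq (η : Space n) : freqSq η = (2 * Real.pi) ^ 2 * ‖η‖ ^ 2 := by
  rw [freqSq, norm_smul, mul_pow, Real.norm_of_nonneg (by positivity)]

theorem continuous_freqSq : Continuous (freqSq : Space n → ℝ) := by
  unfold freqSq
  fun_prop

/-- The symbol `E_{γ,1}(-|2πη|² t^γ)` in the frequency variable of `𝓕`. -/
def flowSym (γ t : ℝ) (η : Space n) : ℂ := (symbol γ t ((2 * Real.pi) • η) : ℝ)

theorem flowSym_eq (γ t : ℝ) (η : Space n) : flowSym γ t η = (mlFlow γ (freqSq η) t : ℝ) := rfl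

variable {γ : ℝ}

theorem measurable_flowSym (hγ : 0 < γ) (t : ℝ) : Measurable (flowSym γ t : Space n → ℂ) :=
  (Complex.continuous_ofReal.comp ((continuous_mlFlow hγ).comp
    (continuous_freqSq.prodMk continuous_const))).measurable

theorem norm_flowSym_le (hγ : γ ∈ Ioo (0 : ℝ) 1) {t : ℝ} (ht : 0 ≤ t) (η : Space n) :
    ‖flowSym γ t η‖ ≤ 1 := by
  rw [flowSym_eq, Complex.norm_real, Real.norm_of_nonneg (mlFlow_pos hγ (freqSq_nonneg η) ht).le]
  exact mlFlow_le_one hγ (freqSq_nonneg η) ht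

theorem flowSym_ne_zero (hγ : γ ∈ Ioo (0 : ℝ) 1) {t : ℝ} (ht : 0 ≤ t) (η : Space n) :
    flowSym γ t η ≠ 0 := by
  rw [flowSym_eq, Complex.ofReal_ne_zero]
  exact (mlFlow_pos hγ (freqSq_nonneg η) ht).ne'

theorem bddMeas_flowSym (hγ : γ ∈ Ioo (0 : ℝ) 1) {t : ℝ} (ht : 0 ≤ t) :
    BddMeas (flowSym γ t : Space n → ℂ) :=
  ⟨measurable_flowSym hγ.1 t, 1, norm_flowSym_le hγ ht⟩

/-- The solution operator `u(0) ↦ u(t)`. -/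
def flow (γ t : ℝ) : L2 n →L[ℂ] L2 n := fourierMul (flowSym γ t)

theorem flow_zero (hγ : 0 < γ) (f : L2 n) : flow γ 0 f = f := by
  have : (flowSym γ 0 : Space n → ℂ) = fun _ => 1 := by
    ext η
    rw [flowSym_eq, mlFlow_zero hγ, Complex.ofReal_one]
  rw [flow, this, fourierMul_one]

/-- Injectivity needs only that the symbol has no zero; no positive lower bound is required. -/
theorem flow_injective (hγ : γ ∈ Ioo (0 : ℝ) 1) {t : ℝ} (ht : 0 ≤ t) :
    Function.Injective (flow γ t : L2 n → L2 n) := by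
  intro f g h
  have h1 := (eq_fourierMul_iff (bddMeas_flowSym hγ ht)).1 (rfl : flow γ t f = fourierMul _ f)
  have h2 := (eq_fourierMul_iff (bddMeas_flowSym hγ ht)).1 (rfl : flow γ t g = fourierMul _ g)
  rw [h] at h1
  refine (Lp.fourierTransformₗᵢ (Space n) ℂ).injective (Lp.ext ?_)
  filter_upwards [h1, h2] with η e1 e2
  rw [e1] at e2
  exact mul_left_cancel₀ (flowSym_ne_zero hγ ht η) e2

theorem continuousOn_flow (hγ : γ ∈ Ioo (0 : ℝ) 1) (f : L2 n) :
    ContinuousOn (fun t => flow γ t f) (Ici 0) := by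
  intro t ht
  refine tendsto_fourierMul (C := 1) f (Eventually.of_forall fun s => measurable_flowSym hγ.1 s)
    ?_ (bddMeas_flowSym hγ ht) fun η => ?_
  · filter_upwards [self_mem_nhdsWithin] with s hs η
    exact norm_flowSym_le hγ hs η
  · exact ((Complex.continuous_ofReal.comp
      (continuous_mlFlow_time hγ.1 (freqSq η))).tendsto t).mono_left nhdsWithin_le_nhds

/-! ### Sobolev norms -/

/-- `K` collects the normalisation constant and the Jacobian of `ξ = 2π η`. Its finiteness is all
that is used. -/
theorem exists_sobolevENorm_eq (n : ℕ) : ∃ K : ℝ≥0∞, K ≠ ⊤ ∧ ∀ h : L2 n, sobolevENorm 2 h =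
    K * eLpNorm (fun η => ((1 + freqSq η : ℝ) : ℂ) * (𝓕 h : L2 n) η) 2 volume := by
  have hπ : (2 * Real.pi)⁻¹ ≠ 0 := by positivity
  set c : ℂ := (((2 * Real.pi) ^ (-(n : ℝ) / 2) : ℝ) : ℂ)
  set D : ℝ≥0∞ := ENNReal.ofReal |((2 * Real.pi)⁻¹ ^ Module.finrank ℝ (Space n))⁻¹|
  refine ⟨‖c‖ₑ * D ^ (1 / (2 : ℝ≥0∞)).toReal, ?_, fun h => ?_⟩
  · exact ENNReal.mul_ne_top enorm_ne_top (ENNReal.rpow_ne_top_of_nonneg (by positivity)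
      ENNReal.ofReal_ne_top)
  set G : Space n → ℂ := fun η => ((1 + freqSq η : ℝ) : ℂ) * (𝓕 h : L2 n) η with hG
  have e1 : (fun ξ : Space n => (((1 + ‖ξ‖ ^ 2) ^ ((2 : ℝ) / 2) : ℝ) : ℂ) * fourierL2 h ξ) =
      c • (G ∘ fun ξ => (2 * Real.pi)⁻¹ • ξ) := by
    ext ξ
    simp only [Pi.smul_apply, Function.comp, hG, freqSq, fourierL2, smul_eq_mul]
    rw [smul_inv_smul₀ (by positivity), div_self two_ne_zero, Real.rpow_one]
    ring
  have e2 : eLpNorm (G ∘ fun ξ => (2 * Real.pi)⁻¹ • ξ) 2 volume =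
      D ^ (1 / (2 : ℝ≥0∞)).toReal * eLpNorm G 2 volume := by
    have hme : MeasurableEmbedding (fun ξ : Space n => (2 * Real.pi)⁻¹ • ξ) :=
      measurableEmbedding_const_smul₀ hπ
    rw [← hme.eLpNorm_map_measure, Measure.map_addHaar_smul volume hπ,
      eLpNorm_smul_measure_of_ne_top (by simp), smul_eq_mul]
  rw [sobolevENorm, e1, eLpNorm_const_smul, e2, mul_assoc]

/-- The weight is absorbed into the symbol, so statements in `H²` become statements about
multiplication operators on `L²`. -/
theorem exists_sobolevENorm_fourierMul (n : ℕ) : ∃ K : ℝ≥0∞, K ≠ ⊤ ∧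
    ∀ (m : Space n → ℂ) (f : L2 n), BddMeas m → BddMeas (fun η => ((1 + freqSq η : ℝ) : ℂ) * m η) →
      sobolevENorm 2 (fourierMul m f) =
        K * ‖mulOp (fun η => ((1 + freqSq η : ℝ) : ℂ) * m η) (𝓕 f)‖ₑ := by
  obtain ⟨K, hK, h⟩ := exists_sobolevENorm_eq n
  refine ⟨K, hK, fun m f hm hm' => ?_⟩
  rw [h, Lp.enorm_def]
  congr 1
  refine eLpNorm_congr_ae ?_
  filter_upwards [coeFn_mulOp hm' (𝓕 f), (eq_fourierMul_iff hm).1 (rfl : _ = fourierMul m f)]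
    with η h1 h2
  rw [h1, h2, mul_assoc]

theorem norm_weight_mul_flowSym_le (hγ : γ ∈ Ioo (0 : ℝ) 1) {r t : ℝ} (hr : 0 < r) (hrt : r ≤ t)
    (η : Space n) : ‖((1 + freqSq η : ℝ) : ℂ) * flowSym γ t η‖ ≤ 1 + mlDecay γ r := by
  have h0 := freqSq_nonneg η
  rw [flowSym_eq, norm_mul, Complex.norm_real, Complex.norm_real, Real.norm_of_nonneg (by linarith),
    Real.norm_of_nonneg (mlFlow_pos hγ h0 (hr.le.trans hrt)).le]
  exact mlFlow_mul_one_add_le hγ h0 hr hrt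

theorem bddMeas_weight_mul_flowSym (hγ : γ ∈ Ioo (0 : ℝ) 1) {t : ℝ} (ht : 0 < t) :
    BddMeas (fun η : Space n => ((1 + freqSq η : ℝ) : ℂ) * flowSym γ t η) :=
  ⟨(Complex.continuous_ofReal.comp (continuous_const.add continuous_freqSq)).measurable.mul
    (measurable_flowSym hγ.1 t), 1 + mlDecay γ t, norm_weight_mul_flowSym_le hγ ht le_rfl⟩

theorem sobolevENorm_flow_lt_top (hγ : γ ∈ Ioo (0 : ℝ) 1) {t : ℝ} (ht : 0 < t) (f : L2 n) :
    sobolevENorm 2 (flow γ t f) < ⊤ := by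
  obtain ⟨K, hK, h⟩ := exists_sobolevENorm_fourierMul n
  rw [flow, h _ f (bddMeas_flowSym hγ ht.le) (bddMeas_weight_mul_flowSym hγ ht)]
  exact ENNReal.mul_lt_top hK.lt_top enorm_lt_top

theorem tendsto_sobolevENorm_flow (hγ : γ ∈ Ioo (0 : ℝ) 1) {t : ℝ} (ht : 0 < t) (f : L2 n) :
    Tendsto (fun s => sobolevENorm 2 (flow γ s f - flow γ t f)) (𝓝 t) (𝓝 0) := by
  obtain ⟨K, hK, h⟩ := exists_sobolevENorm_fourierMul n
  -- Times above `t / 2` share the bound `1 + mlDecay γ (t / 2)` on the weighted symbol.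
  have hev : ∀ᶠ s in 𝓝 t, t / 2 < s := lt_mem_nhds (by linarith)
  have key := tendsto_mulOp (l := 𝓝 t)
    (m := fun s (η : Space n) => ((1 + freqSq η : ℝ) : ℂ) * flowSym γ s η)
    (m₀ := fun (η : Space n) => ((1 + freqSq η : ℝ) : ℂ) * flowSym γ t η) (𝓕 f)
    (C := 1 + mlDecay γ (t / 2))
    (hev.mono fun s hs => (bddMeas_weight_mul_flowSym hγ (by linarith)).1)
    (hev.mono fun s hs η => norm_weight_mul_flowSym_le hγ (by linarith) hs.le η)
    (bddMeas_weight_mul_flowSym hγ ht)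
    (fun η => (((Complex.continuous_ofReal.comp
      (continuous_mlFlow_time hγ.1 (freqSq η))).tendsto t).const_mul _))
  rw [tendsto_iff_edist_tendsto_0] at key
  have key2 := ENNReal.Tendsto.const_mul (a := K) key (Or.inr hK)
  rw [mul_zero] at key2
  refine key2.congr' ?_
  filter_upwards [hev] with s hs
  have hs0 : 0 < s := by linarith
  have hb := bddMeas_flowSym (n := n) hγ hs0.le
  have hb' := bddMeas_flowSym (n := n) hγ ht.le
  have hw := bddMeas_weight_mul_flowSym (n := n) hγ hs0
  have hw' := bddMeas_weight_mul_flowSym (n := n) hγ ht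
  have e : (fun η : Space n => ((1 + freqSq η : ℝ) : ℂ) * (flowSym γ s η - flowSym γ t η)) =
      fun η => ((1 + freqSq η : ℝ) : ℂ) * flowSym γ s η -
        ((1 + freqSq η : ℝ) : ℂ) * flowSym γ t η := by
    ext η; ring
  rw [flow, flow, ← fourierMul_sub hb hb', h _ f (hb.sub hb') (e ▸ hw.sub hw'), e,
    mulOp_sub hw hw', edist_eq_enorm_sub]

/-! ### The fractional derivative of the flow -/

/-- The symbol of the time derivative of the flow. -/
def driftSym (γ t : ℝ) (η : Space n) : ℂ := (mlDrift γ (freqSq η) t / t : ℝ)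

theorem measurable_driftSym (hγ : 0 < γ) (t : ℝ) : Measurable (driftSym γ t : Space n → ℂ) :=
  (Complex.continuous_ofReal.comp (((continuous_mlDrift hγ).comp
    (continuous_freqSq.prodMk continuous_const)).div_const t)).measurable

theorem norm_driftSym_le (hγ : γ ∈ Ioo (0 : ℝ) 1) {r t : ℝ} (hr : 0 < r) (hrt : r ≤ t)
    (η : Space n) : ‖driftSym γ t η‖ ≤ r⁻¹ := by
  have ht : 0 < t := hr.trans_le hrt
  rw [driftSym, Complex.norm_real, norm_div, Real.norm_of_nonneg ht.le, Real.norm_eq_abs]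
  calc |mlDrift γ (freqSq η) t| / t ≤ 1 / t := by
        gcongr; exact abs_mlDrift_le hγ (freqSq_nonneg η) ht.le
    _ ≤ r⁻¹ := by rw [one_div]; gcongr

theorem bddMeas_driftSym (hγ : γ ∈ Ioo (0 : ℝ) 1) {t : ℝ} (ht : 0 < t) :
    BddMeas (driftSym γ t : Space n → ℂ) :=
  ⟨measurable_driftSym hγ.1 t, t⁻¹, norm_driftSym_le hγ ht le_rfl⟩

theorem hasDerivAt_flow (hγ : γ ∈ Ioo (0 : ℝ) 1) {t : ℝ} (ht : 0 < t) (f : L2 n) :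
    HasDerivAt (fun s => flow γ s f) (fourierMul (driftSym γ t) f) t := by
  refine hasDerivAt_fourierMul (m' := driftSym γ) (C := (t / 2)⁻¹) f
    (show t ∈ Ioo (t / 2) (t + 1) from ⟨by linarith, by linarith⟩) ?_
    (measurable_driftSym hγ.1 t) ?_ ?_
  · exact fun r hr => bddMeas_flowSym hγ (by linarith [hr.1])
  · exact fun r hr η => (hasDerivAt_mlFlow hγ.1 (freqSq η) (by linarith [hr.1])).ofReal_comp
  · exact fun r hr η => norm_driftSym_le hγ (by linarith) hr.1.le η

/-- The symbol of the truncated Caputo integral of the flow. -/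
def caputoSym (γ t r : ℝ) (η : Space n) : ℂ := (mlCaputoInt γ (freqSq η) r t : ℝ)

theorem measurable_caputoSym (hγ : 0 < γ) (t r : ℝ) :
    Measurable (caputoSym γ t r : Space n → ℂ) :=
  Complex.measurable_ofReal.comp
    ((measurable_mlCaputoInt hγ r t).comp continuous_freqSq.measurable)

theorem exists_norm_caputoSym_le (hγ : γ ∈ Ioo (0 : ℝ) 1) {t : ℝ} (ht : 0 < t) :
    ∃ C, ∀ r ∈ Ioc 0 t, ∀ η : Space n, ‖caputoSym γ t r η‖ ≤ C := by
  refine ⟨(t / 2) ^ (-γ) + 2 / (t * (1 - γ)) * t ^ (1 - γ), fun r hr η => ?_⟩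
  rw [caputoSym, Complex.norm_real, Real.norm_eq_abs]
  rcases hr.2.lt_or_eq with h | rfl
  · exact abs_mlCaputoInt_le hγ (freqSq_nonneg η) ⟨hr.1, h⟩
  · have : 0 < 1 - γ := by linarith [hγ.2]
    rw [mlCaputoInt, intervalIntegral.integral_same, abs_zero]
    positivity

theorem continuousOn_fourierMul_caputoSym (hγ : γ ∈ Ioo (0 : ℝ) 1) {t ε : ℝ} (hε : ε ∈ Ioo 0 t)
    (f : L2 n) : ContinuousOn (fun r => fourierMul (caputoSym γ t r) f) (Icc ε t) := by
  obtain ⟨C, hC⟩ := exists_norm_caputoSym_le (n := n) hγ (hε.1.trans hε.2)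
  intro r hr
  refine tendsto_fourierMul (C := C) f
    (Eventually.of_forall fun s => measurable_caputoSym hγ.1 t s) ?_
    ⟨measurable_caputoSym hγ.1 t r, C, hC r ⟨hε.1.trans_le hr.1, hr.2⟩⟩ fun η => ?_
  · filter_upwards [self_mem_nhdsWithin] with s hs
    exact hC s ⟨hε.1.trans_le hs.1, hs.2⟩
  · exact (Complex.continuous_ofReal.tendsto _).comp
      (continuousOn_mlCaputoInt hγ (freqSq η) hε r hr)

theorem hasDerivAt_fourierMul_caputoSym (hγ : γ ∈ Ioo (0 : ℝ) 1) {t r : ℝ} (hr : r ∈ Ioo 0 t)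
    (f : L2 n) : HasDerivAt (fun r => fourierMul (caputoSym γ t r) f)
      (-((t - r) ^ (-γ) • deriv (fun s => flow γ s f) r)) r := by
  obtain ⟨C, hC⟩ := exists_norm_caputoSym_le (n := n) hγ (hr.1.trans hr.2)
  -- The interval `(r/2, (r+t)/2)` stays away from both singularities: there `1/s ≤ (r/2)⁻¹` and `t
  -- - s ≥ (t-r)/2`.
  have h := hasDerivAt_fourierMul (m := caputoSym γ t)
    (m' := fun r (η : Space n) => (-(t - r) ^ (-γ) : ℝ) * driftSym γ r η)
    (C := ((t - r) / 2) ^ (-γ) * (r / 2)⁻¹) f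
    (show r ∈ Ioo (r / 2) ((r + t) / 2) from ⟨by linarith [hr.1], by linarith [hr.2]⟩)
    (fun s hs => ⟨measurable_caputoSym hγ.1 t s, C,
      hC s ⟨by linarith [hs.1, hr.1], by linarith [hs.2, hr.2]⟩⟩)
    (measurable_const.mul (measurable_driftSym hγ.1 r)) ?_ ?_
  · rw [fourierMul_const_mul (bddMeas_driftSym hγ hr.1), ofReal_smul_L2, neg_smul,
      ← (hasDerivAt_flow hγ hr.1 f).deriv] at h
    exact h
  · intro s hs η
    refine ((hasDerivAt_mlCaputoInt hγ (freqSq η) (ε := s) (t := t)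
      ⟨by linarith [hs.1, hr.1], by linarith [hs.2, hr.2]⟩).ofReal_comp).congr_deriv ?_
    rw [driftSym]
    push_cast
    ring
  · intro s hs η
    rw [norm_mul, Complex.norm_real, norm_neg,
      Real.norm_of_nonneg (Real.rpow_nonneg (by linarith [hs.2, hr.2]) _)]
    have h1 := norm_driftSym_le hγ (by linarith [hr.1]) hs.1.le η
    have h2 : (t - s) ^ (-γ) ≤ ((t - r) / 2) ^ (-γ) :=
      Real.rpow_le_rpow_of_nonpos (by linarith [hr.2]) (by linarith [hs.2]) (by linarith [hγ.1])
    exact mul_le_mul h2 h1 (norm_nonneg _) (Real.rpow_nonneg (by linarith [hr.2]) _)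

theorem intervalIntegrable_deriv_flow (hγ : γ ∈ Ioo (0 : ℝ) 1) {t ε : ℝ} (hε : ε ∈ Ioo 0 t)
    (f : L2 n) : IntervalIntegrable
      (fun s => (t - s) ^ (-γ) • deriv (fun s => flow γ s f) s) volume ε t := by
  have h1 : IntervalIntegrable (fun s : ℝ => (t - s) ^ (-γ)) volume ε t := by
    have := (intervalIntegral.intervalIntegrable_rpow' (a := t - ε) (b := t - t) (r := -γ)
      (by linarith [hγ.2])).comp_sub_left t
    simpa using this
  have h2 := h1.mul_const (ε⁻¹ * ‖f‖)
  rw [intervalIntegrable_iff_integrableOn_Ioo_of_le hε.2.le] at h2 ⊢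
  refine h2.mono' ?_ ?_
  · exact (((measurable_const.sub measurable_id).pow_const _).stronglyMeasurable.smul
      (stronglyMeasurable_deriv _)).aestronglyMeasurable
  · filter_upwards [ae_restrict_mem measurableSet_Ioo] with s hs
    have hs0 : 0 < s := hε.1.trans hs.1
    rw [(hasDerivAt_flow hγ hs0 f).deriv, norm_smul,
      Real.norm_of_nonneg (Real.rpow_nonneg (sub_nonneg.2 hs.2.le) _)]
    exact mul_le_mul_of_nonneg_left (norm_fourierMul_le (bddMeas_driftSym hγ hs0)
      (norm_driftSym_le hγ hε.1 hs.1.le) f) (Real.rpow_nonneg (sub_nonneg.2 hs.2.le) _)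

/-- The symbol of the Laplacian of the flow. -/
def laplaceSym (γ t : ℝ) (η : Space n) : ℂ := (-freqSq η : ℝ) * flowSym γ t η

theorem bddMeas_laplaceSym (hγ : γ ∈ Ioo (0 : ℝ) 1) {t : ℝ} (ht : 0 < t) :
    BddMeas (laplaceSym γ t : Space n → ℂ) := by
  refine ⟨(Complex.continuous_ofReal.comp continuous_freqSq.neg).measurable.mul
    (measurable_flowSym hγ.1 t), mlDecay γ t, fun η => ?_⟩
  have h0 := freqSq_nonneg η
  rw [laplaceSym, flowSym_eq, norm_mul, Complex.norm_real, Complex.norm_real, norm_neg,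
    Real.norm_of_nonneg h0, Real.norm_of_nonneg (mlFlow_pos hγ h0 ht.le).le]
  exact mul_mlFlow_le hγ h0 ht

/-- The truncated vector integral is the multiplier whose symbol is the scalar truncated integral.
These symbols are bounded uniformly in the frequency and in `ε`, and after division by `Γ(1-γ)` they
converge pointwise to that of the Laplacian of the flow. -/
theorem hasCaputoDerivAt_flow (hγ : γ ∈ Ioo (0 : ℝ) 1) {t : ℝ} (ht : 0 < t) (f : L2 n) :
    HasCaputoDerivAt γ (fun s => flow γ s f) (fourierMul (laplaceSym γ t) f) t := by
  refine ⟨fun s hs => (hasDerivAt_flow hγ hs.1 f).differentiableAt.differentiableWithinAt,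
    fun ε hε => intervalIntegrable_deriv_flow hγ hε f, ?_⟩
  obtain ⟨C, hC⟩ := exists_norm_caputoSym_le (n := n) hγ ht
  have hmem : Ioo 0 t ∈ 𝓝[>] (0 : ℝ) := Ioo_mem_nhdsGT ht
  have hG : 0 < Real.Gamma (1 - γ) := Real.Gamma_pos_of_pos (by linarith [hγ.2])
  have key := tendsto_fourierMul (l := 𝓝[>] (0 : ℝ)) (C := ‖(Real.Gamma (1 - γ))⁻¹‖ * C)
    (m := fun ε (η : Space n) => ((Real.Gamma (1 - γ))⁻¹ : ℝ) * caputoSym γ t ε η) f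
    (Eventually.of_forall fun ε => measurable_const.mul (measurable_caputoSym hγ.1 t ε))
    (by
      filter_upwards [hmem] with ε hε η
      rw [norm_mul, Complex.norm_real]
      exact mul_le_mul_of_nonneg_left (hC ε ⟨hε.1, hε.2.le⟩ η) (norm_nonneg _))
    (bddMeas_laplaceSym hγ ht)
    (fun η => by
      have := (Complex.continuous_ofReal.tendsto _).comp (tendsto_mlCaputoInt hγ (freqSq η) ht)
      rw [Complex.ofReal_mul] at this
      refine this.congr fun ε => ?_
      simp only [Function.comp, Complex.ofReal_mul]
      rfl)
  refine key.congr' ?_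
  filter_upwards [hmem] with ε hε
  rw [fourierMul_const_mul ⟨measurable_caputoSym hγ.1 t ε, C, hC ε ⟨hε.1, hε.2.le⟩⟩,
    ofReal_smul_L2]
  congr 1
  have hftc := intervalIntegral.integral_eq_sub_of_hasDerivAt_of_le hε.2.le
    (continuousOn_fourierMul_caputoSym hγ hε f)
    (fun r hr => hasDerivAt_fourierMul_caputoSym hγ ⟨hε.1.trans hr.1, hr.2⟩ f)
    (intervalIntegrable_deriv_flow hγ hε f).neg
  -- The boundary term at the upper end vanishes. The form `0 * 1` makes `fourierMul_const_mul`
  -- applicable.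
  have h0 : (caputoSym γ t t : Space n → ℂ) = fun _ => 0 * 1 := by
    ext η
    rw [caputoSym, mlCaputoInt, intervalIntegral.integral_same]
    simp
  rw [h0, fourierMul_const_mul ⟨measurable_const, 1, by simp⟩, zero_smul, zero_sub,
    intervalIntegral.integral_neg, neg_inj] at hftc
  exact hftc.symm

/-- The flow solves the initial value problem. -/
theorem isSolution_flow (hγ : γ ∈ Ioo (0 : ℝ) 1) {T : ℝ} (f : L2 n) :
    IsSolution γ T (flow γ T f) (fun t => flow γ t f) where
  continuousOn := (continuousOn_flow hγ f).mono Icc_subset_Ici_self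
  mem_sobolev t ht := sobolevENorm_flow_lt_top hγ ht.1 f
  continuousOn_sobolev t ht := (tendsto_sobolevENorm_flow hγ ht.1 f).mono_left nhdsWithin_le_nhds
  equation t ht := by
    refine ⟨fourierMul (laplaceSym γ t) f, hasCaputoDerivAt_flow hγ ht.1 f, eq_laplacian_iff.2 ?_⟩
    filter_upwards [(eq_fourierMul_iff (bddMeas_laplaceSym hγ ht.1)).1
        (rfl : _ = fourierMul (laplaceSym γ t) f),
      (eq_fourierMul_iff (bddMeas_flowSym hγ ht.1.le)).1 (rfl : flow γ t f = fourierMul _ f)]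
      with η h1 h2
    rw [h1, h2, laplaceSym, freqSq_eq]
    push_cast
    ring
  final := rfl

/-! ### Uniqueness -/

/-- By Plancherel the inner product is minus the integral of `|ξ|² |û|²`. -/
theorem re_inner_laplacian_nonpos {w u : L2 n}
    (h : (w : 𝓢'(Space n, ℂ)) = Δ (u : 𝓢'(Space n, ℂ))) : (⟪u, w⟫_ℂ).re ≤ 0 := by
  rw [eq_laplacian_iff] at h
  have e : ⟪u, w⟫_ℂ =
      ((∫ η, -(2 * Real.pi) ^ 2 * ‖η‖ ^ 2 * ‖(𝓕 u : L2 n) η‖ ^ 2 : ℝ) : ℂ) := by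
    rw [← Lp.inner_fourier_eq, L2.inner_def, ← integral_complex_ofReal]
    refine integral_congr_ae ?_
    filter_upwards [h] with η hη
    rw [hη, ← smul_eq_mul, inner_smul_right, inner_self_eq_norm_sq_to_K]
    push_cast
    rfl
  rw [e, Complex.ofReal_re]
  refine integral_nonpos fun η => ?_
  have : 0 ≤ (2 * Real.pi) ^ 2 * ‖η‖ ^ 2 * ‖(𝓕 u : L2 n) η‖ ^ 2 := by positivity
  simp only [Pi.zero_apply]
  linarith

theorem HasCaputoDerivAt.differentiableAt {X : Type*} [NormedAddCommGroup X] [NormedSpace ℝ X]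
    {u : ℝ → X} {w : X} {s t : ℝ} (h : HasCaputoDerivAt γ u w t) (hs : s ∈ Ioo 0 t) :
    DifferentiableAt ℝ u s :=
  (h.1 s hs).differentiableAt (Ioo_mem_nhds hs.1 hs.2)

/-- Solutions with the same initial value coincide. -/
theorem IsSolution.eqOn_of_initial (hγ : γ ∈ Ioo (0 : ℝ) 1) {T : ℝ} (hT : 0 < T) {g h : L2 n}
    {u v : ℝ → L2 n} (hu : IsSolution γ T g u) (hv : IsSolution γ T h v) (h0 : u 0 = v 0) :
    EqOn u v (Icc 0 T) := by
  set d : ℝ → L2 n := fun t => u t - v t with hd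
  have hdc : ContinuousOn d (Icc 0 T) := hu.continuousOn.sub hv.continuousOn
  have hd0 : d 0 = 0 := sub_eq_zero.2 h0
  have heq : ∀ t ∈ Ioo 0 T, ∃ w : L2 n, HasCaputoDerivAt γ d w t ∧
      (w : 𝓢'(Space n, ℂ)) = Δ (d t : 𝓢'(Space n, ℂ)) := by
    intro t ht
    obtain ⟨w, hw, hw'⟩ := hu.equation t ht
    obtain ⟨z, hz, hz'⟩ := hv.equation t ht
    refine ⟨w - z, hw.sub ht.1 hz, ?_⟩
    rw [eq_laplacian_iff] at hw' hz' ⊢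
    have e1 : (𝓕 (w - z) : L2 n) = 𝓕 w - 𝓕 z := (Lp.fourierTransformₗᵢ (Space n) ℂ).map_sub w z
    have e2 : (𝓕 (d t) : L2 n) = 𝓕 (u t) - 𝓕 (v t) :=
      (Lp.fourierTransformₗᵢ (Space n) ℂ).map_sub (u t) (v t)
    rw [e1, e2]
    filter_upwards [hw', hz', Lp.coeFn_sub (𝓕 w : L2 n) (𝓕 z),
      Lp.coeFn_sub (𝓕 (u t) : L2 n) (𝓕 (v t))] with η a1 a2 a3 a4
    rw [a3, a4, Pi.sub_apply, Pi.sub_apply, a1, a2, mul_sub]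
  have hdiff : ∀ t ∈ Ioo 0 T, DifferentiableAt ℝ d t := by
    intro t ht
    -- The Caputo derivative at a time gives differentiability only strictly before it, so the
    -- equation is used at a later time.
    obtain ⟨w, hw, -⟩ := heq ((t + T) / 2) ⟨by linarith [ht.1], by linarith [ht.2]⟩
    exact hw.differentiableAt ⟨ht.1, by linarith [ht.2]⟩
  have hzero : ∀ t ∈ Ico 0 T, d t = 0 := by
    intro t ht
    by_contra hne
    obtain ⟨r, hr, hmax⟩ := isCompact_Icc.exists_isMaxOn (nonempty_Icc.2 ht.1)
      (hdc.mono (Icc_subset_Icc_right ht.2.le)).norm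
    have hrn : 0 < ‖d r‖ := (norm_pos_iff.2 hne).trans_le (hmax (right_mem_Icc.2 ht.1))
    have hr0 : 0 < r := by
      rcases hr.1.lt_or_eq with h | rfl
      · exact h
      · rw [hd0, norm_zero] at hrn; exact absurd hrn (lt_irrefl _)
    have hrT : r ∈ Ioo 0 T := ⟨hr0, hr.2.trans_lt ht.2⟩
    obtain ⟨w, hw, hwΔ⟩ := heq r hrT
    -- Pairing with `d r` reduces to a scalar function. By Cauchy–Schwarz, `s ↦ Re ⟪d r, d s⟫`
    -- attains its maximum over `[0, r]` at `r`, because `‖d‖` does.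
    set L : L2 n →L[ℝ] ℝ := Complex.reCLM ∘L (innerSL ℂ (d r)).restrictScalars ℝ with hL
    have hLapp : ∀ x, L x = (⟪d r, x⟫_ℂ).re := fun x => rfl
    have hLr : L (d r) = ‖d r‖ ^ 2 := by
      rw [hLapp]; exact inner_self_eq_norm_sq (𝕜 := ℂ) (d r)
    have hext := (hw.clm_comp L hr0).rpow_mul_sub_le hγ hr0
      (L.continuous.comp_continuousOn (hdc.mono (Icc_subset_Icc_right hrT.2.le)))
      (L.differentiableAt.comp r (hdiff r hrT)) (fun s hs => by
        rw [hLr, hLapp]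
        have h1 : (⟪d r, d s⟫_ℂ).re ≤ ‖d r‖ * ‖d s‖ := re_inner_le_norm (𝕜 := ℂ) (d r) (d s)
        have h2 : ‖d s‖ ≤ ‖d r‖ := hmax ⟨hs.1, hs.2.trans hr.2⟩
        nlinarith [norm_nonneg (d r)])
    rw [hd0, map_zero, sub_zero, hLr, hLapp] at hext
    have h1 := re_inner_laplacian_nonpos hwΔ
    have h2 : Real.Gamma (1 - γ) * (⟪d r, w⟫_ℂ).re ≤ 0 :=
      mul_nonpos_of_nonneg_of_nonpos (Real.Gamma_pos_of_pos (by linarith [hγ.2])).le h1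
    have h3 : 0 < r ^ (-γ) * ‖d r‖ ^ 2 := mul_pos (Real.rpow_pos_of_pos hr0 _) (by positivity)
    linarith
  -- The equation is not assumed at `T`; the end point is reached by continuity.
  have hcl : EqOn d (fun _ => 0) (Icc 0 T) := by
    rw [← closure_Ico hT.ne]
    refine EqOn.of_subset_closure (s := Ico 0 T) (t := Icc 0 T) hzero hdc continuousOn_const
      Ico_subset_Icc_self (by rw [closure_Ico hT.ne]) |>.mono (by rw [closure_Ico hT.ne])
  exact fun t ht => sub_eq_zero.1 (hcl ht)

/-- The flow started at `u 0` is a solution with the same initial value. From here on, statements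
about solutions are identities between multipliers. -/
theorem IsSolution.eq_flow (hγ : γ ∈ Ioo (0 : ℝ) 1) {T : ℝ} (hT : 0 < T) {g : L2 n}
    {u : ℝ → L2 n} (hu : IsSolution γ T g u) {t : ℝ} (ht : t ∈ Icc 0 T) :
    u t = flow γ t (u 0) :=
  hu.eqOn_of_initial hγ hT (isSolution_flow hγ (u 0)) (flow_zero hγ.1 (u 0)).symm ht

theorem IsSolution.flow_eq_final (hγ : γ ∈ Ioo (0 : ℝ) 1) {T : ℝ} (hT : 0 < T) {g : L2 n}
    {u : ℝ → L2 n} (hu : IsSolution γ T g u) : flow γ T (u 0) = g := by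
  rw [← hu.eq_flow hγ hT (right_mem_Icc.2 hT.le), hu.final]

/-- Solutions with the same final value coincide. -/
theorem IsSolution.eqOn (hγ : γ ∈ Ioo (0 : ℝ) 1) {T : ℝ} (hT : 0 < T) {g : L2 n}
    {u v : ℝ → L2 n} (hu : IsSolution γ T g u) (hv : IsSolution γ T g v) :
    EqOn u v (Icc 0 T) :=
  hu.eqOn_of_initial hγ hT hv (flow_injective hγ hT.le
    ((hu.flow_eq_final hγ hT).trans (hv.flow_eq_final hγ hT).symm))

theorem flow_eq_iff (hγ : γ ∈ Ioo (0 : ℝ) 1) {T : ℝ} (hT : 0 < T) (f g : L2 n) :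
    flow γ T f = g ↔ ∃ u, IsSolution γ T g u ∧ u 0 = f := by
  constructor
  · rintro rfl
    exact ⟨_, isSolution_flow hγ f, flow_zero hγ.1 f⟩
  · rintro ⟨u, hu, rfl⟩
    exact hu.flow_eq_final hγ hT

theorem isForwardOperator_flow (hγ : γ ∈ Ioo (0 : ℝ) 1) {T : ℝ} (hT : 0 < T) :
    IsForwardOperator γ T (flow γ T : L2 n →L[ℂ] L2 n) := fun f =>
  fourierL2_ae_iff.2 ((eq_fourierMul_iff (bddMeas_flowSym hγ hT.le)).1
    (rfl : flow γ T f = fourierMul _ f))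

end

section

variable {n : ℕ} {γ T : ℝ}

/-! ### Regularization by mollification -/

/-- For every sequence of bounds there is a slowly growing choice of the index. -/
theorem exists_slow_index (b : ℕ → ℝ) : ∃ K : ℝ → ℕ, Tendsto K (𝓝[>] 0) atTop ∧
    Tendsto (fun δ => δ * b (K δ)) (𝓝[>] 0) (𝓝 0) := by
  classical
  -- `K δ` is the largest `k ≤ 1/δ` with `|δ b k| ≤ 1/(k+1)`. Each fixed `k` satisfies this for all
  -- small `δ`, so `K` tends to infinity.
  set P : ℝ → ℕ → Prop := fun δ k => |δ * b k| ≤ 1 / ((k : ℝ) + 1) with hP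
  set K : ℝ → ℕ := fun δ => Nat.findGreatest (P δ) ⌊δ⁻¹⌋₊ with hK
  have hfloor : Tendsto (fun δ : ℝ => ⌊δ⁻¹⌋₊) (𝓝[>] 0) atTop :=
    tendsto_nat_floor_atTop.comp tendsto_inv_nhdsGT_zero
  have hPev : ∀ k, ∀ᶠ δ in 𝓝[>] (0 : ℝ), P δ k := by
    intro k
    have h1 : Tendsto (fun δ : ℝ => |δ * b k|) (𝓝[>] 0) (𝓝 0) := by
      have : Continuous fun δ : ℝ => |δ * b k| := by fun_prop
      have := (this.tendsto 0).mono_left (nhdsWithin_le_nhds (s := Ioi 0))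
      simpa using this
    exact (h1.eventually_lt_const (show (0 : ℝ) < 1 / ((k : ℝ) + 1) by positivity)).mono
      fun δ h => h.le
  have hKt : Tendsto K (𝓝[>] 0) atTop := by
    refine tendsto_atTop.2 fun k => ?_
    filter_upwards [hPev k, hfloor.eventually_ge_atTop k] with δ h1 h2
    exact Nat.le_findGreatest h2 h1
  refine ⟨K, hKt, ?_⟩
  have h0 : Tendsto (fun δ => 1 / ((K δ : ℝ) + 1)) (𝓝[>] 0) (𝓝 0) :=
    tendsto_one_div_add_atTop_nhds_zero_nat.comp hKt
  refine squeeze_zero_norm' ?_ h0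
  filter_upwards [hKt.eventually_ge_atTop 1] with δ h
  -- `Nat.findGreatest` returns `0` when no index qualifies; a nonzero value is sure to satisfy `P
  -- δ`.
  have hne : K δ ≠ 0 := by omega
  exact Nat.findGreatest_of_ne_zero (P := P δ) rfl hne

/-- Along `α(δ) = 1 / (K(δ) + 1)` the product of noise level and amplification tends to zero. -/
theorem exists_parameter_choice (ϱ : ℝ → ℝ) : ∃ a : ℝ → ℝ, (∀ δ, 0 < a δ) ∧
    Tendsto a (𝓝[>] 0) (𝓝 0) ∧ Tendsto (fun δ => δ * ϱ (a δ)) (𝓝[>] 0) (𝓝 0) := by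
  -- Only the values of `ϱ` along `1/(k+1)` enter, so no monotonicity or regularity of `ϱ` is
  -- needed.
  obtain ⟨K, hK, hb⟩ := exists_slow_index fun k => ϱ (1 / ((k : ℝ) + 1))
  exact ⟨fun δ => 1 / ((K δ : ℝ) + 1), fun δ => by positivity,
    tendsto_one_div_add_atTop_nhds_zero_nat.comp hK, hb⟩

theorem IsMollification.unique {φ : Space n → ℝ} {α : ℝ} {f h h' : L2 n}
    (H : IsMollification φ α f h) (H' : IsMollification φ α f h') : h = h' := by
  refine Lp.ext ?_
  filter_upwards [H, H'] with x h1 h2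
  rw [h1.2, h2.2]

/-- The mollification with `φ_α` is the Fourier multiplier with symbol `Ψ_α`, where the family
`Ψ_α` is bounded, tends to `1`, and satisfies `|Ψ_α| ≤ ϱ(α) E_{γ,1}(-|ξ|² T^γ)`. -/
structure IsMollifierSymbol (γ T : ℝ) (φ : Space n → ℝ) (Ψ : ℝ → Space n → ℂ) (ϱ : ℝ → ℝ) :
    Prop where
  measurable : ∀ α > 0, Measurable (Ψ α)
  bounded : ∃ C, ∀ α > 0, ∀ η, ‖Ψ α η‖ ≤ C
  tendsto : ∀ η, Tendsto (fun α => Ψ α η) (𝓝[>] 0) (𝓝 1)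
  le : ∀ α > 0, ∀ η, ‖Ψ α η / flowSym γ T η‖ ≤ ϱ α
  isMollification : ∀ α > 0, ∀ f, IsMollification φ α f (fourierMul (Ψ α) f)

section

variable {φ : Space n → ℝ} {Ψ : ℝ → Space n → ℂ} {ϱ : ℝ → ℝ}

theorem IsMollifierSymbol.bddMeas (h : IsMollifierSymbol γ T φ Ψ ϱ) {α : ℝ} (hα : 0 < α) :
    BddMeas (Ψ α) :=
  ⟨h.measurable α hα, h.bounded.choose, h.bounded.choose_spec α hα⟩

theorem IsMollifierSymbol.bddMeas_div (h : IsMollifierSymbol γ T φ Ψ ϱ) (hγ : 0 < γ) {α : ℝ}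
    (hα : 0 < α) : BddMeas (fun η => Ψ α η / flowSym γ T η) :=
  ⟨(h.measurable α hα).div (measurable_flowSym hγ T), ϱ α, h.le α hα⟩

theorem IsMollifierSymbol.eq (h : IsMollifierSymbol γ T φ Ψ ϱ) {α : ℝ} (hα : 0 < α) {f g : L2 n}
    (H : IsMollification φ α f g) : g = fourierMul (Ψ α) f :=
  H.unique (h.isMollification α hα f)

/-- The quotient symbol is bounded by `ϱ(α)`, so every mollified datum has an explicit preimage
under the forward operator, whether or not the datum itself is attainable. -/
theorem IsMollifierSymbol.flow_div (h : IsMollifierSymbol γ T φ Ψ ϱ) (hγ : γ ∈ Ioo (0 : ℝ) 1)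
    (hT : 0 < T) {α : ℝ} (hα : 0 < α) (g : L2 n) :
    flow γ T (fourierMul (fun η => Ψ α η / flowSym γ T η) g) = fourierMul (Ψ α) g := by
  rw [flow, fourierMul_fourierMul (bddMeas_flowSym hγ hT.le) (h.bddMeas_div hγ.1 hα)]
  congr 2
  ext η
  rw [mul_div_cancel₀ _ (flowSym_ne_zero hγ hT.le η)]

theorem fourierMul_comm {m m' : Space n → ℂ} (hm : BddMeas m) (hm' : BddMeas m') (f : L2 n) :
    fourierMul m (fourierMul m' f) = fourierMul m' (fourierMul m f) := by
  rw [fourierMul_fourierMul hm hm', fourierMul_fourierMul hm' hm]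
  simp only [mul_comm]

/-- The initial value of the solution with the mollified final value. -/
theorem IsMollifierSymbol.initial_eq (h : IsMollifierSymbol γ T φ Ψ ϱ) (hγ : γ ∈ Ioo (0 : ℝ) 1)
    (hT : 0 < T) {α : ℝ} (hα : 0 < α) {g k : L2 n} (H : IsMollification φ α g k)
    {u : ℝ → L2 n} (hu : IsSolution γ T k u) :
    u 0 = fourierMul (fun η => Ψ α η / flowSym γ T η) g := by
  refine flow_injective hγ hT.le ?_
  rw [hu.flow_eq_final hγ hT, h.flow_div hγ hT hα, h.eq hα H]

theorem IsMollifierSymbol.div_flow (h : IsMollifierSymbol γ T φ Ψ ϱ) (hγ : γ ∈ Ioo (0 : ℝ) 1)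
    (hT : 0 < T) {α : ℝ} (hα : 0 < α) (f : L2 n) :
    fourierMul (fun η => Ψ α η / flowSym γ T η) (flow γ T f) = fourierMul (Ψ α) f := by
  rw [← h.flow_div hγ hT hα, flow, fourierMul_comm (h.bddMeas_div hγ.1 hα)
    (bddMeas_flowSym hγ hT.le)]

/-- On exact data the reconstruction is the flow of the mollified initial value, which converges
since `Ψ_α → 1` boundedly. By linearity the noise contributes separately, amplified by at most
`ϱ(α)` because the flow is a contraction. -/
theorem IsMollifierSymbol.isRegularizationMethod (h : IsMollifierSymbol γ T φ Ψ ϱ)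
    (hγ : γ ∈ Ioo (0 : ℝ) 1) (hT : 0 < T) : IsRegularizationMethod γ T fun α t =>
      flow γ t ∘L fourierMul (fun η => Ψ α η / flowSym γ T η) := by
  have hconv : ∀ (g : L2 n) (u : ℝ → L2 n), IsSolution γ T g u → ∀ t ∈ Icc 0 T,
      Tendsto (fun α => (flow γ t ∘L fourierMul (fun η => Ψ α η / flowSym γ T η)) g)
        (𝓝[>] 0) (𝓝 (u t)) := by
    intro g u hu t ht
    have h1 : Tendsto (fun α => fourierMul (Ψ α) (u 0)) (𝓝[>] 0) (𝓝 (u 0)) := by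
      obtain ⟨C, hC⟩ := h.bounded
      have := tendsto_fourierMul (l := 𝓝[>] (0 : ℝ)) (m := Ψ) (m₀ := fun _ => 1) (u 0)
        (eventually_mem_nhdsWithin.mono fun α hα => h.measurable α hα)
        (eventually_mem_nhdsWithin.mono fun α hα => hC α hα)
        ⟨measurable_const, 1, by simp⟩ h.tendsto
      rwa [fourierMul_one] at this
    have h2 := ((flow γ t).continuous.tendsto (u 0)).comp h1
    rw [← hu.eq_flow hγ hT ht] at h2
    refine h2.congr' ?_
    filter_upwards [self_mem_nhdsWithin] with α hα
    rw [ContinuousLinearMap.comp_apply, ← hu.flow_eq_final hγ hT, h.div_flow hγ hT hα]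
    rfl
  refine ⟨hconv, ?_⟩
  obtain ⟨a, ha, ha0, hϱ⟩ := exists_parameter_choice ϱ
  refine ⟨a, fun δ _ => ha δ, ha0, fun g u hu t ht gδ hgδ => ?_⟩
  have ha' : Tendsto a (𝓝[>] 0) (𝓝[>] 0) :=
    tendsto_nhdsWithin_iff.2 ⟨ha0, Eventually.of_forall ha⟩
  have h1 := (hconv g u hu t ht).comp ha'
  have h2 : Tendsto (fun δ => (flow γ t ∘L fourierMul (fun η => Ψ (a δ) η / flowSym γ T η))
      (gδ δ - g)) (𝓝[>] 0) (𝓝 0) := by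
    refine squeeze_zero_norm' ?_ hϱ
    filter_upwards [self_mem_nhdsWithin] with δ hδ
    have hϱ0 : 0 ≤ ϱ (a δ) := (norm_nonneg _).trans (h.le (a δ) (ha δ) 0)
    calc ‖flow γ t (fourierMul (fun η => Ψ (a δ) η / flowSym γ T η) (gδ δ - g))‖
        ≤ 1 * ‖fourierMul (fun η => Ψ (a δ) η / flowSym γ T η) (gδ δ - g)‖ :=
          norm_fourierMul_le (bddMeas_flowSym hγ ht.1) (norm_flowSym_le hγ ht.1) _
      _ ≤ ϱ (a δ) * ‖gδ δ - g‖ := by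
          rw [one_mul]
          exact norm_fourierMul_le (h.bddMeas_div hγ.1 (ha δ)) (h.le (a δ) (ha δ)) _
      _ ≤ δ * ϱ (a δ) := by
          rw [mul_comm]
          exact mul_le_mul_of_nonneg_right (hgδ δ hδ) hϱ0
  have h3 := h2.add h1
  rw [zero_add] at h3
  refine h3.congr fun δ => ?_
  simp only [Function.comp, map_sub, sub_add_cancel]

theorem IsMollifierSymbol.definesRegularizationMethod (h : IsMollifierSymbol γ T φ Ψ ϱ)
    (hγ : γ ∈ Ioo (0 : ℝ) 1) (hT : 0 < T) : DefinesRegularizationMethod γ T φ := by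
  have hsol : ∀ α > 0, ∀ g, IsSolution γ T (fourierMul (Ψ α) g) (fun t =>
      (flow γ t ∘L fourierMul (fun η => Ψ α η / flowSym γ T η)) g) := by
    intro α hα g
    have := isSolution_flow hγ (T := T) (fourierMul (fun η => Ψ α η / flowSym γ T η) g)
    rwa [h.flow_div hγ hT hα] at this
  exact ⟨fun α g => fourierMul (Ψ α) g, _, h.isMollification, hsol,
    fun α hα g u hu => hu.eqOn hγ hT (hsol α hα g), h.isRegularizationMethod hγ hT⟩

/-- Mollification and the flow are both Fourier multipliers and hence commute. -/
theorem IsMollifierSymbol.mollifiesSolution (h : IsMollifierSymbol γ T φ Ψ ϱ)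
    (hγ : γ ∈ Ioo (0 : ℝ) 1) (hT : 0 < T) {α : ℝ} (hα : 0 < α) :
    MollifiesSolution γ T φ α := by
  intro g k u uα hu H huα t ht
  have e : uα t = fourierMul (Ψ α) (u t) := by
    rw [huα.eq_flow hγ hT ht, h.initial_eq hγ hT hα H huα, ← hu.flow_eq_final hγ hT,
      h.div_flow hγ hT hα, hu.eq_flow hγ hT ht, flow,
      fourierMul_comm (bddMeas_flowSym hγ ht.1) (h.bddMeas hα)]
  rw [e]
  exact h.isMollification α hα _

end

/-! ### The Fourier transform on `L¹` and on `L²` -/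

theorem integral_mul_fourierInv_L2 (F : L2 n) (θ : 𝓢(Space n, ℂ)) :
    ∫ x, θ x * (𝓕⁻ F : L2 n) x = ∫ η, (𝓕⁻ θ) η * F η := by
  have h1 : ((𝓕⁻ F : L2 n) : 𝓢'(Space n, ℂ)) θ = ∫ x, θ x * (𝓕⁻ F : L2 n) x :=
    Lp.toTemperedDistribution_apply _ _
  have h2 : ((F : 𝓢'(Space n, ℂ)) (𝓕⁻ θ)) = ∫ η, (𝓕⁻ θ) η * F η :=
    Lp.toTemperedDistribution_apply _ _
  rw [← h1, ← h2, ← Lp.fourierInv_toTemperedDistribution_eq]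
  rfl

/-- An integrable function whose Fourier integral is the square integrable function `F` is the
inverse Plancherel transform of `F`. -/
theorem fourierInv_ae_eq_of_fourier_ae_eq {f : Space n → ℂ} (hf : Integrable f) {F : L2 n}
    (h : F =ᵐ[volume] 𝓕 f) : (𝓕⁻ F : L2 n) =ᵐ[volume] f := by
  refine ae_eq_of_integral_schwartz (locallyIntegrable_L2 _) hf.locallyIntegrable fun θ => ?_
  rw [integral_mul_fourierInv_L2]
  have h1 : ∫ η, (𝓕⁻ θ) η * F η = ∫ η, (𝓕⁻ θ) η * 𝓕 f η := by
    refine integral_congr_ae ?_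
    filter_upwards [h] with η hη
    rw [hη]
  have h2 := VectorFourier.integral_fourierIntegral_smul_eq_flip (L := innerₗ (Space n))
    (μ := volume) (ν := volume) Real.continuous_fourierChar continuous_inner
    (𝓕⁻ θ : 𝓢(Space n, ℂ)).integrable hf
  have h3 : ∀ x, VectorFourier.fourierIntegral Real.fourierChar volume (innerₗ (Space n))
      (𝓕⁻ θ : 𝓢(Space n, ℂ)) x = θ x := fun x => by
    have : (𝓕 (𝓕⁻ θ : 𝓢(Space n, ℂ)) : 𝓢(Space n, ℂ)) x = θ x := by simp
    exact this
  rw [h1]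
  simp only [h3, flip_innerₗ] at h2
  exact h2.symm

/-- The inverse Plancherel transform of a function in `L¹ ∩ L²` is its inverse Fourier integral. -/
theorem fourierInv_ae_eq_of_integrable {F : L2 n} (hF : Integrable F) :
    (𝓕⁻ F : L2 n) =ᵐ[volume] 𝓕⁻ (F : Space n → ℂ) := by
  have hcont : Continuous (𝓕⁻ (F : Space n → ℂ)) :=
    VectorFourier.fourierIntegral_continuous Real.continuous_fourierChar
      (L := -innerₗ (Space n)) continuous_inner.neg hF
  refine ae_eq_of_integral_schwartz (locallyIntegrable_L2 _) hcont.locallyIntegrable fun θ => ?_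
  rw [integral_mul_fourierInv_L2]
  have h2 := VectorFourier.integral_fourierIntegral_smul_eq_flip (L := -innerₗ (Space n))
    (μ := volume) (ν := volume) Real.continuous_fourierChar continuous_inner.neg
    θ.integrable hF
  have h4 : (-innerₗ (Space n)).flip = -innerₗ (Space n) := by
    ext x y
    simp [real_inner_comm]
  rw [h4] at h2
  have h3 : ∀ x, VectorFourier.fourierIntegral Real.fourierChar volume (-innerₗ (Space n))
      θ x = (𝓕⁻ θ : 𝓢(Space n, ℂ)) x := fun x => by
    rw [SchwartzMap.fourierInv_coe]
    rfl
  simp only [h3] at h2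
  exact h2

end

section

variable {n : ℕ} {γ T : ℝ}

/-! ### The reconstruction kernel -/

theorem memLp_of_norm_eq {f g : Space n → ℂ} (hf : MemLp f 2 volume) (hg : Measurable g)
    (h : ∀ x, ‖g x‖ = ‖f x‖) : MemLp g 2 volume :=
  hf.of_le hg.aestronglyMeasurable (Eventually.of_forall fun x => (h x).le)

theorem measurable_fourierChar_inner (x : Space n) :
    Measurable fun η : Space n => (Real.fourierChar (-⟪x, η⟫_ℝ) : ℂ) :=
  (continuous_subtype_val.comp (Real.continuous_fourierChar.comp
    (continuous_const.inner continuous_id).neg)).measurable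

theorem conj_fourierChar_neg (r : ℝ) :
    (starRingEnd ℂ) (Real.fourierChar (-r) : ℂ) = (Real.fourierChar r : ℂ) := by
  rw [← Circle.coe_inv_eq_conj, ← AddChar.map_neg_eq_inv, neg_neg]

theorem fourierInv_apply_eq (f : Space n → ℂ) (x : Space n) :
    𝓕⁻ f x = ∫ η, (Real.fourierChar ⟪x, η⟫_ℝ : ℂ) * f η := by
  rw [Real.fourierInv_eq]
  refine integral_congr_ae (Eventually.of_forall fun η => ?_)
  simp only [Circle.smul_def, smul_eq_mul, real_inner_comm]

theorem fourier_apply_eq (f : Space n → ℂ) (η : Space n) :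
    𝓕 f η = ∫ x, (Real.fourierChar (-⟪x, η⟫_ℝ) : ℂ) * f x := rfl

theorem inner_flow_comm (hγ : γ ∈ Ioo (0 : ℝ) 1) {t : ℝ} (ht : 0 ≤ t) (f g : L2 n) :
    ⟪flow γ t f, g⟫_ℂ = ⟪f, flow γ t g⟫_ℂ := by
  rw [← Lp.inner_fourier_eq, ← Lp.inner_fourier_eq f, L2.inner_def, L2.inner_def]
  refine integral_congr_ae ?_
  filter_upwards [(eq_fourierMul_iff (bddMeas_flowSym hγ ht)).1 (rfl : flow γ t f = fourierMul _ f),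
    (eq_fourierMul_iff (bddMeas_flowSym hγ ht)).1 (rfl : flow γ t g = fourierMul _ g)] with η h1 h2
  rw [h1, h2, RCLike.inner_apply, RCLike.inner_apply, map_mul, flowSym_eq, Complex.conj_ofReal]
  ring

/-- The symbol is real, so the forward operator is self-adjoint. -/
theorem adjoint_flow (hγ : γ ∈ Ioo (0 : ℝ) 1) {t : ℝ} (ht : 0 ≤ t) :
    ContinuousLinearMap.adjoint (flow γ t : L2 n →L[ℂ] L2 n) = flow γ t :=
  ((ContinuousLinearMap.eq_adjoint_iff _ _).2 (inner_flow_comm hγ ht)).symm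

/-- `e` is the function `φ_α(x - ·)`, and its Plancherel transform is `e^{-i x·ξ} conj Ψ`. -/
def IsTranslatedKernel (φ : Space n → ℝ) (α : ℝ) (Ψ : Space n → ℂ) (x : Space n) (e : L2 n) :
    Prop :=
  (e =ᵐ[volume] fun y => (dilate φ α (x - y) : ℂ)) ∧
    (𝓕 e : L2 n) =ᵐ[volume] fun η => (Real.fourierChar (-⟪x, η⟫_ℝ) : ℂ) * (starRingEnd ℂ) (Ψ η)

/-- If `F = m·G` with `m, G` square integrable, the inverse Plancherel transform of `F` at `x` is
an inner product. -/
theorem fourierInv_ae_eq_inner {m : Space n → ℂ} (hm : MemLp m 2 volume) {G F : L2 n}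
    (hF : F =ᵐ[volume] fun η => m η * G η) {V : Space n → L2 n}
    (hV : ∀ x, V x =ᵐ[volume] fun η =>
      (Real.fourierChar (-⟪x, η⟫_ℝ) : ℂ) * (starRingEnd ℂ) (m η)) :
    ∀ᵐ x : Space n, (𝓕⁻ F : L2 n) x = ⟪V x, G⟫_ℂ := by
  have hint : Integrable F :=
    (MemLp.integrable_mul hm (Lp.memLp G)).congr hF.symm
  filter_upwards [fourierInv_ae_eq_of_integrable hint] with x hx
  rw [hx, fourierInv_apply_eq, L2.inner_def]
  refine integral_congr_ae ?_
  filter_upwards [hF, hV x] with η h1 h2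
  rw [h1, h2, RCLike.inner_apply, map_mul, RCLike.conj_conj, conj_fourierChar_neg]
  ring

/-- The kernel `v_x` is the inverse transform of `e^{-i x·ξ} conj(Ψ/E)`: dividing the transform of
`e_α(x, ·)` by the real symbol `E` solves the adjoint equation. The transform of `u_α(·, 0)` is
`(Ψ/E) ĝ`, a product of two `L²` functions and so integrable. Its inverse Fourier integral at `x` is
the inner product with `v_x` by Plancherel. -/
theorem IsMollifierSymbol.hasReconstructionKernel {φ : Space n → ℝ} {Ψ : ℝ → Space n → ℂ}
    {ϱ : ℝ → ℝ} (h : IsMollifierSymbol γ T φ Ψ ϱ) (hγ : γ ∈ Ioo (0 : ℝ) 1) (hT : 0 < T) {α : ℝ}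
    (hα : 0 < α) (hΨ : MemLp (fun η => Ψ α η / flowSym γ T η) 2 volume)
    (he : ∀ x, ∃ e, IsTranslatedKernel φ α (Ψ α) x e) :
    HasReconstructionKernel γ T (flow γ T) φ α := by
  choose e he1 he2 using he
  have hdm := (h.bddMeas_div hγ.1 hα).1
  have hmem : ∀ x : Space n, MemLp (fun η => (Real.fourierChar (-⟪x, η⟫_ℝ) : ℂ) *
      (starRingEnd ℂ) (Ψ α η / flowSym γ T η)) 2 volume := fun x =>
    memLp_of_norm_eq hΨ ((measurable_fourierChar_inner x).mul
      (Complex.continuous_conj.measurable.comp hdm)) fun η => by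
        rw [norm_mul, Circle.norm_coe, one_mul, RCLike.norm_conj]
  set V : Space n → L2 n := fun x => (hmem x).toLp _
  have hV : ∀ x, V x =ᵐ[volume] fun η => (Real.fourierChar (-⟪x, η⟫_ℝ) : ℂ) *
      (starRingEnd ℂ) (Ψ α η / flowSym γ T η) := fun x => (hmem x).coeFn_toLp
  have hflow : ∀ x, flow γ T (𝓕⁻ (V x) : L2 n) = e x := by
    intro x
    refine ((eq_fourierMul_iff (bddMeas_flowSym hγ hT.le)).2 ?_).symm
    rw [FourierTransform.fourier_fourierInv_eq]
    filter_upwards [hV x, he2 x] with η h1 h2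
    have hne := flowSym_ne_zero hγ hT.le η
    have hcj : (starRingEnd ℂ) (flowSym γ T η) = flowSym γ T η := by
      rw [flowSym_eq, Complex.conj_ofReal]
    rw [h1, h2, map_div₀, hcj]
    field_simp
  refine ⟨e, fun x => 𝓕⁻ (V x), he1, fun x w => ?_, fun g k uα H hu => ?_⟩
  · rw [adjoint_flow hγ hT.le, ← hflow x]
    exact (flow_injective hγ hT.le).eq_iff
  · have hF : (𝓕 (uα 0) : L2 n) =ᵐ[volume] fun η =>
        (Ψ α η / flowSym γ T η) * (𝓕 g : L2 n) η :=
      (eq_fourierMul_iff (h.bddMeas_div hγ.1 hα)).1 (h.initial_eq hγ hT hα H hu)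
    filter_upwards [fourierInv_ae_eq_inner hΨ hF hV] with x hx
    rw [FourierTransform.fourierInv_fourier_eq] at hx
    rw [hx, ← Lp.inner_fourier_eq (𝓕⁻ (V x) : L2 n) g, FourierTransform.fourier_fourierInv_eq]

/-- Mollification with a square integrable kernel. -/
theorem isMollification_of_isTranslatedKernel {φ : Space n → ℝ} {α : ℝ} {Ψ : Space n → ℂ}
    (hb : BddMeas Ψ) (hΨ : MemLp Ψ 2 volume) {e : Space n → L2 n}
    (he : ∀ x, IsTranslatedKernel φ α Ψ x (e x)) (f : L2 n) :
    IsMollification φ α f (fourierMul Ψ f) := by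
  have h1 := fourierInv_ae_eq_inner hΨ ((eq_fourierMul_iff hb).1 (rfl : _ = fourierMul Ψ f))
    (V := fun x => 𝓕 (e x)) fun x => (he x).2
  filter_upwards [h1] with x hx
  -- Plancherel turns the Fourier pairing into `⟪e x, f⟫`, which is the convolution at `x` since the
  -- kernel is real. Integrability of the kernel plays no role.
  rw [FourierTransform.fourierInv_fourier_eq, Lp.inner_fourier_eq, L2.inner_def] at hx
  have hcongr : (fun y => ⟪e x y, f y⟫_ℂ) =ᵐ[volume] fun y => (dilate φ α (x - y) : ℂ) * f y := by
    filter_upwards [(he x).1] with y hy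
    rw [hy, RCLike.inner_apply, Complex.conj_ofReal, mul_comm]
  exact ⟨(L2.integrable_inner (e x) f).congr hcongr, hx.trans (integral_congr_ae hcongr)⟩

/-! ### Convolution of integrable and square integrable functions -/

/-- Cauchy–Schwarz after writing `K G = K^{1/2} · K^{1/2} G`. -/
theorem sq_lintegral_mul_le {K G : Space n → ℝ≥0∞} (hK : Measurable K) (hG : Measurable G) :
    (∫⁻ y, K y * G y) ^ 2 ≤ (∫⁻ y, K y) * ∫⁻ y, K y * G y ^ 2 := by
  have h := ENNReal.lintegral_mul_le_Lp_mul_Lq (volume : Measure (Space n))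
    (Real.HolderConjugate.two_two) (f := fun y => K y ^ (1 / 2 : ℝ))
    (g := fun y => K y ^ (1 / 2 : ℝ) * G y) (hK.pow_const _).aemeasurable
    ((hK.pow_const _).mul hG).aemeasurable
  have e0 : ∀ a : ℝ≥0∞, a ^ (1 / 2 : ℝ) * a ^ (1 / 2 : ℝ) = a := fun a => by
    rw [← ENNReal.rpow_add_of_nonneg _ _ (by norm_num) (by norm_num)]
    norm_num
  have e1 : ∀ a : ℝ≥0∞, (a ^ (1 / 2 : ℝ)) ^ (2 : ℝ) = a := fun a => by
    rw [← ENNReal.rpow_mul]; norm_num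
  have e2 : ∀ a : ℝ≥0∞, (a ^ (1 / 2 : ℝ)) ^ 2 = a := fun a => by
    rw [sq, e0]
  simp only [Pi.mul_apply, ← mul_assoc, e0, ENNReal.mul_rpow_of_nonneg _ _ zero_le_two, e1] at h
  calc (∫⁻ y, K y * G y) ^ 2 ≤ _ := pow_le_pow_left' h 2
    _ = _ := by
      rw [mul_pow, e2, e2]
      simp only [ENNReal.rpow_two]

/-- Young's inequality for `L¹ ⋆ L²`: the weighted Cauchy–Schwarz bound is integrated with Tonelli
and translation invariance. -/
theorem lintegral_sq_conv_le {K G : Space n → ℝ≥0∞} (hK : Measurable K) (hG : Measurable G) :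
    ∫⁻ x, (∫⁻ y, K (x - y) * G y) ^ 2 ≤ (∫⁻ y, K y) ^ 2 * ∫⁻ y, G y ^ 2 := by
  calc ∫⁻ x, (∫⁻ y, K (x - y) * G y) ^ 2
      ≤ ∫⁻ x, (∫⁻ y, K y) * ∫⁻ y, K (x - y) * G y ^ 2 := by
        refine lintegral_mono fun x => ?_
        have := sq_lintegral_mul_le (hK.comp (measurable_const.sub measurable_id)) hG
          (K := fun y => K (x - y))
        rwa [lintegral_sub_left_eq_self K x] at this
    _ = (∫⁻ y, K y) * ∫⁻ y, ∫⁻ x, K (x - y) * G y ^ 2 := by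
        have hm : Measurable (Function.uncurry fun x y : Space n => K (x - y) * G y ^ 2) :=
          (hK.comp (measurable_fst.sub measurable_snd)).mul
            ((hG.comp measurable_snd).pow_const 2)
        rw [lintegral_const_mul _ hm.lintegral_prod_right, lintegral_lintegral_swap hm.aemeasurable]
    _ = (∫⁻ y, K y) ^ 2 * ∫⁻ y, G y ^ 2 := by
        have : ∀ y, ∫⁻ x, K (x - y) * G y ^ 2 = (∫⁻ x, K x) * G y ^ 2 := fun y => by
          have hm : Measurable fun x => K (x - y) := hK.comp (measurable_id.sub measurable_const)
          rw [lintegral_mul_const _ hm, lintegral_sub_right_eq_self K y]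
        simp only [this]
        rw [lintegral_const_mul _ (hG.pow_const 2), sq, mul_assoc]

theorem lintegral_enorm_sq (f : L2 n) : ∫⁻ y, ‖f y‖ₑ ^ 2 = ‖f‖ₑ ^ 2 := by
  rw [Lp.enorm_def, eLpNorm_eq_lintegral_rpow_enorm_toReal (by simp) (by simp)]
  simp only [ENNReal.toReal_ofNat, ENNReal.rpow_two]
  rw [← ENNReal.rpow_two, ← ENNReal.rpow_mul]
  norm_num

section

variable {k : Space n → ℂ}

theorem lintegral_enorm_conv_sq_le (hk : Measurable k) (f : L2 n) :
    ∫⁻ x, (∫⁻ y, ‖k (x - y) * f y‖ₑ) ^ 2 ≤ (∫⁻ y, ‖k y‖ₑ) ^ 2 * ‖f‖ₑ ^ 2 := by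
  have h := lintegral_sq_conv_le hk.enorm (Lp.stronglyMeasurable f).measurable.enorm
  rw [lintegral_enorm_sq] at h
  simpa only [enorm_mul] using h

theorem measurable_conv_integrand (hk : Measurable k) (f : L2 n) :
    Measurable (Function.uncurry fun x y : Space n => k (x - y) * f y) :=
  (hk.comp (measurable_fst.sub measurable_snd)).mul
    ((Lp.stronglyMeasurable f).measurable.comp measurable_snd)

theorem ae_integrable_conv (hk : Measurable k) (hki : Integrable k) (f : L2 n) :
    ∀ᵐ x : Space n, Integrable fun y => k (x - y) * f y := by
  have hfin : ∫⁻ x, (∫⁻ y, ‖k (x - y) * f y‖ₑ) ^ 2 ≠ ⊤ :=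
    ne_top_of_le_ne_top (ENNReal.mul_ne_top (ENNReal.pow_ne_top hki.2.ne)
      (ENNReal.pow_ne_top enorm_ne_top)) (lintegral_enorm_conv_sq_le hk f)
  have hm := measurable_conv_integrand hk f
  filter_upwards [ae_lt_top (hm.enorm.lintegral_prod_right.pow_const 2) hfin] with x hx
  exact ⟨(hm.comp measurable_prodMk_left).aestronglyMeasurable,
    (ENNReal.pow_lt_top_iff.1 hx).resolve_right two_ne_zero⟩

theorem eLpNorm_conv_le (hk : Measurable k) (f : L2 n) :
    eLpNorm (fun x => ∫ y, k (x - y) * f y) 2 volume ≤ (∫⁻ y, ‖k y‖ₑ) * ‖f‖ₑ := by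
  rw [eLpNorm_eq_lintegral_rpow_enorm_toReal (by simp) (by simp)]
  simp only [ENNReal.toReal_ofNat, ENNReal.rpow_two]
  calc (∫⁻ x, ‖∫ y, k (x - y) * f y‖ₑ ^ 2) ^ (1 / 2 : ℝ)
      ≤ (((∫⁻ y, ‖k y‖ₑ) * ‖f‖ₑ) ^ 2) ^ (1 / 2 : ℝ) := by
        refine ENNReal.rpow_le_rpow ?_ (by norm_num)
        rw [mul_pow]
        refine le_trans (lintegral_mono fun x => ?_) (lintegral_enorm_conv_sq_le hk f)
        exact pow_le_pow_left' (enorm_integral_le_lintegral_enorm _) 2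
    _ = _ := by
        rw [← ENNReal.rpow_two, ← ENNReal.rpow_mul]
        norm_num

theorem norm_fourier_le (f : Space n → ℂ) (η : Space n) : ‖𝓕 f η‖ ≤ ∫ x, ‖f x‖ :=
  VectorFourier.norm_fourierIntegral_le_integral_norm _ _ _ _ _

theorem continuous_fourier (hki : Integrable k) : Continuous (𝓕 k) :=
  VectorFourier.fourierIntegral_continuous Real.continuous_fourierChar
    (L := innerₗ (Space n)) continuous_inner hki

theorem bddMeas_fourier (hki : Integrable k) : BddMeas (𝓕 k) :=
  ⟨(continuous_fourier hki).measurable, _, norm_fourier_le k⟩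

/-- Here both factors are integrable, so the convolution theorem for Fourier integrals applies and
is carried over to the Plancherel transform. -/
theorem fourierMul_fourier_schwartz (hki : Integrable k) (s : 𝓢(Space n, ℂ)) :
    fourierMul (𝓕 k) (s.toLp 2) =ᵐ[volume] fun x => ∫ y, k (x - y) * s y := by
  have hconv : Integrable (MeasureTheory.convolution (s : Space n → ℂ) k
      (ContinuousLinearMap.mul ℂ ℂ)) := s.integrable.integrable_convolution _ hki
  have hF : mulOp (𝓕 k) (𝓕 (s.toLp 2) : L2 n) =ᵐ[volume]
      𝓕 (MeasureTheory.convolution (s : Space n → ℂ) k (ContinuousLinearMap.mul ℂ ℂ)) := by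
    rw [SchwartzMap.toLp_fourier_eq]
    filter_upwards [coeFn_mulOp (bddMeas_fourier hki) ((𝓕 s : 𝓢(Space n, ℂ)).toLp 2),
      (𝓕 s : 𝓢(Space n, ℂ)).coeFn_toLp 2] with η h1 h2
    rw [h1, h2, Real.fourier_mul_convolution_eq s.integrable hki, mul_comm]
    rfl
  refine (fourierInv_ae_eq_of_fourier_ae_eq hconv hF).trans (Eventually.of_forall fun x => ?_)
  simp only [MeasureTheory.convolution, ContinuousLinearMap.mul_apply', mul_comm]

/-- Convolution with an integrable function is the Fourier multiplier with its Fourier transform. -/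
theorem fourierMul_fourier_ae_eq (hk : Measurable k) (hki : Integrable k) (f : L2 n) :
    fourierMul (𝓕 k) f =ᵐ[volume] fun x => ∫ y, k (x - y) * f y := by
  set c : L2 n → Space n → ℂ := fun f x => ∫ y, k (x - y) * f y with hc
  have hcm : ∀ f, AEStronglyMeasurable (c f) volume := fun f =>
    (measurable_conv_integrand hk f).stronglyMeasurable.integral_prod_right.aestronglyMeasurable
  set C : ℝ≥0∞ := ∫⁻ y, ‖k y‖ₑ with hC
  have hCtop : C ≠ ⊤ := hki.2.ne
  have hM : ∀ f, ‖fourierMul (𝓕 k) f‖ₑ ≤ C * ‖f‖ₑ := by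
    intro f
    have h1 := norm_fourierMul_le (bddMeas_fourier hki) (norm_fourier_le k) f
    have h2 : ENNReal.ofReal (∫ x, ‖k x‖) = C := ofReal_integral_norm_eq_lintegral_enorm hki
    rw [← h2, ← ofReal_norm, ← ofReal_norm, ← ENNReal.ofReal_mul (by positivity)]
    exact ENNReal.ofReal_le_ofReal h1
  have hsub : ∀ f g : L2 n, c f =ᵐ[volume] c g + c (f - g) := by
    intro f g
    filter_upwards [ae_integrable_conv hk hki g, ae_integrable_conv hk hki (f - g)] with x h1 h2
    simp only [hc, Pi.add_apply]
    rw [← integral_add h1 h2]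
    refine integral_congr_ae ?_
    filter_upwards [Lp.coeFn_sub f g] with y hy
    rw [hy, Pi.sub_apply]
    ring
  -- The multiplier and the convolution agree on `s`, so their difference at `f` equals their
  -- difference at `f - s`. Both are bounded by `C ‖f - s‖`, and density of Schwartz functions
  -- finishes the argument.
  have hle : ∀ s : 𝓢(Space n, ℂ), eLpNorm (((fourierMul (𝓕 k) f : L2 n) : Space n → ℂ) - c f) 2 volume ≤
      2 * C * ‖f - s.toLp 2 volume‖ₑ := by
    intro s
    have hs : fourierMul (𝓕 k) (s.toLp 2) =ᵐ[volume] c (s.toLp 2) := by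
      refine (fourierMul_fourier_schwartz hki s).trans (Eventually.of_forall fun x => ?_)
      refine integral_congr_ae ?_
      filter_upwards [s.coeFn_toLp 2] with y hy
      rw [hy]
    have e : ((fourierMul (𝓕 k) f : L2 n) : Space n → ℂ) - c f =ᵐ[volume]
        ((fourierMul (𝓕 k) (f - s.toLp 2 volume) : L2 n) : Space n → ℂ) - c (f - s.toLp 2 volume) := by
      rw [map_sub]
      filter_upwards [hsub f (s.toLp 2), hs,
        Lp.coeFn_sub (fourierMul (𝓕 k) f) (fourierMul (𝓕 k) (s.toLp 2))] with x h1 h2 h3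
      rw [Pi.sub_apply, Pi.sub_apply, h1, h3, Pi.add_apply, Pi.sub_apply, h2]
      ring
    rw [eLpNorm_congr_ae e]
    refine (eLpNorm_sub_le (Lp.aestronglyMeasurable _) (hcm _) one_le_two).trans ?_
    rw [two_mul, add_mul, ← Lp.enorm_def]
    exact add_le_add (hM _) (eLpNorm_conv_le hk _)
  have hzero : eLpNorm (((fourierMul (𝓕 k) f : L2 n) : Space n → ℂ) - c f) 2 volume = 0 := by
    have hmem : f ∈ closure (Set.range fun s : 𝓢(Space n, ℂ) => (s.toLp 2 : L2 n)) :=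
      SchwartzMap.denseRange_toLpCLM (F := ℂ) (p := 2) ENNReal.ofNat_ne_top f
    obtain ⟨x, hx, hxt⟩ := mem_closure_iff_seq_limit.1 hmem
    choose s hs using hx
    have h1 : Tendsto (fun i => 2 * C * ‖f - x i‖ₑ) atTop (𝓝 0) := by
      have h2 : Tendsto (fun i => edist (x i) f) atTop (𝓝 0) := tendsto_iff_edist_tendsto_0.1 hxt
      have h3 := ENNReal.Tendsto.const_mul (a := 2 * C) h2
        (Or.inr (ENNReal.mul_ne_top (by simp) hCtop))
      rw [mul_zero] at h3
      refine h3.congr fun i => ?_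
      rw [edist_comm, edist_eq_enorm_sub]
    refine le_antisymm (ge_of_tendsto h1 (Eventually.of_forall fun i => ?_)) zero_le
    rw [← hs i]
    exact hle (s i)
  rw [eLpNorm_eq_zero_iff ((Lp.aestronglyMeasurable _).sub (hcm f)) two_ne_zero] at hzero
  filter_upwards [hzero] with x hx
  exact sub_eq_zero.1 hx

end

end

section

variable {n : ℕ} {γ T : ℝ}

/-! ### Integrable kernels -/

theorem memLp_comp_smul {f : Space n → ℂ} (hf : MemLp f 2 volume) {c : ℝ} (hc : c ≠ 0) :
    MemLp (fun x => f (c • x)) 2 volume := by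
  have he : MeasurableEmbedding fun x : Space n => c • x := measurableEmbedding_const_smul₀ hc
  refine (he.memLp_map_measure_iff (μ := volume) (g := f) (p := 2)).1 ?_
  rw [Measure.map_addHaar_smul volume hc]
  exact hf.smul_measure ENNReal.ofReal_ne_top

theorem fourierL1_two_pi_smul (φ : Space n → ℝ) (η : Space n) :
    fourierL1 φ ((2 * Real.pi) • η) =
      (((2 * Real.pi) ^ (-(n : ℝ) / 2) : ℝ) : ℂ) * 𝓕 (fun x => (φ x : ℂ)) η := by
  rw [fourierL1, fourier_apply_eq]
  congr 1
  refine integral_congr_ae (Eventually.of_forall fun x => ?_)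
  simp only [Real.fourierChar_apply, inner_smul_right]
  congr 2
  push_cast
  ring

theorem integrable_dilate {φ : Space n → ℝ} (hφ : Integrable φ) {α : ℝ} (hα : 0 < α) :
    Integrable fun x => (dilate φ α x : ℂ) :=
  ((hφ.comp_smul (inv_ne_zero hα.ne')).const_mul _).ofReal

theorem fourier_dilate (φ : Space n → ℝ) {α : ℝ} (hα : 0 < α) (η : Space n) :
    𝓕 (fun x => (dilate φ α x : ℂ)) η = 𝓕 (fun x => (φ x : ℂ)) (α • η) := by
  have h := Measure.integral_comp_inv_smul_of_nonneg (volume : Measure (Space n))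
    (fun x => (Real.fourierChar (-⟪x, α • η⟫_ℝ) : ℂ) * (φ x : ℂ)) hα.le
  rw [finrank_euclideanSpace_fin] at h
  rw [fourier_apply_eq, fourier_apply_eq, ← inv_smul_smul₀ (pow_pos hα n).ne'
    (∫ x, (Real.fourierChar (-⟪x, α • η⟫_ℝ) : ℂ) * (φ x : ℂ)), ← h, ← integral_smul]
  refine integral_congr_ae (Eventually.of_forall fun x => ?_)
  simp only [dilate, inner_smul_left, inner_smul_right, RCLike.conj_to_real,
    mul_inv_cancel_left₀ hα.ne', Complex.real_smul]
  push_cast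
  rw [← mul_assoc, ← mul_assoc, mul_comm (Real.fourierChar _ : ℂ)]

theorem two_pi_rpow_pos (n : ℕ) : 0 < (2 * Real.pi) ^ (-(n : ℝ) / 2) :=
  Real.rpow_pos_of_pos Real.two_pi_pos _

/-- The symbol at `η` is `𝓕 φ (α η)`: it is bounded by the `L¹` norm of `φ` and tends to `𝓕 φ 0 = ∫
φ = 1` by continuity. The inverse constant in front of `ϱ` removes the normalisation of `fourierL1`.
-/
theorem IsMollifierSymbol.of_integrable {φ : Space n → ℝ} {ϱ : ℝ → ℝ} (hγ : γ ∈ Ioo (0 : ℝ) 1)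
    (hT : 0 < T) (hm : Measurable φ) (hφ : Integrable φ) (h1 : ∫ x, φ x = 1)
    (hK : KernelCondition γ T (fourierL1 φ) ϱ) :
    IsMollifierSymbol γ T φ (fun α => 𝓕 fun x => (dilate φ α x : ℂ))
      fun α => ((2 * Real.pi) ^ (-(n : ℝ) / 2))⁻¹ * ϱ α := by
  have hkm : ∀ α, Measurable fun x => (dilate φ α x : ℂ) := fun α =>
    Complex.measurable_ofReal.comp ((hm.comp (measurable_const_smul _)).const_mul _)
  refine ⟨fun α hα => (continuous_fourier (integrable_dilate hφ hα)).measurable,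
    ⟨∫ x, ‖(φ x : ℂ)‖, fun α hα η => ?_⟩, fun η => ?_, fun α hα η => ?_, fun α hα f => ?_⟩
  · rw [fourier_dilate φ hα]
    exact norm_fourier_le _ _
  · have hc : Tendsto (fun α : ℝ => 𝓕 (fun x => (φ x : ℂ)) (α • η)) (𝓝[>] 0)
        (𝓝 (𝓕 (fun x => (φ x : ℂ)) ((0 : ℝ) • η))) :=
      (((continuous_fourier hφ.ofReal).comp
        (continuous_id.smul continuous_const)).tendsto 0).mono_left nhdsWithin_le_nhds
    have e : 𝓕 (fun x => (φ x : ℂ)) ((0 : ℝ) • η) = 1 := by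
      rw [fourier_apply_eq, zero_smul]
      simp only [inner_zero_right, neg_zero, AddChar.map_zero_eq_one, Circle.coe_one, one_mul]
      rw [integral_complex_ofReal, h1, Complex.ofReal_one]
    rw [e] at hc
    refine hc.congr' ?_
    filter_upwards [self_mem_nhdsWithin] with α hα
    rw [fourier_dilate φ hα]
  · have h := hK α hα ((2 * Real.pi) • η)
    rw [smul_comm, fourierL1_two_pi_smul, ← fourier_dilate φ hα, norm_mul, Complex.norm_real,
      Real.norm_of_nonneg (two_pi_rpow_pos n).le, mul_div_assoc] at h
    have hs : 0 < symbol γ T ((2 * Real.pi) • η) := mlFlow_pos hγ (freqSq_nonneg η) hT.le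
    rw [norm_div, flowSym, Complex.norm_real, Real.norm_of_nonneg hs.le, le_inv_mul_iff₀ (two_pi_rpow_pos n)]
    exact h
  · filter_upwards [ae_integrable_conv (hkm α) (integrable_dilate hφ hα) f,
      fourierMul_fourier_ae_eq (hkm α) (integrable_dilate hφ hα) f] with x h1 h2
    exact ⟨h1, h2⟩

/-- Reflection of a real function conjugates its transform, and translation contributes the
character. -/
theorem fourier_translate {φ : Space n → ℝ} (x η : Space n) :
    𝓕 (fun y => (φ (x - y) : ℂ)) η =
      (Real.fourierChar (-⟪x, η⟫_ℝ) : ℂ) * (starRingEnd ℂ) (𝓕 (fun y => (φ y : ℂ)) η) := by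
  rw [fourier_apply_eq, fourier_apply_eq, ← integral_conj, ← integral_const_mul,
    ← integral_sub_left_eq_self _ volume x]
  refine integral_congr_ae (Eventually.of_forall fun y => ?_)
  simp only [sub_sub_cancel, map_mul, Complex.conj_ofReal, conj_fourierChar_neg, inner_sub_left,
    neg_sub]
  rw [← mul_assoc, ← Circle.coe_mul, ← AddChar.map_add_eq_mul, neg_add_eq_sub]

/-- Square integrability is obtained on the Fourier side, where conjugation and a unimodular factor
do not change the modulus. -/
theorem exists_isTranslatedKernel {φ : Space n → ℝ} {α : ℝ}
    (hi : Integrable fun x => (dilate φ α x : ℂ))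
    (hΨ : MemLp (𝓕 fun x => (dilate φ α x : ℂ)) 2 volume) (x : Space n) :
    ∃ e, IsTranslatedKernel φ α (𝓕 fun x => (dilate φ α x : ℂ)) x e := by
  have hmem := memLp_of_norm_eq hΨ ((measurable_fourierChar_inner x).mul
    (Complex.continuous_conj.measurable.comp (continuous_fourier hi).measurable)) fun η => by
      rw [Pi.mul_apply, norm_mul, Circle.norm_coe, one_mul, Function.comp_apply, RCLike.norm_conj]
  have hE := hmem.coeFn_toLp
  refine ⟨𝓕⁻ (hmem.toLp _), fourierInv_ae_eq_of_fourier_ae_eq (hi.comp_sub_left x) ?_, ?_⟩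
  · refine hE.trans (Eventually.of_forall fun η => ?_)
    exact (fourier_translate (φ := dilate φ α) x η).symm
  · rw [FourierTransform.fourier_fourierInv_eq]
    exact hE

theorem hasReconstructionKernel_of_integrable {φ : Space n → ℝ} {ϱ : ℝ → ℝ}
    (hγ : γ ∈ Ioo (0 : ℝ) 1) (hT : 0 < T) (hm : Measurable φ) (hφ : Integrable φ)
    (h1 : ∫ x, φ x = 1) (hK : KernelCondition γ T (fourierL1 φ) ϱ) {α : ℝ} (hα : 0 < α)
    (h2 : MemLp (fun ξ : Space n => fourierL1 φ (α • ξ) / (symbol γ T ξ : ℂ)) 2 volume) :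
    HasReconstructionKernel γ T (flow γ T) φ α := by
  have h := IsMollifierSymbol.of_integrable hγ hT hm hφ h1 hK
  have hc : (((2 * Real.pi) ^ (-(n : ℝ) / 2) : ℝ) : ℂ) ≠ 0 :=
    Complex.ofReal_ne_zero.2 (two_pi_rpow_pos n).ne'
  have hdiv : MemLp (fun η => 𝓕 (fun x => (dilate φ α x : ℂ)) η / flowSym γ T η) 2 volume := by
    have h3 := (memLp_comp_smul h2 Real.two_pi_pos.ne').const_mul
      ((((2 * Real.pi) ^ (-(n : ℝ) / 2) : ℝ) : ℂ)⁻¹)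
    refine h3.congr_norm ((h.bddMeas_div hγ.1 hα).1.aestronglyMeasurable)
      (Eventually.of_forall fun η => ?_)
    rw [smul_comm, fourierL1_two_pi_smul, ← fourier_dilate φ hα, mul_div_assoc,
      inv_mul_cancel_left₀ hc]
    rfl
  have hi := integrable_dilate hφ hα
  -- Since the symbol of the flow is at most `1`, square integrability of the quotient implies that
  -- of the transform of the kernel.
  refine h.hasReconstructionKernel hγ hT hα hdiv
    (exists_isTranslatedKernel hi (hdiv.of_le (continuous_fourier hi).aestronglyMeasurable
      (Eventually.of_forall fun η => ?_)))
  have hne := flowSym_ne_zero hγ hT.le η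
  rw [norm_div, le_div_iff₀ (norm_pos_iff.2 hne)]
  exact mul_le_of_le_one_right (norm_nonneg _) (norm_flowSym_le hγ hT.le η)

end

section

variable {n : ℕ} {γ T : ℝ}

/-! ### The Dirichlet kernel -/

theorem dilate_dirichletKernel (α : ℝ) :
    dilate (dirichletKernel n 1) α = dirichletKernel n (1 / α) := by
  ext x
  have h : (α ^ n)⁻¹ = ∏ _j : Fin n, α⁻¹ := by
    rw [Finset.prod_const, Finset.card_univ, Fintype.card_fin, inv_pow]
  rw [dilate, dirichletKernel, dirichletKernel, h, ← Finset.prod_mul_distrib]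
  refine Finset.prod_congr rfl fun j _ => ?_
  rw [PiLp.smul_apply, smul_eq_mul, one_mul, one_div, one_div, ← mul_assoc, div_eq_mul_inv]

theorem dirichletKernel_neg (ν : ℝ) (x : Space n) :
    dirichletKernel n ν (-x) = dirichletKernel n ν x := by
  simp only [dirichletKernel, PiLp.neg_apply, mul_neg, Real.sinc_neg]

theorem cubeIndicator_smul {ν α : ℝ} (hα : 0 < α) (ξ : Space n) :
    cubeIndicator n ν (α • ξ) = cubeIndicator n (ν / α) ξ := by
  have : ∀ j, |(α • ξ) j| ≤ ν ↔ |ξ j| ≤ ν / α := fun j => by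
    rw [PiLp.smul_apply, smul_eq_mul, abs_mul, abs_of_pos hα, le_div_iff₀' hα]
  simp only [cubeIndicator, indicator, mem_ofPred_eq, this]

theorem norm_sq_le_of_abs_le {ν : ℝ} {ξ : Space n} (h : ∀ j, |ξ j| ≤ ν) :
    ‖ξ‖ ^ 2 ≤ n * ν ^ 2 := by
  rw [EuclideanSpace.norm_sq_eq]
  calc ∑ j, ‖ξ j‖ ^ 2 ≤ ∑ _j : Fin n, ν ^ 2 :=
        Finset.sum_le_sum fun j _ => pow_le_pow_left₀ (norm_nonneg _) (h j) 2
    _ = n * ν ^ 2 := by simp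

theorem isClosed_cube (ν : ℝ) : IsClosed {ξ : Space n | ∀ j, |ξ j| ≤ ν} := by
  simp only [ofPred_forall]
  exact isClosed_iInter fun j => isClosed_le (by fun_prop) continuous_const

theorem volume_cube_ne_top (ν : ℝ) : volume {ξ : Space n | ∀ j, |ξ j| ≤ ν} ≠ ⊤ := by
  refine ((Metric.isBounded_closedBall (x := (0 : Space n)) (r := √(n * ν ^ 2))).subset
    fun ξ hξ => ?_).measure_lt_top.ne
  rw [mem_closedBall_zero_iff]
  exact Real.le_sqrt_of_sq_le (norm_sq_le_of_abs_le hξ)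

theorem measurable_cubeIndicator (ν : ℝ) : Measurable (cubeIndicator n ν) :=
  measurable_const.indicator (isClosed_cube ν).measurableSet

theorem memLp_cubeIndicator (p : ℝ≥0∞) (ν : ℝ) : MemLp (cubeIndicator n ν) p volume :=
  memLp_indicator_const p (isClosed_cube ν).measurableSet 1 (Or.inr (volume_cube_ne_top ν))

theorem norm_cubeIndicator_le (ν : ℝ) (ξ : Space n) : ‖cubeIndicator n ν ξ‖ ≤ 1 :=
  (norm_indicator_le_norm_self _ ξ).trans norm_one.le

theorem conj_cubeIndicator (ν : ℝ) (ξ : Space n) :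
    (starRingEnd ℂ) (cubeIndicator n ν ξ) = cubeIndicator n ν ξ := by
  by_cases h : ξ ∈ {ξ : Space n | ∀ j, |ξ j| ≤ ν}
  · rw [cubeIndicator, indicator_of_mem h, map_one]
  · rw [cubeIndicator, indicator_of_notMem h, map_zero]

/-- The symbol of the cut-off at the frequency `ν`. -/
def cutoff (n : ℕ) (ν : ℝ) (η : Space n) : ℂ := cubeIndicator n ν ((2 * Real.pi) • η)

theorem cutoff_eq (ν : ℝ) : cutoff n ν = cubeIndicator n (ν / (2 * Real.pi)) :=
  funext fun η => cubeIndicator_smul Real.two_pi_pos η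

theorem bddMeas_cutoff (ν : ℝ) : BddMeas (cutoff n ν) :=
  ⟨(measurable_cubeIndicator ν).comp (measurable_const_smul _), 1,
    fun _ => norm_cubeIndicator_le ν _⟩

theorem memLp_cutoff (p : ℝ≥0∞) (ν : ℝ) : MemLp (cutoff n ν) p volume := by
  rw [cutoff_eq]
  exact memLp_cubeIndicator p _

theorem intervalIntegral_exp_mul_I (a c : ℝ) :
    ∫ s in -a..a, Complex.exp ((c * s : ℝ) * Complex.I) = (2 * a * Real.sinc (c * a) : ℝ) := by
  rcases eq_or_ne c 0 with rfl | hc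
  · simp [two_mul]
  · rw [intervalIntegral.integral_comp_mul_left
      (fun t : ℝ => Complex.exp ((t : ℂ) * Complex.I)) hc, mul_neg, integral_exp_mul_I_eq_sinc,
      Complex.real_smul]
    push_cast
    have : (c : ℂ) ≠ 0 := Complex.ofReal_ne_zero.2 hc
    field_simp

theorem integral_indicator_mul_fourierChar {a : ℝ} (ha : 0 ≤ a) (x : ℝ) :
    ∫ s : ℝ, (Real.fourierChar (x * s) : ℂ) * {s : ℝ | |s| ≤ a}.indicator (fun _ => 1) s =
      (2 * a * Real.sinc (2 * Real.pi * x * a) : ℝ) := by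
  have hs : {s : ℝ | |s| ≤ a} = Icc (-a) a := by
    ext s
    rw [mem_ofPred_eq, abs_le, mem_Icc]
  have h : ∀ s : ℝ, (Real.fourierChar (x * s) : ℂ) * (Icc (-a) a).indicator (fun _ => 1) s =
      (Icc (-a) a).indicator (fun s => Complex.exp ((2 * Real.pi * x * s : ℝ) * Complex.I)) s := by
    intro s
    by_cases h : s ∈ Icc (-a) a
    · rw [indicator_of_mem h, indicator_of_mem h, mul_one, Real.fourierChar_apply, mul_assoc (2 * _)]
    · rw [indicator_of_notMem h, indicator_of_notMem h, mul_zero]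
  simp only [hs, h]
  rw [integral_indicator measurableSet_Icc, integral_Icc_eq_integral_Ioc,
    ← intervalIntegral.integral_of_le (by linarith), intervalIntegral_exp_mul_I]

theorem cubeIndicator_eq_prod (ν : ℝ) (ξ : Space n) :
    cubeIndicator n ν ξ = ∏ j, {s : ℝ | |s| ≤ ν}.indicator (fun _ => (1 : ℂ)) (ξ j) := by
  by_cases h : ∀ j, |ξ j| ≤ ν
  · rw [cubeIndicator, indicator_of_mem (show ξ ∈ {ξ : Space n | ∀ j, |ξ j| ≤ ν} from h)]
    exact (Finset.prod_eq_one fun j _ => indicator_of_mem (show ξ j ∈ {s : ℝ | |s| ≤ ν} from h j) _).symm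
  · rw [cubeIndicator, indicator_of_notMem (show ξ ∉ {ξ : Space n | ∀ j, |ξ j| ≤ ν} from h)]
    obtain ⟨j, hj⟩ := not_forall.1 h
    exact (Finset.prod_eq_zero (Finset.mem_univ j)
      (indicator_of_notMem (show ξ j ∉ {s : ℝ | |s| ≤ ν} from hj) _)).symm

/-- The Dirichlet kernel is the inverse Fourier integral of the cut-off. -/
theorem fourierInv_cutoff {ν : ℝ} (hν : 0 < ν) (x : Space n) :
    𝓕⁻ (cutoff n ν) x = (dirichletKernel n ν x : ℂ) := by
  rw [fourierInv_apply_eq, cutoff_eq, ← (PiLp.volume_preserving_toLp (Fin n)).integral_comp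
    (MeasurableEquiv.toLp 2 (Fin n → ℝ)).measurableEmbedding]
  -- The character and the indicator of the cube both factor over the coordinates, so the integral
  -- is a product of one-dimensional ones.
  have h : ∀ s : Fin n → ℝ, (Real.fourierChar ⟪x, WithLp.toLp 2 s⟫_ℝ : ℂ) *
      cubeIndicator n (ν / (2 * Real.pi)) (WithLp.toLp 2 s) =
      ∏ j, ((Real.fourierChar (x j * s j) : ℂ) *
        {s : ℝ | |s| ≤ ν / (2 * Real.pi)}.indicator (fun _ => 1) (s j)) := by
    intro s
    rw [Finset.prod_mul_distrib, cubeIndicator_eq_prod]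
    congr 1
    simp only [Real.fourierChar_apply, ← Complex.exp_sum, PiLp.inner_apply, Finset.mul_sum,
      Complex.ofReal_sum, Finset.sum_mul]
    congr 1
    refine Finset.sum_congr rfl fun j _ => ?_
    simp [mul_comm]
  simp only [h]
  rw [integral_fintype_prod_volume_eq_prod (fun j s => (Real.fourierChar (x j * s) : ℂ) *
    {s : ℝ | |s| ≤ ν / (2 * Real.pi)}.indicator (fun _ => 1) s), dirichletKernel,
    Complex.ofReal_prod]
  refine Finset.prod_congr rfl fun j _ => ?_
  rw [integral_indicator_mul_fourierChar (by positivity)]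
  congr 2
  · field_simp
  · congr 1
    field_simp

/-- No Fourier integral of the kernel itself is used. The construction starts from the cut-off,
which lies in `L¹ ∩ L²`, so its inverse Plancherel transform is an explicit integral. -/
theorem exists_translate_dirichletKernel {ν : ℝ} (hν : 0 < ν) (x : Space n) :
    ∃ e : L2 n, (e =ᵐ[volume] fun y => (dirichletKernel n ν (x - y) : ℂ)) ∧
      (𝓕 e : L2 n) =ᵐ[volume] fun η =>
        (Real.fourierChar (-⟪x, η⟫_ℝ) : ℂ) * (starRingEnd ℂ) (cutoff n ν η) := by
  have hm : Measurable fun η => (Real.fourierChar (-⟪x, η⟫_ℝ) : ℂ) *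
      (starRingEnd ℂ) (cutoff n ν η) :=
    (measurable_fourierChar_inner x).mul
      (Complex.continuous_conj.measurable.comp (bddMeas_cutoff ν).1)
  have hn : ∀ η, ‖(Real.fourierChar (-⟪x, η⟫_ℝ) : ℂ) * (starRingEnd ℂ) (cutoff n ν η)‖ =
      ‖cutoff n ν η‖ := fun η => by rw [norm_mul, Circle.norm_coe, one_mul, RCLike.norm_conj]
  have hmem := memLp_of_norm_eq (memLp_cutoff 2 ν) hm hn
  have hE := hmem.coeFn_toLp
  have hint : Integrable (hmem.toLp _) :=
    ((memLp_one_iff_integrable.1 (memLp_cutoff 1 ν)).mono hm.aestronglyMeasurable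
      (Eventually.of_forall fun η => (hn η).le)).congr hE.symm
  refine ⟨𝓕⁻ (hmem.toLp _), ?_, ?_⟩
  · refine (fourierInv_ae_eq_of_integrable hint).trans (Eventually.of_forall fun y => ?_)
    simp only
    -- Evenness replaces `x - y` by `y - x`, the argument that arises from multiplying the
    -- characters.
    rw [← dirichletKernel_neg, neg_sub, ← fourierInv_cutoff hν, fourierInv_apply_eq,
      fourierInv_apply_eq]
    refine integral_congr_ae ?_
    filter_upwards [hE] with η hη
    rw [hη, cutoff, conj_cubeIndicator, ← mul_assoc, ← Circle.coe_mul, ← AddChar.map_add_eq_mul,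
      inner_sub_left, sub_eq_add_neg]
  · rw [FourierTransform.fourier_fourierInv_eq]
    exact hE

theorem exists_fourierL2_dirichletKernel : ∃ d : L2 n,
    d =ᵐ[volume] (fun x => (dirichletKernel n 1 x : ℂ)) ∧
      fourierL2 d =ᵐ[volume] fun ξ =>
        (((2 * Real.pi) ^ (-(n : ℝ) / 2) : ℝ) : ℂ) * cubeIndicator n 1 ξ := by
  obtain ⟨d, h1, h2⟩ := exists_translate_dirichletKernel (n := n) one_pos 0
  refine ⟨d, h1.trans (Eventually.of_forall fun x => ?_), ?_⟩
  · simp only [zero_sub, dirichletKernel_neg]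
  · filter_upwards [ae_comp_smul (inv_ne_zero Real.two_pi_pos.ne') h2] with ξ hξ
    rw [fourierL2, hξ, cutoff, conj_cubeIndicator, smul_inv_smul₀ Real.two_pi_pos.ne',
      inner_zero_left, neg_zero, AddChar.map_zero_eq_one, Circle.coe_one, one_mul]

/-- On the cube `|ξ|² ≤ n ν²`, and `1/E` grows at most linearly in `|ξ|²`; off the cube both sides
vanish. Keeping the indicator on the right also yields square integrability of the quotient. -/
theorem norm_cubeIndicator_div_symbol_le (hγ : γ ∈ Ioo (0 : ℝ) 1) (hT : 0 < T) (ν : ℝ)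
    (ξ : Space n) : ‖cubeIndicator n ν ξ‖ / symbol γ T ξ ≤
      (1 + Real.Gamma (1 - γ) * T ^ γ * n) * (1 + ν ^ 2) * ‖cubeIndicator n ν ξ‖ := by
  by_cases h : ∀ j, |ξ j| ≤ ν
  · rw [cubeIndicator, indicator_of_mem (show ξ ∈ {ξ : Space n | ∀ j, |ξ j| ≤ ν} from h),
      norm_one, one_div, mul_one]
    have hG : 0 < Real.Gamma (1 - γ) := Real.Gamma_pos_of_pos (by linarith [hγ.2])
    have hTγ := Real.rpow_pos_of_pos hT γ
    calc (symbol γ T ξ)⁻¹ ≤ 1 + Real.Gamma (1 - γ) * T ^ γ * ‖ξ‖ ^ 2 :=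
          inv_mlFlow_le hγ (sq_nonneg _) hT
      _ ≤ 1 + Real.Gamma (1 - γ) * T ^ γ * (n * ν ^ 2) := by
          gcongr
          exact norm_sq_le_of_abs_le h
      _ ≤ _ := by
          have : 0 ≤ Real.Gamma (1 - γ) * T ^ γ * n := by positivity
          nlinarith [sq_nonneg ν]
  · rw [cubeIndicator, indicator_of_notMem (show ξ ∉ {ξ : Space n | ∀ j, |ξ j| ≤ ν} from h),
      norm_zero, zero_div, mul_zero]

theorem norm_cutoff_div_flowSym_le (hγ : γ ∈ Ioo (0 : ℝ) 1) (hT : 0 < T) (ν : ℝ)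
    (η : Space n) : ‖cutoff n ν η / flowSym γ T η‖ ≤
      (1 + Real.Gamma (1 - γ) * T ^ γ * n) * (1 + ν ^ 2) * ‖cutoff n ν η‖ := by
  have hs : 0 < symbol γ T ((2 * Real.pi) • η) := mlFlow_pos hγ (freqSq_nonneg η) hT.le
  rw [norm_div, flowSym, Complex.norm_real, Real.norm_of_nonneg hs.le]
  exact norm_cubeIndicator_div_symbol_le hγ hT ν _

theorem const_cube_nonneg (hγ : γ ∈ Ioo (0 : ℝ) 1) (hT : 0 < T) (ν : ℝ) :
    0 ≤ (1 + Real.Gamma (1 - γ) * T ^ γ * n) * (1 + ν ^ 2) := by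
  have hG : 0 < Real.Gamma (1 - γ) := Real.Gamma_pos_of_pos (by linarith [hγ.2])
  have hTγ := Real.rpow_pos_of_pos hT γ
  positivity

theorem kernelCondition_cubeIndicator (hγ : γ ∈ Ioo (0 : ℝ) 1) (hT : 0 < T) :
    ∃ C : ℝ, KernelCondition γ T
      (fun ξ : Space n => (((2 * Real.pi) ^ (-(n : ℝ) / 2) : ℝ) : ℂ) * cubeIndicator n 1 ξ)
      (fun α => C * (1 + 1 / α ^ 2)) := by
  refine ⟨(2 * Real.pi) ^ (-(n : ℝ) / 2) * (1 + Real.Gamma (1 - γ) * T ^ γ * n),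
    fun α hα ξ => ?_⟩
  rw [norm_mul, Complex.norm_real, Real.norm_of_nonneg (two_pi_rpow_pos n).le, mul_div_assoc,
    cubeIndicator_smul hα]
  simp only
  rw [mul_assoc ((2 * Real.pi) ^ (-(n : ℝ) / 2)), ← one_div_pow]
  refine mul_le_mul_of_nonneg_left ?_ (two_pi_rpow_pos n).le
  exact (norm_cubeIndicator_div_symbol_le hγ hT _ ξ).trans
    (mul_le_of_le_one_right (const_cube_nonneg hγ hT _) (norm_cubeIndicator_le _ _))

theorem exists_isTranslatedKernel_dirichletKernel {α : ℝ} (hα : 0 < α) (x : Space n) :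
    ∃ e, IsTranslatedKernel (dirichletKernel n 1) α (cutoff n (1 / α)) x e := by
  simp only [IsTranslatedKernel, dilate_dirichletKernel α]
  exact exists_translate_dirichletKernel (one_div_pos.2 hα) x

/-- At each frequency the cut-off equals `1` once `1/α ≥ |ξ|`, so convergence is eventual equality.
The convolution is identified through the square integrable translates of the kernel. -/
theorem isMollifierSymbol_dirichletKernel (hγ : γ ∈ Ioo (0 : ℝ) 1) (hT : 0 < T) :
    IsMollifierSymbol γ T (dirichletKernel n 1) (fun α => cutoff n (1 / α))
      fun α => (1 + Real.Gamma (1 - γ) * T ^ γ * n) * (1 + (1 / α) ^ 2) := by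
  refine ⟨fun α _ => (bddMeas_cutoff _).1, ⟨1, fun α _ η => norm_cubeIndicator_le _ _⟩,
    fun η => ?_, fun α _ η => (norm_cutoff_div_flowSym_le hγ hT _ η).trans
      (mul_le_of_le_one_right (const_cube_nonneg hγ hT _) (norm_cubeIndicator_le _ _)),
    fun α hα f => ?_⟩
  · refine tendsto_const_nhds.congr' ?_
    filter_upwards [tendsto_inv_nhdsGT_zero.eventually_ge_atTop ‖(2 * Real.pi) • η‖] with α h
    have hmem : (2 * Real.pi) • η ∈ {ξ : Space n | ∀ j, |ξ j| ≤ 1 / α} := fun j => by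
      rw [one_div]
      exact (PiLp.norm_apply_le _ j).trans h
    rw [cutoff, cubeIndicator, indicator_of_mem hmem]
  · choose e he using exists_isTranslatedKernel_dirichletKernel (n := n) hα
    exact isMollification_of_isTranslatedKernel (bddMeas_cutoff _) (memLp_cutoff 2 _) he f

theorem hasReconstructionKernel_dirichletKernel (hγ : γ ∈ Ioo (0 : ℝ) 1) (hT : 0 < T) {α : ℝ}
    (hα : 0 < α) : HasReconstructionKernel γ T (flow γ T) (dirichletKernel n 1) α := by
  have h := isMollifierSymbol_dirichletKernel (n := n) hγ hT
  exact h.hasReconstructionKernel hγ hT hα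
    ((memLp_cutoff 2 (1 / α)).of_le_mul (h.bddMeas_div hγ.1 hα).1.aestronglyMeasurable
      (Eventually.of_forall (norm_cutoff_div_flowSym_le hγ hT _)))
    (exists_isTranslatedKernel_dirichletKernel hα)

/-- Mollification with the Dirichlet kernel is Fourier regularization. -/
theorem fourierL2_solution_dirichletKernel (hγ : γ ∈ Ioo (0 : ℝ) 1) (hT : 0 < T) {ν : ℝ}
    (hν : 0 < ν) {g h : L2 n} {u : ℝ → L2 n}
    (H : IsMollification (dirichletKernel n 1) (1 / ν) g h) (hu : IsSolution γ T h u) {t : ℝ}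
    (ht : t ∈ Icc 0 T) :
    fourierL2 (u t) =ᵐ[volume] fun ξ =>
      cubeIndicator n ν ξ * ((symbol γ t ξ / symbol γ T ξ : ℝ) : ℂ) * fourierL2 g ξ := by
  have hS := isMollifierSymbol_dirichletKernel (n := n) hγ hT
  have hα : 0 < 1 / ν := one_div_pos.2 hν
  rw [fourierL2_ae_iff (σ := fun ξ => cubeIndicator n ν ξ *
    ((symbol γ t ξ / symbol γ T ξ : ℝ) : ℂ))]
  have h1 := (eq_fourierMul_iff (bddMeas_flowSym hγ ht.1)).1 (hu.eq_flow hγ hT ht)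
  have h2 := (eq_fourierMul_iff (hS.bddMeas_div hγ.1 hα)).1 (hS.initial_eq hγ hT hα H hu)
  filter_upwards [h1, h2] with η h3 h4
  rw [h3, h4, cutoff, one_div_one_div, flowSym, flowSym, Complex.ofReal_div]
  ring

end

end FractionalDiffusion

end

theorem mainTheorem9 (n : ℕ) (hn : 0 < n) (γ : ℝ) (hγ : γ ∈ Set.Ioo (0 : ℝ) 1)
    (T : ℝ) (hT : 0 < T) :
    ∃ A : L2 n →L[ℂ] L2 n,
      -- the forward operator, and its relation to the final value problem
      IsForwardOperator γ T A ∧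
      (∀ f g, A f = g ↔ ∃ u, IsSolution γ T g u ∧ u 0 = f) ∧
      -- the general statement, and the identification with the approximate inverse
      (∀ φ : Space n → ℝ, ContDiff ℝ ∞ φ → Integrable φ → ∫ x, φ x = 1 →
        ∀ ϱ : ℝ → ℝ,
          KernelCondition γ T (fourierL1 φ) ϱ →
          DefinesRegularizationMethod γ T φ ∧
          ∀ α > 0, MollifiesSolution γ T φ α ∧
            (MemLp (fun ξ : Space n =>
                fourierL1 φ (α • ξ) /
                  (symbol γ T ξ : ℂ)) 2 volume →
              HasReconstructionKernel γ T A φ α)) ∧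
      -- mollification by the Dirichlet kernel; for `n = 1` this is Fourier regularization
      (∀ ν > 0, dilate (dirichletKernel n 1) (1 / ν) =
        dirichletKernel n ν) ∧
      (∃ d : L2 n, d =ᵐ[volume] (fun x => (dirichletKernel n 1 x : ℂ)) ∧
        fourierL2 d =ᵐ[volume] fun ξ =>
          (((2 * Real.pi) ^ (-(n : ℝ) / 2) : ℝ) : ℂ) *
            cubeIndicator n 1 ξ) ∧
      (∃ C : ℝ, KernelCondition γ T
        (fun ξ => (((2 * Real.pi) ^ (-(n : ℝ) / 2) : ℝ) : ℂ) *
          cubeIndicator n 1 ξ)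
        (fun α => C * (1 + 1 / α ^ 2))) ∧
      DefinesRegularizationMethod γ T
        (dirichletKernel n 1) ∧
      (∀ α > 0,
        MollifiesSolution γ T (dirichletKernel n 1) α ∧
        HasReconstructionKernel γ T A
          (dirichletKernel n 1) α) ∧
      (∀ ν > 0, ∀ (g h : L2 n) (u : ℝ → L2 n),
        IsMollification (dirichletKernel n 1) (1 / ν) g h →
        IsSolution γ T h u → ∀ t ∈ Set.Icc 0 T,
          fourierL2 (u t) =ᵐ[volume] fun ξ =>
            cubeIndicator n ν ξ *
              ((symbol γ t ξ / symbol γ T ξ : ℝ) : ℂ) *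
              fourierL2 g ξ) := by
  -- The forward operator is the solution operator at time `T`. Smooth integrable kernels and the
  -- Dirichlet kernel both enter through `IsMollifierSymbol`.
  refine ⟨flow γ T, isForwardOperator_flow hγ hT, flow_eq_iff hγ hT,
    fun φ hφ hφi h1 ϱ hK => ?_, fun ν _ => ?_, exists_fourierL2_dirichletKernel,
    kernelCondition_cubeIndicator hγ hT,
    (isMollifierSymbol_dirichletKernel hγ hT).definesRegularizationMethod hγ hT,
    fun α hα => ⟨(isMollifierSymbol_dirichletKernel hγ hT).mollifiesSolution hγ hT hα,
      hasReconstructionKernel_dirichletKernel hγ hT hα⟩,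
    fun ν hν g h u H hu t ht => fourierL2_solution_dirichletKernel hγ hT hν H hu ht⟩
  · have hm : Measurable φ := hφ.continuous.measurable
    have h := IsMollifierSymbol.of_integrable hγ hT hm hφi h1 hK
    exact ⟨h.definesRegularizationMethod hγ hT, fun α hα => ⟨h.mollifiesSolution hγ hT hα,
      hasReconstructionKernel_of_integrable hγ hT hm hφi h1 hK hα⟩⟩
  · rw [dilate_dirichletKernel, one_div_one_div]
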